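/- Let $\mathbb{M}$ be a smooth compact manifold of dimension $n+m$ with a Riemannian metric $g$ and a foliation with $m$-dimensional leaves such that $g$ is bundle-like and the leaves are totally geodesic. Let $\mathcal V$ be the tangent bundle of the leaves, $\mathcal H=\mathcal V^\perp$, $\pi_{\mathcal V},\pi_{\mathcal H}$ the orthogonal projections, $\nabla^g$ the Levi-Civita connection, $\mu$ the Riemannian volume measure, and $\nabla$ the Bott connection: $\nabla_XY$ equals $\pi_{\mathcal H}\nabla^g_XY$ for $X,Y\in\mathcal H$, $\pi_{\mathcal H}[X,Y]$ for $X\in\mathcal V,Y\in\mathcal H$, $\pi_{\mathcal V}[X,Y]$ for $X\in\mathcal H,Y\in\mathcal V$, and $\pi_{\mathcal V}\nabla^g_XY$ for $X,Y\in\mathcal V$. Let $T$ be its torsion and $\mathrm{Ric}$ its Ricci curvature. Let $\langle J_ZX,Y\rangle=\langle Z,T(X,Y)\rangle$ for $Z\in\mathcal V$, $X,Y\in\mathcal H$, with $J_Z$ taking values in $\mathcal H$, $J_Z=0$ on $\mathcal V$, and $J_Z=0$ for $Z\in\mathcal H$. With local orthonormal frames $X_1,\dots,X_n$ of $\mathcal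 H$ and $Z_1,\dots,Z_m$ of $\mathcal V$, put $$\mathbf J^2=\sum_{l=1}^m J_{Z_l}J_{Z_l},\qquad \delta_{\mathcal H}T(X)=-\sum_{j=1}^n(\nabla_{X_j}T)(X_j,X).$$ An endomorphism field $A$ of $T\mathbb M$ acts on one-forms by $\langle A\eta,\xi\rangle=\xi(A\sharp\eta)$, and $\mathrm{Ric}_{\mathcal H}$ acts on one-forms by $\langle\mathrm{Ric}_{\mathcal H}\eta,\xi\rangle=\mathrm{Ric}(\pi_{\mathcal H}\sharp\eta,\pi_{\mathcal H}\sharp\xi)$, where $\langle\cdot,\cdot\rangle$ and $\sharp$ are those of $g$. For $0<\varepsilon\le\infty$ (with $1/\infty=0$) let $$\nabla^\varepsilon_XY=\nabla_XY-T(X,Y)+\tfrac1\varepsilon J_YX,$$ let $\nabla^\varepsilon_{\mathcal H}\eta=\sum_i\nabla^\varepsilon_{X_i}\eta\otimes\theta_i$, where $\theta_i=\langle X_i,\cdot\rangle$, and let $$\delta_{\mathcal H,\varepsilon}\omega(V_1,\dots,V_{p-1})=-\sum_{i=1}^n(\nabla^\varepsilon_{X_i}\omega)(X_i,V_1,\dots,V_{p-1})$$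 be the horizontal divergence of a $p$-form. On smooth one-forms let $$\Delta_{\mathcal H,\varepsilon}=-(\nabla^\varepsilon_{\mathcal H})^*\nabla^\varepsilon_{\mathcal H}-\tfrac1\varepsilon\,\delta_{\mathcal H}T-\tfrac1\varepsilon\,\mathbf J^2-\mathrm{Ric}_{\mathcal H}.$$ Here, for $\varepsilon<\infty$, the adjoint is taken for the $L^2(\mu)$ product associated with $\|\eta\|_\varepsilon^2=\|\eta\|_{\mathcal H}^2+\varepsilon\|\eta\|_{\mathcal V}^2$, and for $\varepsilon=\infty$ the first term denotes $\sum_i(\nabla^\infty_{X_i})^2-\nabla^\infty_{\nabla^\infty_{X_i}X_i}$. Then, for every $0<\varepsilon\le\infty$: 1. if $\varepsilon<\infty$, then $-(\nabla^\varepsilon_{\mathcal H})^*\nabla^\varepsilon_{\mathcal H}=\sum_i(\nabla^\varepsilon_{X_i})^2-\nabla^\varepsilon_{\nabla^\varepsilon_{X_i}X_i}$ on smooth one-forms; 2. on smooth one-forms, $\Delta_{\mathcal H,\varepsilon}=-d\,\delta_{\mathcal H,\varepsilon}-\delta_{\mathcal H,\varepsilon}\,d$; 3. for every $f\in C^\infty(\mathbb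 M)$ there is a unique smooth function $\Delta_{\mathcal H}f$ with $\int\langle\pi_{\mathcal H}\nabla f,\pi_{\mathcal H}\nabla u\rangle\,d\mu=-\int u\,\Delta_{\mathcal H}f\,d\mu$ for all $u\in C^\infty(\mathbb M)$, and $d\Delta_{\mathcal H}f=\Delta_{\mathcal H,\varepsilon}df$. -/

import Mathlib

open scoped Manifold ContDiff Bundle ENNReal
open MeasureTheory

noncomputable section

namespace TGFoliation

variable {d : ℕ} {M : Type*} [TopologicalSpace M]
  [ChartedSpace (EuclideanSpace ℝ (Fin d)) M] [IsManifold (𝓡 d) ∞ M]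

/-- Vector fields on the `d`-dimensional manifold `M`; no regularity is built in. -/
abbrev VField (d : ℕ) (M : Type*) [TopologicalSpace M]
    [ChartedSpace (EuclideanSpace ℝ (Fin d)) M] : Type _ :=
  Π x : M, TangentSpace (𝓡 d) x

/-- Fields of real functions on the tangent spaces. One-forms are those that are fibrewise linear,
see `IsSmoothOneForm`. -/
abbrev CoField (d : ℕ) (M : Type*) [TopologicalSpace M]
    [ChartedSpace (EuclideanSpace ℝ (Fin d)) M] : Type _ :=
  Π x : M, TangentSpace (𝓡 d) x → ℝ

/-- Fields of real functions of two tangent vectors (two-forms, when alternating bilinear). -/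
abbrev CoField₂ (d : ℕ) (M : Type*) [TopologicalSpace M]
    [ChartedSpace (EuclideanSpace ℝ (Fin d)) M] : Type _ :=
  Π x : M, TangentSpace (𝓡 d) x → TangentSpace (𝓡 d) x → ℝ

/-- A field of subspaces of the tangent spaces. -/
abbrev Distribution (d : ℕ) (M : Type*) [TopologicalSpace M]
    [ChartedSpace (EuclideanSpace ℝ (Fin d)) M] : Type _ :=
  Π x : M, Submodule ℝ (TangentSpace (𝓡 d) x)

/-- `X` is smooth on `U`. -/
def SmoothFieldOn (X : VField d M) (U : Set M) : Prop :=
  ContMDiffOn (𝓡 d) (𝓡 d).tangent ∞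
    (fun x => (⟨x, X x⟩ : TangentBundle (𝓡 d) M)) U

/-- A real function is smooth. -/
def SmoothFun (f : M → ℝ) : Prop := ContMDiff (𝓡 d) 𝓘(ℝ, ℝ) ∞ f

/-- Smooth one-forms: fibrewise linear, and smooth when evaluated on local smooth vector fields. -/
def IsSmoothOneForm (α : CoField d M) : Prop :=
  (∀ x, IsLinearMap ℝ (α x)) ∧
    ∀ (U : Set M) (X : VField d M), IsOpen U → SmoothFieldOn X U →
      ContMDiffOn (𝓡 d) 𝓘(ℝ, ℝ) ∞ (fun x => α x (X x)) U

/-- `X` is a smooth section of `D` over `U`. -/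
def IsLocalSection (D : Distribution d M) (U : Set M) (X : VField d M) : Prop :=
  SmoothFieldOn X U ∧ ∀ x ∈ U, X x ∈ D x

/-- `D` is a smooth subbundle of rank `m` of the tangent bundle. -/
def IsSmoothDistribution (m : ℕ) (D : Distribution d M) : Prop :=
  ∀ x₀ : M, ∃ U : Set M, IsOpen U ∧ x₀ ∈ U ∧ ∃ Z : Fin m → VField d M,
    (∀ l, SmoothFieldOn (Z l) U) ∧
    ∀ x ∈ U, LinearIndependent ℝ (fun l => Z l x) ∧
      Submodule.span ℝ (Set.range fun l => Z l x) = D x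

/-- The Lie bracket of vector fields. -/
abbrev bracket (X Y : VField d M) : VField d M := VectorField.mlieBracket (𝓡 d) X Y

/-- A foliation with `m`-dimensional leaves, given by the tangent distribution of its leaves:
an involutive smooth distribution of rank `m`. -/
structure IsFoliation (m : ℕ) (D : Distribution d M) : Prop where
  smooth : IsSmoothDistribution m D
  involutive : ∀ (U : Set M) (X Y : VField d M), IsOpen U →
    IsLocalSection D U X → IsLocalSection D U Y → ∀ x ∈ U, bracket X Y x ∈ D x

/-- The derivative `v f` of a function in the direction of a tangent vector. -/
def dirDeriv (f : M → ℝ) (x : M) (v : TangentSpace (𝓡 d) x) : ℝ :=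
  mvfderiv (𝓡 d) f x v

/-- An extension of a tangent vector at `x` to a vector field that is smooth near `x`. -/
abbrev ext {x : M} (v : TangentSpace (𝓡 d) x) : VField d M :=
  FiberBundle.extend (EuclideanSpace ℝ (Fin d)) v

/-- The exterior derivative of a function. -/
def extD₀ (f : M → ℝ) : CoField d M := fun x v => dirDeriv f x v

/-- The exterior derivative of a one-form,
`dα(X, Y) = X (α(Y)) - Y (α(X)) - α([X, Y])`. -/
def extD₁ (α : CoField d M) : CoField₂ d M := fun x v w =>
  dirDeriv (fun y => α y (ext w y)) x v - dirDeriv (fun y => α y (ext v y)) x w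
    - α x (bracket (ext v) (ext w) x)

section Connection

/-- A rule `(X, Y) ↦ ∇_X Y` on vector fields. -/
abbrev Conn (d : ℕ) (M : Type*) [TopologicalSpace M]
    [ChartedSpace (EuclideanSpace ℝ (Fin d)) M] : Type _ :=
  VField d M → VField d M → VField d M

/-- The torsion `T(X, Y) = ∇_X Y - ∇_Y X - [X, Y]`. -/
def torsion (D : Conn d M) (X Y : VField d M) : VField d M := fun x =>
  D X Y x - D Y X x - bracket X Y x

/-- The covariant derivative of the torsion,
`(∇_X T)(Y, Z) = ∇_X (T(Y, Z)) - T(∇_X Y, Z) - T(Y, ∇_X Z)`. -/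
def covTorsion (D : Conn d M) (X Y Z : VField d M) : VField d M := fun x =>
  D X (torsion D Y Z) x - torsion D (D X Y) Z x - torsion D Y (D X Z) x

/-- The curvature `R(X, Y)Z = ∇_X ∇_Y Z - ∇_Y ∇_X Z - ∇_{[X, Y]} Z`. -/
def curvature (D : Conn d M) (X Y Z : VField d M) : VField d M := fun x =>
  D X (D Y Z) x - D Y (D X Z) x - D (bracket X Y) Z x

/-- The covariant derivative of a one-form, `(∇_X α)(W) = X (α(W)) - α(∇_X W)`. -/
def covForm (D : Conn d M) (X : VField d M) (α : CoField d M) : CoField d M := fun x w =>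
  dirDeriv (fun y => α y (ext w y)) x (X x) - α x (D X (ext w) x)

/-- The covariant derivative of a two-form,
`(∇_X τ)(V, W) = X (τ(V, W)) - τ(∇_X V, W) - τ(V, ∇_X W)`. -/
def covForm₂ (D : Conn d M) (X : VField d M) (τ : CoField₂ d M) : CoField₂ d M := fun x v w =>
  dirDeriv (fun y => τ y (ext v y) (ext w y)) x (X x)
    - τ x (D X (ext v) x) w - τ x v (D X (ext w) x)

end Connection

variable [Bundle.RiemannianBundle (fun x : M => TangentSpace (𝓡 d) x)]

instance (x : M) : FiniteDimensional ℝ (TangentSpace (𝓡 d) x) :=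
  inferInstanceAs (FiniteDimensional ℝ (EuclideanSpace ℝ (Fin d)))

/-- `∑ᵢ F(eᵢ)` over an orthonormal basis `e` of the subspace `S` of the tangent space at `x`. -/
def frameSum {A : Type*} [AddCommMonoid A] {x : M} (S : Submodule ℝ (TangentSpace (𝓡 d) x))
    (F : TangentSpace (𝓡 d) x → A) : A :=
  ∑ i, F (stdOrthonormalBasis ℝ S i : TangentSpace (𝓡 d) x)

/-- The vector `♯a` dual to the covector `a`. -/
def sharp {x : M} (a : TangentSpace (𝓡 d) x → ℝ) : TangentSpace (𝓡 d) x :=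
  frameSum (⊤ : Submodule ℝ (TangentSpace (𝓡 d) x)) fun e => a e • e

/-- The right-hand side of Koszul's formula, an expression for `⟨∇^g_X Y, W⟩`. -/
def koszul (X Y W : VField d M) (x : M) : ℝ :=
  (1 / 2 : ℝ) *
    (dirDeriv (fun y => inner ℝ (Y y) (W y)) x (X x)
      + dirDeriv (fun y => inner ℝ (X y) (W y)) x (Y x)
      - dirDeriv (fun y => inner ℝ (X y) (Y y)) x (W x)
      + inner ℝ (bracket X Y x) (W x)
      - inner ℝ (bracket X W x) (Y x)
      - inner ℝ (bracket Y W x) (X x))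

/-- The Levi-Civita connection `∇^g`: the vector `∇^g_X Y` at `x` is the one whose inner product
with each `w` is given by Koszul's formula. -/
def leviCivita : Conn d M := fun X Y x => sharp fun w => koszul X Y (ext w) x

/-- A foliation, with tangent distribution `V` of rank `m`, for which the metric is bundle-like
(`(L_Z g)(X, X) = 0` for `Z` vertical and `X` horizontal) and whose leaves are totally geodesic
(`∇^g_Y Z` is vertical for `Y`, `Z` vertical). -/
structure IsTotallyGeodesicRiemannianFoliation (m : ℕ) (V : Distribution d M) : Prop
    extends IsFoliation m V where
  bundleLike : ∀ (U : Set M) (Z X : VField d M), IsOpen U →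
    IsLocalSection V U Z → IsLocalSection (fun x => (V x)ᗮ) U X →
    ∀ x ∈ U, dirDeriv (fun y => inner ℝ (X y) (X y)) x (Z x)
      - 2 * inner ℝ (bracket Z X x) (X x) = 0
  totallyGeodesic : ∀ (U : Set M) (Y Z : VField d M), IsOpen U →
    IsLocalSection V U Y → IsLocalSection V U Z → ∀ x ∈ U, leviCivita Y Z x ∈ V x

variable (V : Distribution d M)

/-- The vertical component of a tangent vector. -/
def projV (x : M) (v : TangentSpace (𝓡 d) x) : TangentSpace (𝓡 d) x := (V x).starProjection v

/-- The horizontal component of a tangent vector. -/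
def projH (x : M) (v : TangentSpace (𝓡 d) x) : TangentSpace (𝓡 d) x := (V x)ᗮ.starProjection v

/-- The vertical part of a vector field. -/
def partV (X : VField d M) : VField d M := fun x => projV V x (X x)

/-- The horizontal part of a vector field. -/
def partH (X : VField d M) : VField d M := fun x => projH V x (X x)

/-- The Bott connection. -/
def bott : Conn d M := fun X Y x =>
  projH V x (leviCivita (partH V X) (partH V Y) x)
    + projH V x (bracket (partV V X) (partH V Y) x)
    + projV V x (bracket (partH V X) (partV V Y) x)
    + projV V x (leviCivita (partV V X) (partV V Y) x)

/-- The torsion of the Bott connection, evaluated on two tangent vectors at `x`. -/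
def torsionAt (x : M) (v w : TangentSpace (𝓡 d) x) : TangentSpace (𝓡 d) x :=
  torsion (bott V) (ext v) (ext w) x

/-- The endomorphism `J_z`: for `z` vertical, `⟨J_z v, w⟩ = ⟨z, T(v, w)⟩` for `v`, `w` horizontal
and `J_z v = 0` for `v` vertical; moreover `J_z = 0` for `z` horizontal. -/
def J (x : M) (z v : TangentSpace (𝓡 d) x) : TangentSpace (𝓡 d) x :=
  frameSum (V x)ᗮ fun e => (inner ℝ (projV V x z) (torsionAt V x (projH V x v) e) : ℝ) • e

/-- `𝐉² = ∑ₗ J_{Z_l} J_{Z_l}` over an orthonormal vertical frame. -/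
def Jsq (x : M) (v : TangentSpace (𝓡 d) x) : TangentSpace (𝓡 d) x :=
  frameSum (V x) fun z => J V x z (J V x z v)

/-- The horizontal divergence of the torsion, `δ_H T(v) = - ∑ⱼ (∇_{X_j} T)(X_j, v)`. -/
def deltaT (x : M) (v : TangentSpace (𝓡 d) x) : TangentSpace (𝓡 d) x :=
  - frameSum (V x)ᗮ fun e => covTorsion (bott V) (ext e) (ext e) (ext v) x

/-- The Ricci curvature of the Bott connection. -/
def ricci (x : M) (v w : TangentSpace (𝓡 d) x) : ℝ :=
  frameSum (⊤ : Submodule ℝ (TangentSpace (𝓡 d) x)) fun e =>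
    inner ℝ (curvature (bott V) (ext e) (ext v) (ext w) x) e

/-- The horizontal Ricci curvature on one-forms: `⟨Ric_H(α), β⟩ = Ric((♯α)_H, (♯β)_H)`. -/
def ricH (α : CoField d M) : CoField d M := fun x v =>
  ricci V x (projH V x (sharp (α x))) (projH V x v)

/-- The action on one-forms of a field `A` of endomorphisms of the tangent spaces, by the duality
of the metric `g`: `⟨A α, β⟩ = β(A ♯α)`. -/
def onForms (A : Π x : M, TangentSpace (𝓡 d) x → TangentSpace (𝓡 d) x) (α : CoField d M) :
    CoField d M := fun x v =>
  inner ℝ (A x (sharp (α x))) v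

/-- The real number `1 / ε`, where `1 / ∞ = 0`. -/
def recip (ε : ℝ≥0∞) : ℝ := (ε⁻¹).toReal

/-- The connection `∇^ε_X Y = ∇_X Y - T(X, Y) + (1 / ε) J_Y X`. -/
def connEps (ε : ℝ≥0∞) : Conn d M := fun X Y x =>
  bott V X Y x - torsion (bott V) X Y x + recip ε • J V x (Y x) (X x)

/-- The horizontal divergence of a one-form, `- ∑ᵢ (∇^ε_{X_i} α)(X_i)`. The sum is the trace of a
tensor, so that it may be computed at each point with any extension of an orthonormal basis of the
horizontal space. The same remark applies to the other sums over horizontal frames. -/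
def divEps₁ (ε : ℝ≥0∞) (α : CoField d M) : M → ℝ := fun x =>
  - frameSum (V x)ᗮ fun e => covForm (connEps V ε) (ext e) α x e

/-- The horizontal divergence of a two-form, `w ↦ - ∑ᵢ (∇^ε_{X_i} τ)(X_i, w)`. -/
def divEps₂ (ε : ℝ≥0∞) (τ : CoField₂ d M) : CoField d M := fun x w =>
  - frameSum (V x)ᗮ fun e => covForm₂ (connEps V ε) (ext e) τ x e w

/-- `∑ᵢ (∇^ε_{X_i})² - ∇^ε_{∇^ε_{X_i} X_i}` on one-forms. -/
def roughLaplacian (ε : ℝ≥0∞) (α : CoField d M) : CoField d M := fun x w =>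
  frameSum (V x)ᗮ fun e =>
    covForm (connEps V ε) (ext e) (covForm (connEps V ε) (ext e) α) x w
      - covForm (connEps V ε) (connEps V ε (ext e) (ext e)) α x w

/-- The inner product `⟨a, b⟩_ε = ⟨a, b⟩_H + ε ⟨a, b⟩_V` of covectors, for finite `ε`. -/
def innerEps (ε : ℝ≥0∞) (x : M) (a b : TangentSpace (𝓡 d) x → ℝ) : ℝ :=
  frameSum (V x)ᗮ (fun e => a e * b e) + ε.toReal * frameSum (V x) (fun z => a z * b z)

/-- The inner product `⟨∇^ε_H α, ∇^ε_H β⟩_ε`, where `∇^ε_H α = ∑ᵢ ∇^ε_{X_i} α ⊗ θ_i`. -/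
def innerGradEps (ε : ℝ≥0∞) (α β : CoField d M) (x : M) : ℝ :=
  frameSum (V x)ᗮ fun e =>
    innerEps V ε x (covForm (connEps V ε) (ext e) α x) (covForm (connEps V ε) (ext e) β x)

/-- The horizontal gradient of a function. -/
def gradH (f : M → ℝ) : VField d M := fun x => projH V x (sharp (extD₀ f x))

/-- The horizontal Laplacian on one-forms. -/
def lapEps (ε : ℝ≥0∞) (α : CoField d M) : CoField d M := fun x v =>
  roughLaplacian V ε α x v - recip ε * onForms (deltaT V) α x v
    - recip ε * onForms (Jsq V) α x v - ricH V α x v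

section Volume

variable (d M)
variable [MeasurableSpace M]

/-- The Gram matrix `⟨∂ᵢ, ∂ⱼ⟩` of the coordinate fields of the chart at `c`, at the point with
coordinates `y`. -/
def gram (c : M) (y : EuclideanSpace ℝ (Fin d)) : Matrix (Fin d) (Fin d) ℝ :=
  let φ := extChartAt (𝓡 d) c
  let b : Fin d → TangentSpace (𝓡 d) (φ.symm y) := fun i =>
    mfderiv 𝓘(ℝ, EuclideanSpace ℝ (Fin d)) (𝓡 d) φ.symm y (EuclideanSpace.single i (1 : ℝ))
  Matrix.of fun i j => inner ℝ (b i) (b j)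

/-- The measure `√(det ⟨∂ᵢ, ∂ⱼ⟩) dy` on the domain of the chart at `c`. -/
def chartVolume (c : M) : Measure M :=
  (((volume : Measure (EuclideanSpace ℝ (Fin d))).restrict
      (extChartAt (𝓡 d) c).target).withDensity
        fun y => ENNReal.ofReal (Real.sqrt (gram d M c y).det)).map (extChartAt (𝓡 d) c).symm

/-- The Riemannian volume measure. The measures `chartVolume` agree on the intersections of the
chart domains, and their supremum is the measure that restricts to each of them. -/
def riemannianVolume : Measure M := ⨆ c : M, chartVolume d M c

end Volume

variable [MeasurableSpace M]

/-- `β = -(∇^ε_H)^* ∇^ε_H α` (for finite `ε`), where the adjoint is taken for the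
`L²` product `∫ ⟨·, ·⟩_ε dμ`. -/
def IsNegAdjointGrad (ε : ℝ≥0∞) (α β : CoField d M) : Prop :=
  IsSmoothOneForm β ∧ ∀ η : CoField d M, IsSmoothOneForm η →
    ∫ x, innerEps V ε x (β x) (η x) ∂(riemannianVolume d M)
      = - ∫ x, innerGradEps V ε α η x ∂(riemannianVolume d M)

/-- `h = Δ_H f`: the function `h` is smooth and `∫ ⟨∇_H f, ∇_H u⟩ dμ = - ∫ u h dμ` for all smooth
functions `u`. -/
def IsHorizontalLaplacian (f h : M → ℝ) : Prop :=
  SmoothFun (d := d) h ∧ ∀ u : M → ℝ, SmoothFun (d := d) u →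
    ∫ x, (inner ℝ (gradH V f x) (gradH V u x) : ℝ) ∂(riemannianVolume d M)
      = - ∫ x, u x * h x ∂(riemannianVolume d M)

end TGFoliation

end

/-! The core is a Weitzenböck formula, proved algebraically and before traces are taken. Smooth
functions and vector fields satisfy the axioms of `FoliatedLieRinehart`. These axioms imply that the
Bott connection preserves the metric and the splitting into horizontal and vertical fields
(`der_ip`, `pv_nab`), that its torsion `T` is vertical and kills vertical arguments, and that `J` is
dual to `T`. The connection adjoint to `∇^ε`, namely `(Y, E) ↦ ∇_Y E + (1/ε) J_Y E`, differs from
`∇^ε_E Y` by the bracket `[E, Y]` (`cn_eq_br_add`), and it is metric because `J_Y` is skew.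

For horizontal `E`, `weitzenboeck` compares one term of the rough Laplacian with the matching terms
of `-dδ - δd`. The difference is the curvature of the adjoint connection plus symmetric expressions
in `E` and its derivative along `W` under that connection. Traced over a horizontal orthonormal
frame, the symmetric expressions vanish because the derivative is skew (`sum_skew_eq_zero`). The
curvature yields `δ_H T` and `𝐉²` (`deltaT_apply`, `Jsq_apply`) and, through the first Bianchi
identity, `Ric_H` (`ip_curv_eq`). Only the constant `r = 1/ε` enters, so `ε = ∞` is simply `r = 0`.

For finite `ε`, the connection that `∇^ε` induces on one-forms preserves `⟨·, ·⟩_ε` (`der_ipE`).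
Hence the rough Laplacian paired with `β`, plus the pairing of the horizontal gradients, is the
horizontal trace of the derivative of the field dual to `X ↦ ⟨∇^ε_{X_H} α, β⟩_ε`. Since the leaves
are totally geodesic, this trace is the full Riemannian divergence (`lcForm_of_vertical`), and
`integral_divFn` gives the adjoint formula. The divergence theorem itself is derived from the
definition of the volume in charts, by Jacobi's formula for the Gram determinant and a partition of
unity.

Applied to `u • ∇_H f`, the divergence theorem identifies `Δ_H f` with `div ∇_H f = -δ_{H,ε} df`,
for every `ε`. Then `d² = 0` turns the Hodge form of the Laplacian into the commutation with `d`.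

The operators of the statement use extensions of vectors that are smooth only near one point, and
arbitrary orthonormal bases. Locality and linearity over the smooth functions allow replacing these
by global sections and by frames that stay orthonormal near the point (`exists_adapted_frame`) and
may therefore be differentiated. -/

set_option linter.unusedSectionVars false

/-! ### Algebraic model of a totally geodesic Riemannian foliation. -/

/-- The algebra of vector fields and functions on a Riemannian manifold with a totally geodesic
Riemannian foliation: a Lie–Rinehart pair with a metric, the projection `pv` on the vertical
fields, and the Levi-Civita connection `lc`. -/
structure FoliatedLieRinehart (R L : Type*) [CommRing R] [AddCommGroup L] [Module R L] where
  -- The scalars form an arbitrary commutative ring; division by two is needed for Koszul's formula,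
  -- for polarisation and to annihilate skew expressions on the diagonal.
  half : R
  two_half : half + half = 1
  der : L →+ R →+ R
  der_smul : ∀ (f : R) (X : L) (g : R), der (f • X) g = f * der X g
  der_mul : ∀ (X : L) (f g : R), der X (f * g) = f * der X g + g * der X f
  br : L →+ L →+ L
  br_swap : ∀ X Y : L, br X Y = - br Y X
  br_smul : ∀ (X : L) (f : R) (Y : L), br X (f • Y) = der X f • Y + f • br X Y
  jacobi : ∀ X Y Z : L, br X (br Y Z) = br (br X Y) Z + br Y (br X Z)
  der_br : ∀ (X Y : L) (f : R), der (br X Y) f = der X (der Y f) - der Y (der X f)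
  ip : L →ₗ[R] L →ₗ[R] R
  ip_comm : ∀ X Y : L, ip X Y = ip Y X
  ip_nondeg : ∀ X : L, (∀ Y, ip X Y = 0) → X = 0
  sharp : (L →ₗ[R] R) → L
  ip_sharp : ∀ (α : L →ₗ[R] R) (Y : L), ip (sharp α) Y = α Y
  lc : L → L → L
  koszul : ∀ X Y W : L, 2 * ip (lc X Y) W
    = der X (ip Y W) + der Y (ip X W) - der W (ip X Y)
      + ip (br X Y) W - ip (br X W) Y - ip (br Y W) X
  pv : L →ₗ[R] L
  pv_pv : ∀ X : L, pv (pv X) = pv X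
  ip_pv : ∀ X Y : L, ip (pv X) Y = ip X (pv Y)
  involutive : ∀ X Y : L, pv (br (pv X) (pv Y)) = br (pv X) (pv Y)
  bundleLike : ∀ Z X : L, der (pv Z) (ip (X - pv X) (X - pv X))
    = 2 * ip (br (pv Z) (X - pv X)) (X - pv X)
  totallyGeodesic : ∀ X Y : L, pv (lc (pv X) (pv Y)) = lc (pv X) (pv Y)

namespace FoliatedLieRinehart

variable {R L : Type*} [CommRing R] [AddCommGroup L] [Module R L]
  (F : FoliatedLieRinehart R L)

lemma two_cancel (F : FoliatedLieRinehart R L) {a b : R} (h : 2 * a = 2 * b) : a = b := by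
  linear_combination F.half * h - (a - b) * F.two_half

lemma eq_of_ip {X Y : L} (h : ∀ W, F.ip X W = F.ip Y W) : X = Y := by
  rw [← sub_eq_zero]
  exact F.ip_nondeg _ fun W => by simp [h W]

lemma smul_br (f : R) (X Y : L) : F.br (f • X) Y = f • F.br X Y - F.der Y f • X := by
  rw [F.br_swap, F.br_smul, F.br_swap Y X, smul_neg]; abel

/-- The horizontal projection. -/
def ph : L →ₗ[R] L := LinearMap.id - F.pv

lemma ph_apply (X : L) : F.ph X = X - F.pv X := rfl

@[simp] lemma pv_pv' (X : L) : F.pv (F.pv X) = F.pv X := F.pv_pv X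

@[simp] lemma ph_ph (X : L) : F.ph (F.ph X) = F.ph X := by simp [ph_apply]

@[simp] lemma ph_pv (X : L) : F.ph (F.pv X) = 0 := by simp [ph_apply]

@[simp] lemma pv_ph (X : L) : F.pv (F.ph X) = 0 := by simp [ph_apply]

lemma ph_add_pv (X : L) : F.ph X + F.pv X = X := by simp [ph_apply]

lemma ip_ph (X Y : L) : F.ip (F.ph X) Y = F.ip X (F.ph Y) := by simp [ph_apply, F.ip_pv]

@[simp] lemma ip_ph_pv (X Y : L) : F.ip (F.ph X) (F.pv Y) = 0 := by rw [ip_ph]; simp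

@[simp] lemma ip_pv_ph (X Y : L) : F.ip (F.pv X) (F.ph Y) = 0 := by rw [F.ip_pv]; simp

lemma ip_of_horizontal {E X : L} (hE : F.pv E = 0) : F.ip (F.ph X) E = F.ip X E := by
  simp [ph_apply, F.ip_pv, hE]

lemma eq_ph {E : L} (hE : F.pv E = 0) : F.ph E = E := by simp [ph_apply, hE]

lemma eq_pv {E : L} (hE : F.ph E = 0) : F.pv E = E := by
  rw [ph_apply, sub_eq_zero] at hE; exact hE.symm

/-! ### The Levi-Civita connection -/

lemma ip_lc_comm (X Y W : L) : F.ip (F.lc X Y) W + F.ip Y (F.lc X W) = F.der X (F.ip Y W) := by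
  apply F.two_cancel
  have h1 := F.koszul X Y W
  have h2 := F.koszul X W Y
  rw [F.ip_comm Y (F.lc X W)]
  rw [F.ip_comm W Y, F.br_swap W Y] at h2
  simp only [map_neg, LinearMap.neg_apply] at h1 h2
  linear_combination h1 + h2

lemma lc_torsion (X Y : L) : F.lc X Y - F.lc Y X = F.br X Y := by
  refine F.eq_of_ip fun W => F.two_cancel ?_
  have h1 := F.koszul X Y W
  have h2 := F.koszul Y X W
  rw [F.ip_comm Y X, F.br_swap Y X] at h2
  simp only [map_neg, map_sub, LinearMap.neg_apply, LinearMap.sub_apply] at h1 h2 ⊢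
  linear_combination h1 - h2

lemma lc_add_right (X Y Y' : L) : F.lc X (Y + Y') = F.lc X Y + F.lc X Y' := by
  refine F.eq_of_ip fun W => F.two_cancel ?_
  have h1 := F.koszul X Y W
  have h2 := F.koszul X Y' W
  have h3 := F.koszul X (Y + Y') W
  simp only [map_add, LinearMap.add_apply, AddMonoidHom.add_apply] at h1 h2 h3 ⊢
  linear_combination h3 - h1 - h2

lemma lc_add_left (X X' Y : L) : F.lc (X + X') Y = F.lc X Y + F.lc X' Y := by
  refine F.eq_of_ip fun W => F.two_cancel ?_
  have h1 := F.koszul X Y W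
  have h2 := F.koszul X' Y W
  have h3 := F.koszul (X + X') Y W
  simp only [map_add, LinearMap.add_apply, AddMonoidHom.add_apply] at h1 h2 h3 ⊢
  linear_combination h3 - h1 - h2

lemma lc_smul_right (X : L) (f : R) (Y : L) :
    F.lc X (f • Y) = F.der X f • Y + f • F.lc X Y := by
  refine F.eq_of_ip fun W => F.two_cancel ?_
  have h1 := F.koszul X Y W
  have h2 := F.koszul X (f • Y) W
  rw [F.br_smul, F.smul_br] at h2
  simp only [map_add, map_sub, map_smul, LinearMap.add_apply, LinearMap.smul_apply, smul_eq_mul,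
    LinearMap.sub_apply, F.der_mul, F.der_smul] at h1 h2 ⊢
  rw [F.ip_comm Y X] at h2
  linear_combination h2 - f * h1

lemma lc_smul_left (f : R) (X Y : L) : F.lc (f • X) Y = f • F.lc X Y := by
  refine F.eq_of_ip fun W => F.two_cancel ?_
  have h1 := F.koszul X Y W
  have h2 := F.koszul (f • X) Y W
  rw [F.smul_br, F.smul_br] at h2
  simp only [map_sub, map_smul, LinearMap.smul_apply, smul_eq_mul,
    LinearMap.sub_apply, F.der_mul, F.der_smul] at h1 h2 ⊢
  rw [F.ip_comm X Y] at h1 h2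
  rw [F.ip_comm X W, F.ip_comm Y W] at h2
  rw [F.ip_comm X W, F.ip_comm Y W] at h1
  linear_combination h2 - f * h1

/-- Differentiating the zero pairing of a horizontal with a vertical field along a leaf moves the
derivative onto the vertical field, where it stays vertical because the leaves are totally geodesic.
This later removes the vertical part of the divergence of a horizontal field. -/
lemma ip_lc_vertical (Y Z Z' : L) : F.ip (F.lc (F.pv Z) (F.ph Y)) (F.pv Z') = 0 := by
  have h := F.ip_lc_comm (F.pv Z) (F.ph Y) (F.pv Z')
  rw [← F.totallyGeodesic Z Z'] at h
  simpa using h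

/-! ### The Bott connection -/

/-- The Bott connection. -/
def bott (X Y : L) : L :=
  F.ph (F.lc (F.ph X) (F.ph Y)) + F.ph (F.br (F.pv X) (F.ph Y))
    + F.pv (F.br (F.ph X) (F.pv Y)) + F.pv (F.lc (F.pv X) (F.pv Y))

/-- The brackets produce extra terms in which `f` is differentiated; each is a multiple of a
vertical field under `ph` or of a horizontal field under `pv`, hence zero. -/
lemma bott_smul_left (f : R) (X Y : L) : F.bott (f • X) Y = f • F.bott X Y := by
  simp only [bott, map_smul, lc_smul_left, smul_br, map_sub, ph_pv, pv_ph]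
  module

lemma bott_smul_right (X : L) (f : R) (Y : L) :
    F.bott X (f • Y) = F.der X f • Y + f • F.bott X Y := by
  have h1 : F.der X f = F.der (F.ph X) f + F.der (F.pv X) f := by
    rw [← AddMonoidHom.add_apply, ← map_add, F.ph_add_pv]
  have h2 : Y = F.ph Y + F.pv Y := (F.ph_add_pv Y).symm
  conv_rhs => rw [h1]; enter [1]; rw [h2]
  simp only [bott, map_smul, lc_smul_right, F.br_smul, map_add, ph_ph, pv_pv']
  module

/-- The Bott connection as a biadditive map. -/
def nab : L →+ L →+ L :=
  AddMonoidHom.mk' (fun X => AddMonoidHom.mk' (F.bott X) fun Y Y' => by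
    simp only [bott, map_add, lc_add_right]; abel) fun X X' => by
    ext Y
    simp only [bott, map_add, lc_add_left, AddMonoidHom.add_apply, AddMonoidHom.mk'_apply]; abel

lemma nab_def (X Y : L) : F.nab X Y = F.bott X Y := rfl

lemma nab_smul_left (f : R) (X Y : L) : F.nab (f • X) Y = f • F.nab X Y := F.bott_smul_left f X Y

lemma nab_smul_right (X : L) (f : R) (Y : L) :
    F.nab X (f • Y) = F.der X f • Y + f • F.nab X Y := F.bott_smul_right X f Y

lemma lc_zero_right (X : L) : F.lc X 0 = 0 := by simpa using F.lc_add_right X 0 0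

lemma lc_zero_left (X : L) : F.lc 0 X = 0 := by simpa using F.lc_add_left 0 0 X

lemma pv_nab (X Y : L) : F.pv (F.nab X Y) = F.nab X (F.pv Y) := by
  simp [nab_def, bott, lc_zero_right]

lemma ph_nab (X Y : L) : F.ph (F.nab X Y) = F.nab X (F.ph Y) := by
  simp [nab_def, bott, lc_zero_right]

lemma ip_split (X Y : L) : F.ip X Y = F.ip (F.ph X) (F.ph Y) + F.ip (F.pv X) (F.pv Y) := by
  conv_lhs => rw [← F.ph_add_pv X, ← F.ph_add_pv Y]
  simp

/-- Polarisation of `bundleLike`: vertical fields preserve the transverse metric infinitesimally. -/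
lemma der_vertical_ip (X Y Z : L) : F.der (F.pv X) (F.ip (F.ph Y) (F.ph Z))
    = F.ip (F.br (F.pv X) (F.ph Y)) (F.ph Z) + F.ip (F.ph Y) (F.br (F.pv X) (F.ph Z)) := by
  apply F.two_cancel
  have h1 := F.bundleLike X Y
  have h2 := F.bundleLike X Z
  have h3 := F.bundleLike X (Y + Z)
  simp only [← ph_apply] at h1 h2 h3
  simp only [map_add, LinearMap.add_apply] at h3
  rw [F.ip_comm (F.ph Z) (F.ph Y)] at h3
  rw [F.ip_comm (F.ph Y) (F.br _ _)]
  linear_combination h3 - h1 - h2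

/-- This is Koszul's formula for two vertical fields, tested on a horizontal one. Its left side
vanishes because the leaves are totally geodesic, the term with the bracket of the vertical fields
by involutivity, and two derivatives by orthogonality. -/
lemma der_horizontal_ip (X Y Z : L) : F.der (F.ph X) (F.ip (F.pv Y) (F.pv Z))
    = F.ip (F.br (F.ph X) (F.pv Y)) (F.pv Z) + F.ip (F.pv Y) (F.br (F.ph X) (F.pv Z)) := by
  have h := (F.koszul (F.pv Y) (F.pv Z) (F.ph X)).symm
  rw [← F.totallyGeodesic, ← F.involutive, F.br_swap (F.pv Y) (F.ph X),
    F.br_swap (F.pv Z) (F.ph X)] at h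
  simp only [ip_pv_ph, map_zero, map_neg, LinearMap.neg_apply] at h
  rw [F.ip_comm (F.pv Y) (F.br _ _)]
  linear_combination - h

/-- The Bott connection is metric. -/
lemma der_ip (X Y Z : L) :
    F.der X (F.ip Y Z) = F.ip (F.nab X Y) Z + F.ip Y (F.nab X Z) := by
  -- There are four cases, by the type of the direction and of the pairing. Equal types use that the
  -- Levi-Civita connection is metric; the mixed cases use the bundle-like condition and the total
  -- geodesy.
  have h1 := F.ip_lc_comm (F.ph X) (F.ph Y) (F.ph Z)
  have h2 := F.ip_lc_comm (F.pv X) (F.pv Y) (F.pv Z)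
  have h3 := F.der_vertical_ip X Y Z
  have h4 := F.der_horizontal_ip X Y Z
  rw [F.ip_split Y Z, F.ip_split _ Z, F.ip_split Y, ph_nab, ph_nab, pv_nab, pv_nab]
  have h0 : ∀ g, F.der X g = F.der (F.ph X) g + F.der (F.pv X) g := fun g => by
    rw [← AddMonoidHom.add_apply, ← map_add, F.ph_add_pv]
  rw [h0, map_add, map_add]
  have p1 : ∀ A B, F.ip (F.ph A) (F.ph B) = F.ip A (F.ph B) := fun A B => by rw [ip_ph, ph_ph]
  have p2 : ∀ A B, F.ip (F.ph A) (F.ph B) = F.ip (F.ph A) B := fun A B => by rw [← ip_ph, ph_ph]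
  have p3 : ∀ A B, F.ip (F.pv A) (F.pv B) = F.ip A (F.pv B) := fun A B => by
    rw [F.ip_pv, pv_pv]
  have p4 : ∀ A B, F.ip (F.pv A) (F.pv B) = F.ip (F.pv A) B := fun A B => by
    rw [← F.ip_pv, pv_pv]
  simp only [nab_def, bott, map_add, ph_ph, pv_ph, ph_pv, pv_pv', map_zero,
    add_zero, zero_add, lc_zero_right, LinearMap.add_apply]
  rw [p1 (F.lc _ _), p1 (F.br _ _), p2 _ (F.lc _ _), p2 _ (F.br _ _),
    p3 (F.lc _ _), p3 (F.br _ _), p4 _ (F.lc _ _), p4 _ (F.br _ _)]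
  linear_combination - h1 - h2 + h3 + h4

/-! ### Torsion -/

/-- The torsion of the Bott connection. -/
def tor (X Y : L) : L := F.nab X Y - F.nab Y X - F.br X Y

lemma tor_swap (X Y : L) : F.tor X Y = - F.tor Y X := by
  rw [tor, tor, F.br_swap]; abel

lemma tor_add_left (X X' Y : L) : F.tor (X + X') Y = F.tor X Y + F.tor X' Y := by
  simp only [tor, map_add, AddMonoidHom.add_apply]; abel

lemma tor_add_right (X Y Y' : L) : F.tor X (Y + Y') = F.tor X Y + F.tor X Y' := by
  simp only [tor, map_add, AddMonoidHom.add_apply]; abel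

lemma tor_smul_left (f : R) (X Y : L) : F.tor (f • X) Y = f • F.tor X Y := by
  simp only [tor, nab_smul_left, nab_smul_right, smul_br]; module

lemma tor_smul_right (f : R) (X Y : L) : F.tor X (f • Y) = f • F.tor X Y := by
  rw [tor_swap, tor_smul_left, F.tor_swap Y]; module

/-- The torsion as a bilinear map. -/
def torL : L →ₗ[R] L →ₗ[R] L :=
  LinearMap.mk₂ R F.tor F.tor_add_left F.tor_smul_left F.tor_add_right F.tor_smul_right

lemma torL_apply (X Y : L) : F.torL X Y = F.tor X Y := rfl

lemma br_eq (X Y : L) : F.br X Y = F.nab X Y - F.nab Y X - F.tor X Y := by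
  simp [tor]

-- For horizontal `X` the two mixed derivatives are the vertical and, up to sign, the horizontal
-- part of one bracket, so they add up to it. For vertical `X` the Bott connection is the
-- Levi-Civita connection of the leaves, which has no torsion.
@[simp] lemma tor_pv_right (X Y : L) : F.tor X (F.pv Y) = 0 := by
  have h1 : F.nab (F.ph X) (F.pv Y) - F.nab (F.pv Y) (F.ph X) - F.br (F.ph X) (F.pv Y) = 0 := by
    rw [F.br_swap (F.ph X)]
    simp only [nab_def, bott, ph_ph, pv_ph, ph_pv, pv_pv', map_zero, lc_zero_right, lc_zero_left,
      add_zero, zero_add]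
    rw [F.br_swap (F.ph X), sub_neg_eq_add, map_neg, ← sub_add_cancel (F.br (F.pv Y) (F.ph X))
      (F.pv (F.br (F.pv Y) (F.ph X))), ← ph_apply]
    simp
    abel
  have h2 : F.nab (F.pv X) (F.pv Y) - F.nab (F.pv Y) (F.pv X) - F.br (F.pv X) (F.pv Y) = 0 := by
    simp only [nab_def, bott, ph_pv, pv_pv', map_zero, lc_zero_right, zero_add]
    simp only [F.totallyGeodesic]
    rw [← F.lc_torsion]
    simp
  have h3 : F.tor X (F.pv Y) = F.tor (F.ph X) (F.pv Y) + F.tor (F.pv X) (F.pv Y) := by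
    rw [← tor_add_left, ph_add_pv]
  rw [h3, tor, tor, h1, h2, add_zero]

@[simp] lemma tor_pv_left (X Y : L) : F.tor (F.pv X) Y = 0 := by
  rw [tor_swap]; simp

lemma tor_ph (X Y : L) : F.tor (F.ph X) (F.ph Y) = F.tor X Y := by
  conv_rhs => rw [← F.ph_add_pv X, ← F.ph_add_pv Y]
  simp [tor_add_left, tor_add_right]

lemma tor_ph_right (X Y : L) : F.tor X (F.ph Y) = F.tor X Y := by
  conv_rhs => rw [← F.ph_add_pv Y]
  simp [tor_add_right]

-- On horizontal fields the horizontal part of the Bott torsion is that of the Levi-Civita torsion,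
-- which is zero.
@[simp] lemma ph_tor (X Y : L) : F.ph (F.tor X Y) = 0 := by
  rw [← tor_ph, tor, map_sub, map_sub, ph_nab, ph_nab]
  simp only [nab_def, bott, ph_ph, pv_ph, map_zero, lc_zero_right, add_zero,
      AddMonoidHom.zero_apply]
  rw [← map_sub, F.lc_torsion, sub_self]

@[simp] lemma pv_tor (X Y : L) : F.pv (F.tor X Y) = F.tor X Y := F.eq_pv (by simp)

/-! ### The maps `J` -/

/-- The one-form `W ↦ ⟨Z, T(X, W)⟩`. -/
def jform (Z X : L) : L →ₗ[R] R := F.ip Z ∘ₗ F.torL X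

/-- The endomorphism `J_Z`. -/
def jop (Z X : L) : L := F.sharp (F.jform Z X)

/-- No projection is inserted in the definition of `jop`: that `J_Z` vanishes for horizontal `Z` and
takes horizontal values follows by duality from the torsion being vertical and killing vertical
arguments. -/
lemma ip_jop (Z X W : L) : F.ip (F.jop Z X) W = F.ip Z (F.tor X W) := F.ip_sharp _ _

lemma jop_add_left (Z Z' X : L) : F.jop (Z + Z') X = F.jop Z X + F.jop Z' X :=
  F.eq_of_ip fun W => by simp [ip_jop]

lemma jop_add_right (Z X X' : L) : F.jop Z (X + X') = F.jop Z X + F.jop Z X' :=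
  F.eq_of_ip fun W => by simp [ip_jop, tor_add_left]

lemma jop_smul_left (f : R) (Z X : L) : F.jop (f • Z) X = f • F.jop Z X :=
  F.eq_of_ip fun W => by simp [ip_jop]

lemma jop_smul_right (f : R) (Z X : L) : F.jop Z (f • X) = f • F.jop Z X :=
  F.eq_of_ip fun W => by simp [ip_jop, tor_smul_left]

/-- `J` as a bilinear map. -/
def jopL : L →ₗ[R] L →ₗ[R] L :=
  LinearMap.mk₂ R F.jop F.jop_add_left F.jop_smul_left F.jop_add_right F.jop_smul_right

lemma jopL_apply (Z X : L) : F.jopL Z X = F.jop Z X := rfl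

lemma jop_of_horizontal {E : L} (hE : F.pv E = 0) (X : L) : F.jop E X = 0 :=
  F.eq_of_ip fun W => by rw [ip_jop, ← F.pv_tor, ← F.ip_pv, hE]; simp

@[simp] lemma pv_jop (Z X : L) : F.pv (F.jop Z X) = 0 :=
  F.eq_of_ip fun W => by rw [F.ip_pv, ip_jop]; simp

/-! ### The connections `∇^ε` -/

/-- The connection `∇^ε`, where `r = 1 / ε`. -/
def conn (r : R) (X Y : L) : L := F.bott X Y - F.tor X Y + r • F.jop Y X

lemma conn_def (r : R) (X Y : L) : F.conn r X Y = F.nab X Y - F.tor X Y + r • F.jop Y X := rfl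

/-- The connection `∇^ε` as a biadditive map. -/
def cn (r : R) : L →+ L →+ L :=
  AddMonoidHom.mk' (fun X => AddMonoidHom.mk' (F.conn r X) fun Y Y' => by
    simp only [conn_def, map_add, tor_add_right, jop_add_left]; module) fun X X' => by
    ext Y
    simp only [conn_def, map_add, tor_add_left, jop_add_right, AddMonoidHom.add_apply,
      AddMonoidHom.mk'_apply]; module

lemma cn_def (r : R) (X Y : L) : F.cn r X Y = F.nab X Y - F.tor X Y + r • F.jop Y X := rfl

lemma cn_smul_left (r : R) (f : R) (X Y : L) : F.cn r (f • X) Y = f • F.cn r X Y := by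
  simp only [cn_def, nab_smul_left, tor_smul_left, jop_smul_right]; module

lemma cn_smul_right (r : R) (X : L) (f : R) (Y : L) :
    F.cn r X (f • Y) = F.der X f • Y + f • F.cn r X Y := by
  simp only [cn_def, nab_smul_right, tor_smul_right, jop_smul_left]; module

/-- The terms after the bracket form the connection adjoint to `∇^ε`, as a derivative of `E` along
`Y`. It is metric for constant `r`, because `J_Y` is skew; the Weitzenböck formula rests on this. -/
lemma cn_eq_br_add (r : R) (E Y : L) :
    F.cn r E Y = F.br E Y + F.nab Y E + r • F.jop Y E := by
  rw [cn_def, br_eq]; abel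

lemma tor_self (E : L) : F.tor E E = 0 := by
  refine F.eq_of_ip fun W => F.two_cancel ?_
  have h := F.tor_swap E E
  have h2 : F.ip (F.tor E E) W = - F.ip (F.tor E E) W := by
    conv_lhs => rw [h]
    simp
  simp only [map_zero, LinearMap.zero_apply]
  linear_combination h2

/-- This removes `ε` from the diagonal: the horizontal divergence of a one-form is the same for all
`ε`. -/
lemma cn_self (r : R) {E : L} (hE : F.pv E = 0) : F.cn r E E = F.nab E E := by
  rw [cn_def, jop_of_horizontal F hE, tor_self]; simp

/-! ### Forms -/

/-- The covariant derivative of a one-form with respect to a connection. -/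
def covF (D : L →+ L →+ L) (hD : ∀ X f Y, D X (f • Y) = F.der X f • Y + f • D X Y)
    (X : L) (α : L →ₗ[R] R) : L →ₗ[R] R where
  toFun W := F.der X (α W) - α (D X W)
  map_add' W W' := by simp only [map_add]; ring
  map_smul' f W := by
    simp only [map_smul, map_add, hD, smul_eq_mul, F.der_mul, RingHom.id_apply]; ring

/-- The covariant derivative of a one-form with respect to the Bott connection. -/
def nabF (X : L) (α : L →ₗ[R] R) : L →ₗ[R] R := F.covF F.nab F.nab_smul_right X α

/-- The covariant derivative of a one-form with respect to `∇^ε`. -/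
def cnF (r : R) (X : L) (α : L →ₗ[R] R) : L →ₗ[R] R := F.covF (F.cn r) (F.cn_smul_right r) X α

lemma nabF_apply (X : L) (α : L →ₗ[R] R) (W : L) :
    F.nabF X α W = F.der X (α W) - α (F.nab X W) := rfl

lemma cnF_apply (r : R) (X : L) (α : L →ₗ[R] R) (W : L) :
    F.cnF r X α W = F.der X (α W) - α (F.cn r X W) := rfl

/-- The bilinear form `(X, W) ↦ (∇_X α)(W)`. -/
def nabFL (α : L →ₗ[R] R) : L →ₗ[R] L →ₗ[R] R :=
  LinearMap.mk₂ R (fun X W => F.nabF X α W)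
    (fun X X' W => by simp only [nabF_apply, map_add, AddMonoidHom.add_apply]; ring)
    (fun f X W => by
      simp only [nabF_apply, nab_smul_left, F.der_smul, map_smul, smul_eq_mul]; ring)
    (fun X W W' => map_add _ _ _) (fun f X W => map_smul _ _ _)

/-- The bilinear form `(X, W) ↦ (∇^ε_X α)(W)`. -/
def cnFL (r : R) (α : L →ₗ[R] R) : L →ₗ[R] L →ₗ[R] R :=
  LinearMap.mk₂ R (fun X W => F.cnF r X α W)
    (fun X X' W => by simp only [cnF_apply, map_add, AddMonoidHom.add_apply]; ring)
    (fun f X W => by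
      simp only [cnF_apply, cn_smul_left, F.der_smul, map_smul, smul_eq_mul]; ring)
    (fun X W W' => map_add _ _ _) (fun f X W => map_smul _ _ _)

lemma cnFL_apply (r : R) (α : L →ₗ[R] R) (X W : L) : F.cnFL r α X W = F.cnF r X α W := rfl

/-- The exterior derivative of a one-form. -/
def extF (α : L →ₗ[R] R) : L →ₗ[R] L →ₗ[R] R :=
  LinearMap.mk₂ R (fun X Y => F.der X (α Y) - F.der Y (α X) - α (F.br X Y))
    (fun X X' W => by simp only [map_add, AddMonoidHom.add_apply]; ring)
    (fun f X W => by
      simp only [smul_br, F.der_smul, map_smul, map_sub, smul_eq_mul, F.der_mul]; ring)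
    (fun X W W' => by simp only [map_add, AddMonoidHom.add_apply]; ring)
    (fun f X W => by
      simp only [F.br_smul, F.der_smul, map_smul, map_add, smul_eq_mul, F.der_mul]; ring)

lemma extF_apply (α : L →ₗ[R] R) (X Y : L) :
    F.extF α X Y = F.der X (α Y) - F.der Y (α X) - α (F.br X Y) := rfl

/-- The covariant derivative of a two-form with respect to `∇^ε`. -/
def cnF₂ (r : R) (τ : L →ₗ[R] L →ₗ[R] R) (X Y W : L) : R :=
  F.der X (τ Y W) - τ (F.cn r X Y) W - τ Y (F.cn r X W)

/-- The term `(∇^ε_E)² - ∇^ε_{∇^ε_E E}` of the rough Laplacian. -/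
def rough (r : R) (α : L →ₗ[R] R) (E W : L) : R :=
  F.cnF r E (F.cnF r E α) W - F.cnF r (F.cn r E E) α W

/-- The curvature of the Bott connection. -/
def curv (X Y Z : L) : L := F.nab X (F.nab Y Z) - F.nab Y (F.nab X Z) - F.nab (F.br X Y) Z

/-- The covariant derivative of the torsion. -/
def covT (X Y Z : L) : L :=
  F.nab X (F.tor Y Z) - F.tor (F.nab X Y) Z - F.tor Y (F.nab X Z)

lemma cnF_add_left (r : R) (X X' : L) (α : L →ₗ[R] R) :
    F.cnF r (X + X') α = F.cnF r X α + F.cnF r X' α := by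
  ext W; exact congrArg (fun G => G W) (map_add (F.cnFL r α) X X')

lemma cnF_smul_left (r f : R) (X : L) (α : L →ₗ[R] R) :
    F.cnF r (f • X) α = f • F.cnF r X α := by
  ext W; exact congrArg (fun G => G W) (map_smul (F.cnFL r α) f X)

lemma cnF_add_right (r : R) (X : L) (α β : L →ₗ[R] R) :
    F.cnF r X (α + β) = F.cnF r X α + F.cnF r X β := by
  ext W; simp only [cnF_apply, LinearMap.add_apply, map_add]; ring

lemma cnF_smul_right (r f : R) (X : L) (α : L →ₗ[R] R) :
    F.cnF r X (f • α) = F.der X f • α + f • F.cnF r X α := by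
  ext W
  simp only [cnF_apply, LinearMap.add_apply, LinearMap.smul_apply, smul_eq_mul, F.der_mul]; ring

/-- The second covariant derivative of a one-form with respect to `∇^ε`. -/
def hess (r : R) (α : L →ₗ[R] R) : L →ₗ[R] L →ₗ[R] L →ₗ[R] R :=
  LinearMap.mk₂ R (fun E E' => F.cnF r E (F.cnF r E' α) - F.cnF r (F.cn r E E') α)
    (fun X X' W => by simp only [map_add, AddMonoidHom.add_apply, cnF_add_left]; abel)
    (fun f X W => by simp only [cn_smul_left, cnF_smul_left]; module)
    (fun X W W' => by simp only [map_add, cnF_add_left, cnF_add_right]; abel)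
    (fun f X W => by
      simp only [cn_smul_right, cnF_smul_left, cnF_add_left, cnF_smul_right]; module)

/-- The covariant derivative of a two-form with respect to `∇^ε` is a tensor. -/
def cnF₂L (r : R) (τ : L →ₗ[R] L →ₗ[R] R) (W : L) : L →ₗ[R] L →ₗ[R] R :=
  LinearMap.mk₂ R (fun X Y => F.cnF₂ r τ X Y W)
    (fun X X' Y => by
      simp only [cnF₂, map_add, AddMonoidHom.add_apply, LinearMap.add_apply]; ring)
    (fun f X Y => by
      simp only [cnF₂, cn_smul_left, F.der_smul, map_smul, LinearMap.smul_apply, smul_eq_mul]; ring)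
    (fun X Y Y' => by
      simp only [cnF₂, map_add, LinearMap.add_apply]; ring)
    (fun f X Y => by
      simp only [cnF₂, cn_smul_right, F.der_mul, map_add, map_smul, LinearMap.add_apply,
        LinearMap.smul_apply, smul_eq_mul]; ring)

lemma cnF₂L_apply (r : R) (τ : L →ₗ[R] L →ₗ[R] R) (X Y W : L) :
    F.cnF₂L r τ W X Y = F.cnF₂ r τ X Y W := rfl

/-- The covariant derivative of the torsion is a tensor. -/
def covTL (Z : L) : L →ₗ[R] L →ₗ[R] L :=
  LinearMap.mk₂ R (fun X Y => F.covT X Y Z)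
    (fun X X' Y => by
      simp only [covT, map_add, AddMonoidHom.add_apply, tor_add_left, tor_add_right]; abel)
    (fun f X Y => by simp only [covT, nab_smul_left, tor_smul_left, tor_smul_right]; module)
    (fun X Y Y' => by
      simp only [covT, map_add, tor_add_left]; abel)
    (fun f X Y => by
      simp only [covT, nab_smul_right, tor_smul_left, tor_add_left]; module)

/-- The covariant derivative of the torsion as a linear map of its last argument. -/
def covTR (X Y : L) : L →ₗ[R] L where
  toFun Z := F.covT X Y Z
  map_add' Z Z' := by simp only [covT, map_add, tor_add_right]; abel
  map_smul' f Z := by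
    simp only [covT, nab_smul_right, tor_smul_right, tor_add_right, RingHom.id_apply]; module

/-- The difference of the two sides of the Weitzenböck formula, before traces are taken. -/
lemma weitzenboeck (r : R) (hr : ∀ X, F.der X r = 0) (S W : L) {E : L} (hE : F.pv E = 0) :
    F.rough r (F.ip S) E W - F.der W (F.nabF E (F.ip S) E) - F.cnF₂ r (F.extF (F.ip S)) E E W
      = - r * (F.nabF E (F.ip S) (F.jop W E) + F.nabF (F.jop W E) (F.ip S) E)
        - (F.nabF (F.nab W E) (F.ip S) E + F.nabF E (F.ip S) (F.nab W E))
        - r * F.ip W (F.covT E E S) - r * F.ip (F.tor S E) (F.tor W E)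
        + F.ip S (F.curv W E E) := by
  have hF : F.pv (F.nab E E) = 0 := by rw [pv_nab, hE, map_zero]
  have k1 := F.cn_eq_br_add r E W
  have k2 := F.cn_eq_br_add r E (F.cn r E W)
  have k3 := F.cn_eq_br_add r (F.nab E E) W
  -- `Q` is the derivative of `E` along `W` for the adjoint connection. It is horizontal, and `[E,
  -- W] = ∇^ε_E W - Q`.
  set Q := F.nab W E + r • F.jop W E with hQ
  have hbr : F.br E W = F.cn r E W - Q := by rw [k1, hQ]; abel
  -- The second-order terms cancel up to a derivative along the bracket.
  have hd : F.der E (F.der W (F.ip S E)) - F.der W (F.der E (F.ip S E))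
      = F.der (F.cn r E W) (F.ip S E) - F.der Q (F.ip S E) := by
    rw [← F.der_br, hbr, map_sub, AddMonoidHom.sub_apply]
  -- The left side is the curvature `R̂(W, E)E` of the adjoint connection; the terms `J_Q E` and
  -- `J_E Q` are absent since `Q` and `E` are horizontal. It is expanded into the Bott curvature,
  -- the derivative of `J` and a quadratic torsion term.
  have hZ : F.nab (F.cn r E W) E + r • F.jop (F.cn r E W) E + F.nab W (F.nab E E)
      + r • F.jop W (F.nab E E) - F.nab Q E - F.nab E Q
      = F.curv W E E - r • (F.nab E (F.jop W E) - F.jop (F.nab E W) E - F.jop W (F.nab E E))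
        - r • F.jop (F.tor E W) E := by
    have h1 : F.nab (F.br W E) E = F.nab Q E - F.nab (F.cn r E W) E := by
      rw [F.br_swap, hbr]; simp
    have h2 : F.jop (F.cn r E W) E = F.jop (F.nab E W) E - F.jop (F.tor E W) E := by
      have h3 : F.jop (F.jop W E) E = 0 := F.jop_of_horizontal (by simp) _
      simp only [cn_def, ← jopL_apply, map_add, map_sub, map_smul, LinearMap.add_apply,
        LinearMap.sub_apply, LinearMap.smul_apply] at h3 ⊢
      rw [h3]; simp
    have h4 : F.nab E Q = F.nab E (F.nab W E) + r • F.nab E (F.jop W E) := by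
      rw [hQ, map_add, nab_smul_right, hr]; simp
    rw [curv, h1, h2, h4]
    module
  -- The Bott connection being metric, the duality between `J` and `T` can be differentiated
  -- covariantly.
  have hJ : F.ip S (F.nab E (F.jop W E) - F.jop (F.nab E W) E - F.jop W (F.nab E E))
      = F.ip W (F.covT E E S) := by
    have h1 := F.der_ip E (F.jop W E) S
    have h2 := F.der_ip E W (F.tor E S)
    rw [ip_jop, ip_jop] at h1
    simp only [covT, map_sub]
    rw [F.ip_comm S, F.ip_comm S, F.ip_comm S, ip_jop, ip_jop]
    linear_combination h2 - h1
  have hT : F.ip S (F.jop (F.tor E W) E) = F.ip (F.tor S E) (F.tor W E) := by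
    rw [F.ip_comm, ip_jop, F.tor_swap S, F.tor_swap W, F.ip_comm]; simp
  have hαZ := congrArg (F.ip S) hZ
  simp only [map_add, map_sub, map_smul, smul_eq_mul] at hαZ hJ
  have a2 := congrArg (F.ip S) k2
  have a3 := congrArg (F.ip S) k3
  have aQ : F.der E (F.ip S Q) = F.der E (F.ip S (F.nab W E)) + r * F.der E (F.ip S (F.jop W E)) := by
    rw [hQ, map_add, map_add, map_smul, smul_eq_mul, F.der_mul, hr]; ring
  have aQ' : F.der Q (F.ip S E) = F.der (F.nab W E) (F.ip S E) + r * F.der (F.jop W E) (F.ip S E) := by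
    rw [hQ, map_add, AddMonoidHom.add_apply, F.der_smul]
  have aQ2 : F.ip S (F.nab E Q) = F.ip S (F.nab E (F.nab W E)) + r * F.ip S (F.nab E (F.jop W E)) := by
    rw [hQ, map_add, nab_smul_right, hr]; simp
  have aQ3 : F.ip S (F.nab Q E) = F.ip S (F.nab (F.nab W E) E) + r * F.ip S (F.nab (F.jop W E) E) := by
    rw [hQ, map_add, AddMonoidHom.add_apply, nab_smul_left]; simp
  have ab : F.der E (F.ip S (F.br E W)) = F.der E (F.ip S (F.cn r E W)) - F.der E (F.ip S Q) := by
    rw [hbr, map_sub, map_sub]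
  simp only [rough, cnF_apply, nabF_apply, cnF₂, extF_apply, F.cn_self r hE, map_sub,
    map_add, map_smul, smul_eq_mul] at a2 a3 ⊢
  rw [a2, a3, ab]
  linear_combination hd + hαZ - r * hJ - r * hT - aQ - aQ' + aQ2 + aQ3

/-! ### Curvature -/

/-- The second derivatives of `⟨A, B⟩` commute up to the bracket, and the connection is metric. -/
lemma ip_curv_swap (X Y A B : L) : F.ip (F.curv X Y A) B = - F.ip (F.curv X Y B) A := by
  have h1 := F.der_ip X (F.nab Y A) B
  have h2 := F.der_ip X A (F.nab Y B)
  have h3 := F.der_ip Y (F.nab X A) B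
  have h4 := F.der_ip Y A (F.nab X B)
  have h5 := F.der_ip (F.br X Y) A B
  have h6 := congrArg (F.der X) (F.der_ip Y A B)
  have h7 := congrArg (F.der Y) (F.der_ip X A B)
  rw [F.der_br] at h5
  simp only [curv, map_sub, LinearMap.sub_apply, map_add] at h5 h6 h7 ⊢
  simp only [F.ip_comm A] at *
  linear_combination h5 - h6 + h7 - h1 - h2 + h3 + h4

lemma curv_swap (X Y Z : L) : F.curv X Y Z = - F.curv Y X Z := by
  rw [curv, curv, F.br_swap X Y]; simp only [map_neg, AddMonoidHom.neg_apply]; abel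

lemma ph_curv (X Y Z : L) : F.ph (F.curv X Y Z) = F.curv X Y (F.ph Z) := by
  simp [curv, ph_nab]

/-- The horizontal part of the first Bianchi identity. -/
lemma bianchi (X Y Z : L) :
    F.ph (F.curv X Y Z) + F.ph (F.curv Y Z X) + F.ph (F.curv Z X Y) = 0 := by
  -- This is the first Bianchi identity with torsion, a rewriting of the Jacobi identity. Every term
  -- on the right is vertical, because the torsion is vertical and the connection preserves vertical
  -- fields.
  have key : F.curv X Y Z + F.curv Y Z X + F.curv Z X Y
      = F.nab X (F.tor Y Z) + F.nab Y (F.tor Z X) + F.nab Z (F.tor X Y)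
        + F.tor X (F.br Y Z) + F.tor Y (F.br Z X) + F.tor Z (F.br X Y) := by
    have j := F.jacobi X Y Z
    have b1 := F.br_eq X (F.br Y Z)
    have b2 := F.br_eq Y (F.br Z X)
    have b3 := F.br_eq Z (F.br X Y)
    have c1 := congrArg (F.nab X) (F.br_eq Y Z)
    have c2 := congrArg (F.nab Y) (F.br_eq Z X)
    have c3 := congrArg (F.nab Z) (F.br_eq X Y)
    have j' : F.br X (F.br Y Z) + F.br Y (F.br Z X) + F.br Z (F.br X Y) = 0 := by
      rw [j, F.br_swap (F.br X Y) Z, F.br_swap X Z]; simp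
    simp only [map_sub] at c1 c2 c3
    simp only [curv]
    rw [b1, b2, b3, c1, c2, c3, add_assoc, add_eq_zero_iff_eq_neg] at j'
    rw [← sub_eq_zero]
    rw [← sub_eq_zero] at j'
    rw [← j']
    abel
  rw [← map_add, ← map_add, key]
  simp [ph_nab]

lemma curv_add_left (X X' Y Z : L) : F.curv (X + X') Y Z = F.curv X Y Z + F.curv X' Y Z := by
  simp only [curv, map_add, AddMonoidHom.add_apply]; abel

lemma curv_add_right (X Y Z Z' : L) : F.curv X Y (Z + Z') = F.curv X Y Z + F.curv X Y Z' := by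
  simp only [curv, map_add]; abel

lemma curv_smul_left (f : R) (X Y Z : L) : F.curv (f • X) Y Z = f • F.curv X Y Z := by
  simp only [curv, nab_smul_left, nab_smul_right, smul_br, map_sub, AddMonoidHom.sub_apply]
  module

lemma curv_smul_right (X Y : L) (f : R) (Z : L) : F.curv X Y (f • Z) = f • F.curv X Y Z := by
  simp only [curv, nab_smul_right, map_add, F.der_br]
  module

/-- The curvature as a linear map of its first argument. -/
def curv₁ (Y Z : L) : L →ₗ[R] L where
  toFun X := F.curv X Y Z
  map_add' X X' := F.curv_add_left X X' Y Z
  map_smul' f X := F.curv_smul_left f X Y Z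

/-- The curvature as a linear map of its second argument. -/
def curv₂ (X Z : L) : L →ₗ[R] L := - F.curv₁ X Z

/-- The curvature as a linear map of its last argument. -/
def curv₃ (X Y : L) : L →ₗ[R] L where
  toFun Z := F.curv X Y Z
  map_add' Z Z' := F.curv_add_right X Y Z Z'
  map_smul' f Z := F.curv_smul_right X Y f Z

lemma curv₂_apply (X Y Z : L) : F.curv₂ X Z Y = F.curv X Y Z := (F.curv_swap X Y Z).symm

lemma curv₃_apply (X Y Z : L) : F.curv₃ X Y Z = F.curv X Y Z := rfl

/-- In the Bianchi identity for `W_V, E, A_H` paired with `E`, the curvature applied to `W_V` is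
vertical and the term `⟨R(A_H, W_V)E, E⟩` is zero by skewness, so the third term is zero as well. -/
lemma ip_curv_vertical (W A : L) {E : L} (hE : F.pv E = 0) :
    F.ip (F.ph A) (F.curv (F.pv W) E E) = 0 := by
  have hEh : F.ph E = E := F.eq_ph hE
  have hs : ∀ B : L, F.ip (F.curv (F.pv W) E B) E = F.ip (F.curv (F.pv W) E (F.ph B)) E := by
    intro B; rw [← F.ph_curv, F.ip_ph, hEh]
  have hb := F.bianchi (F.pv W) E (F.ph A)
  have h0 : F.ph (F.curv E (F.ph A) (F.pv W)) = 0 := by rw [ph_curv]; simp [curv]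
  rw [h0, add_zero] at hb
  have hb1 := congrArg (F.ip E) hb
  simp only [map_add, map_zero, ← F.ip_ph, hEh] at hb1
  have h3 : F.ip E (F.curv (F.ph A) (F.pv W) E) = 0 := by
    apply F.two_cancel
    have := F.ip_curv_swap (F.ph A) (F.pv W) E E
    rw [F.ip_comm]
    linear_combination this
  rw [h3, add_zero, F.ip_comm, F.ip_curv_swap] at hb1
  rw [F.ip_comm]
  linear_combination - hb1

/-- The trace term of the Weitzenböck formula is a Ricci curvature. -/
lemma ip_curv_eq (S W : L) {E : L} (hE : F.pv E = 0) :
    F.ip S (F.curv W E E) = F.ip (F.curv E (F.ph S) (F.ph W)) E := by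
  have hEh : F.ph E = E := F.eq_ph hE
  -- The curvature applied to `E` is horizontal, which removes the vertical part of `S`; the
  -- vertical part of `W` drops out by `ip_curv_vertical`. The Bianchi identity then exchanges the
  -- arguments, its middle term vanishing by skewness.
  have h1 : F.ip S (F.curv W E E) = F.ip (F.ph S) (F.curv (F.ph W) E E) := by
    have h2 := F.ip_curv_vertical W S hE
    have h3 : F.curv W E E = F.curv (F.ph W) E E + F.curv (F.pv W) E E := by
      rw [← curv_add_left, ph_add_pv]
    rw [← hEh, ← F.ph_curv, ← F.ip_ph, hEh, h3, map_add, h2, add_zero]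
  have hb := congrArg (F.ip E) (F.bianchi E (F.ph S) (F.ph W))
  simp only [map_add, map_zero, ← F.ip_ph, hEh] at hb
  have h3 : F.ip E (F.curv (F.ph S) (F.ph W) E) = 0 := by
    apply F.two_cancel
    have := F.ip_curv_swap (F.ph S) (F.ph W) E E
    rw [F.ip_comm]
    linear_combination this
  rw [h3, add_zero, F.ip_comm E, F.ip_comm E, F.ip_curv_swap (F.ph W)] at hb
  rw [h1, F.ip_comm]
  linear_combination - hb

/-! ### Metric compatibility of `∇^ε` -/

/-- The vector field dual to `∇^ε_X ⟨S, ·⟩`, for horizontal `X`. -/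
def dualConn (r : R) (X S : L) : L := F.nab X S + F.jop S X - r • F.tor X S

/-- Passing to the dual exchanges the two correction terms: the transpose of the torsion is `J`, and
that of `J` is the torsion. -/
lemma cnF_ip (r : R) (S : L) (X : L) : F.cnF r X (F.ip S) = F.ip (F.dualConn r X S) := by
  ext W
  have h := F.der_ip X S W
  have h1 := F.ip_jop S X W
  have h2 := F.ip_jop W X S
  rw [F.ip_comm] at h2
  simp only [cnF_apply, cn_def, dualConn, map_add, map_sub, map_smul, LinearMap.add_apply,
    LinearMap.sub_apply, LinearMap.smul_apply, smul_eq_mul]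
  rw [h1, h2, F.ip_comm W]
  linear_combination h

lemma rough_ip (r : R) (S W : L) {E : L} (hE : F.pv E = 0) : F.rough r (F.ip S) E W
    = F.ip (F.dualConn r E (F.dualConn r E S) - F.dualConn r (F.nab E E) S) W := by
  rw [rough, F.cn_self r hE, cnF_ip, cnF_ip, cnF_ip, map_sub, LinearMap.sub_apply]

/-- The metric `⟨·, ·⟩_H + e ⟨·, ·⟩_V`. -/
def ipE (e : R) : L →ₗ[R] L →ₗ[R] R := F.ip.compl₁₂ F.ph F.ph + e • F.ip.compl₁₂ F.pv F.pv

lemma ipE_apply (e : R) (S N : L) :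
    F.ipE e S N = F.ip (F.ph S) (F.ph N) + e * F.ip (F.pv S) (F.pv N) := rfl

/-- The term `J_S X` is horizontal and counts with weight one, `r T(X, S)` is vertical and counts
with weight `e`. Since `e r = 1`, the cross terms cancel, so the metric scaled by `ε` is preserved
by the connection with factor `1/ε`. -/
lemma der_ipE (e r : R) (he : ∀ X, F.der X e = 0) (her : e * r = 1) (X S N : L) :
    F.der X (F.ipE e S N) = F.ipE e (F.dualConn r X S) N + F.ipE e S (F.dualConn r X N) := by
  have h1 := F.der_ip X (F.ph S) (F.ph N)
  have h2 := F.der_ip X (F.pv S) (F.pv N)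
  have j1 : F.ip (F.jop S X) (F.ph N) = F.ip (F.pv S) (F.tor X N) := by
    rw [ip_jop, tor_ph_right, F.ip_pv, pv_tor]
  have j2 : F.ip (F.ph S) (F.jop N X) = F.ip (F.tor X S) (F.pv N) := by
    rw [F.ip_comm, ip_jop, tor_ph_right, F.ip_comm, ← F.ip_pv, pv_tor]
  simp only [ipE_apply, dualConn, map_add, map_sub, map_smul, LinearMap.add_apply,
    LinearMap.sub_apply, LinearMap.smul_apply, smul_eq_mul, F.der_mul, he, ph_nab, pv_nab, pv_jop,
    pv_tor, ph_tor, map_zero, LinearMap.zero_apply, F.eq_ph (F.pv_jop _ _), j1, j2]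
  linear_combination h1 + e * h2 + (F.ip (F.tor X S) (F.pv N) + F.ip (F.pv S) (F.tor X N)) * her

end FoliatedLieRinehart

noncomputable section

/-! ### Smooth functions and vector fields on a manifold as a Lie–Rinehart pair. -/

namespace TGFoliation
variable {d : ℕ} {M : Type*} [TopologicalSpace M]
  [ChartedSpace (EuclideanSpace ℝ (Fin d)) M]
open Topology

/-- The ring of smooth functions on `M`. -/
abbrev Fn (d : ℕ) (M : Type*) [TopologicalSpace M]
    [ChartedSpace (EuclideanSpace ℝ (Fin d)) M] : Type _ :=
  C^∞⟮𝓡 d, M; 𝓘(ℝ, ℝ), ℝ⟯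

/-- The smooth vector fields on `M`. -/
abbrev Vec (d : ℕ) (M : Type*) [TopologicalSpace M]
    [ChartedSpace (EuclideanSpace ℝ (Fin d)) M] [IsManifold (𝓡 d) ∞ M] : Type _ :=
  Cₛ^∞⟮𝓡 d; EuclideanSpace ℝ (Fin d), fun x : M => TangentSpace (𝓡 d) x⟯

variable [IsManifold (𝓡 d) ∞ M]

instance : SMul (Fn d M) (Vec d M) :=
  ⟨fun f X => ⟨fun x => f x • X x, f.contMDiff.smul_section X.contMDiff⟩⟩

lemma smul_vec_apply (f : Fn d M) (X : Vec d M) (x : M) : (f • X) x = f x • X x := rfl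

@[simp] lemma vec_add_apply (X Y : Vec d M) (x : M) : (X + Y) x = X x + Y x := rfl
@[simp] lemma vec_sub_apply (X Y : Vec d M) (x : M) : (X - Y) x = X x - Y x := rfl
@[simp] lemma vec_neg_apply (X : Vec d M) (x : M) : (- X) x = - X x := rfl
@[simp] lemma vec_zero_apply (x : M) : (0 : Vec d M) x = 0 := rfl
@[simp] lemma vec_real_smul_apply (c : ℝ) (X : Vec d M) (x : M) : (c • X) x = c • X x := rfl
@[simp] lemma fn_add_apply (f g : Fn d M) (x : M) : (f + g) x = f x + g x := rfl
@[simp] lemma fn_sub_apply (f g : Fn d M) (x : M) : (f - g) x = f x - g x := rfl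
@[simp] lemma fn_mul_apply (f g : Fn d M) (x : M) : (f * g) x = f x * g x := rfl
@[simp] lemma fn_neg_apply (f : Fn d M) (x : M) : (- f) x = - f x := rfl
@[simp] lemma fn_zero_apply (x : M) : (0 : Fn d M) x = 0 := rfl
@[simp] lemma fn_one_apply (x : M) : (1 : Fn d M) x = 1 := rfl

instance : Module (Fn d M) (Vec d M) where
  one_smul X := by ext1 x; simp [smul_vec_apply]
  mul_smul f g X := by ext1 x; simp [smul_vec_apply, mul_smul]
  smul_zero f := by ext1 x; simp [smul_vec_apply]
  smul_add f X Y := by ext1 x; simp [smul_vec_apply]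
  add_smul f g X := by ext1 x; simp [smul_vec_apply, add_smul]
  zero_smul X := by ext1 x; simp [smul_vec_apply]

/-- Evaluation at `x` of smooth functions. -/
def evF (x : M) : Fn d M →+* ℝ where
  toFun f := f x
  map_one' := rfl
  map_mul' _ _ := rfl
  map_zero' := rfl
  map_add' _ _ := rfl

lemma fn_sum_apply {ι : Type*} (s : Finset ι) (f : ι → Fn d M) (x : M) :
    (∑ i ∈ s, f i) x = ∑ i ∈ s, f i x := map_sum (evF x) f s

/-- Evaluation at `x` of smooth vector fields. -/
def evV (x : M) : Vec d M →+ TangentSpace (𝓡 d) x where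
  toFun X := X x
  map_zero' := rfl
  map_add' _ _ := rfl

lemma vec_sum_apply {ι : Type*} (s : Finset ι) (f : ι → Vec d M) (x : M) :
    (∑ i ∈ s, f i) x = ∑ i ∈ s, f i x := map_sum (evV x) f s

/-- A constant function. -/
def constFn (c : ℝ) : Fn d M := ⟨fun _ => c, contMDiff_const⟩

lemma constFn_apply (c : ℝ) (x : M) : (constFn c : Fn d M) x = c := rfl

lemma Fn.mdifferentiableAt (f : Fn d M) (x : M) :
    MDifferentiableAt (𝓡 d) 𝓘(ℝ, ℝ) f x :=
  f.contMDiff.mdifferentiable (by simp) x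

/-! ### Derivatives of functions and brackets -/

lemma contMDiff_der (X : Vec d M) (f : Fn d M) :
    ContMDiff (𝓡 d) 𝓘(ℝ, ℝ) ∞ fun x => dirDeriv f x (X x) := by
  have h1 : ContMDiff (𝓡 d).tangent 𝓘(ℝ, ℝ).tangent ∞ (tangentMap (𝓡 d) 𝓘(ℝ, ℝ) f) :=
    f.contMDiff.contMDiff_tangentMap (by simp)
  have h2 := h1.comp X.contMDiff
  exact contMDiff_snd_tangentBundle_modelSpace ℝ 𝓘(ℝ, ℝ) |>.comp h2

/-- The derivative of a function along a vector field. -/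
def derV : Vec d M →+ Fn d M →+ Fn d M :=
  AddMonoidHom.mk' (fun X => AddMonoidHom.mk' (fun f => ⟨_, contMDiff_der X f⟩) fun f g => by
    ext x
    show mvfderiv (𝓡 d) (f + g : M → ℝ) x (X x) = _
    rw [mvfderiv_add (f.mdifferentiableAt x) (g.mdifferentiableAt x)]; rfl) fun X Y => by
    ext f x
    exact map_add (mvfderiv (𝓡 d) f x) (X x) (Y x)

lemma derV_apply (X : Vec d M) (f : Fn d M) (x : M) : derV X f x = dirDeriv f x (X x) := rfl

lemma derV_smul (f : Fn d M) (X : Vec d M) (g : Fn d M) : derV (f • X) g = f * derV X g := by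
  ext x; simp [derV_apply, smul_vec_apply, dirDeriv]

lemma derV_mul (X : Vec d M) (f g : Fn d M) : derV X (f * g) = f * derV X g + g * derV X f := by
  ext x
  show mvfderiv (𝓡 d) (f * g : M → ℝ) x (X x) = _
  rw [mvfderiv_mul (f.mdifferentiableAt x) (g.mdifferentiableAt x)]; rfl

lemma derV_const (X : Vec d M) (c : ℝ) : derV X (constFn c) = 0 := by
  ext x
  show mvfderiv (𝓡 d) (fun _ => c) x (X x) = 0
  rw [mvfderiv_const]; rfl

scoped instance : IsManifold (𝓡 d) (((⊤ : ℕ∞) : WithTop ℕ∞) + 1) M :=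
  inferInstanceAs (IsManifold (𝓡 d) ∞ M)

scoped instance : IsManifold (𝓡 d) (minSmoothness ℝ 2) M := by
  rw [minSmoothness_of_isRCLikeNormedField]; infer_instance

scoped instance : IsManifold (𝓡 d) (minSmoothness ℝ 3) M := by
  rw [minSmoothness_of_isRCLikeNormedField]; infer_instance

lemma contMDiff_bracket (X Y : Vec d M) :
    ContMDiff (𝓡 d) (𝓡 d).tangent ∞ fun x => (⟨x, bracket X Y x⟩ : TangentBundle (𝓡 d) M) :=
  ContDiff.mlieBracket_vectorField (m := ⊤) (n := ⊤) X.contMDiff Y.contMDiff (by simp)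

/-- The Lie bracket of vector fields. -/
def brV : Vec d M →+ Vec d M →+ Vec d M :=
  AddMonoidHom.mk' (fun X => AddMonoidHom.mk' (fun Y => ⟨_, contMDiff_bracket X Y⟩) fun f g => by
    ext1 x
    exact VectorField.mlieBracket_add_right f.mdifferentiableAt g.mdifferentiableAt)
    fun X Y => by
    ext f x
    exact VectorField.mlieBracket_add_left X.mdifferentiableAt Y.mdifferentiableAt

lemma coe_brV (X Y : Vec d M) : ⇑(brV X Y) = bracket X Y := rfl

lemma brV_swap (X Y : Vec d M) : brV X Y = - brV Y X := by
  ext1 x; exact VectorField.mlieBracket_swap_apply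

lemma brV_smul (X : Vec d M) (f : Fn d M) (Y : Vec d M) :
    brV X (f • Y) = derV X f • Y + f • brV X Y := by
  ext1 x
  exact VectorField.mlieBracket_smul_right (f.mdifferentiableAt x) Y.mdifferentiableAt

lemma brV_jacobi (X Y Z : Vec d M) : brV X (brV Y Z) = brV (brV X Y) Z + brV Y (brV X Z) := by
  ext1 x
  have h : ∀ X : Vec d M, ContMDiffAt (𝓡 d) (𝓡 d).tangent (minSmoothness ℝ 2)
    (fun x => (⟨x, X x⟩ : TangentBundle (𝓡 d) M)) x := fun X =>
      (X.contMDiff x).of_le (by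
        rw [minSmoothness_of_isRCLikeNormedField]; exact ENat.LEInfty.out)
  exact VectorField.leibniz_identity_mlieBracket_apply (h X) (h Y) (h Z)

/-! ### Extension of vectors and localization -/

lemma smoothFieldOn_ext {x : M} (v : TangentSpace (𝓡 d) x) :
    SmoothFieldOn (ext v)
      (trivializationAt (EuclideanSpace ℝ (Fin d)) (TangentSpace (𝓡 d)) x).baseSet := by
  set t := trivializationAt (EuclideanSpace ℝ (Fin d)) (TangentSpace (𝓡 d) : M → Type _) x
  let w : EuclideanSpace ℝ (Fin d) := (t ⟨x, v⟩).2
  intro y hy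
  rw [t.contMDiffWithinAt_section _ hy]
  have : ContMDiffOn (𝓡 d) 𝓘(ℝ, EuclideanSpace ℝ (Fin d)) ∞ (fun _ : M => w) t.baseSet :=
    contMDiffOn_const
  exact this.congr (fun z hz ↦ by
    show (t ⟨z, t.symm z w⟩).2 = w
    rw [t.apply_mk_symm hz]) y hy

lemma ext_eq_symm {x : M} (v : TangentSpace (𝓡 d) x) {y : M}
    (hy : y ∈ (trivializationAt (EuclideanSpace ℝ (Fin d)) (TangentSpace (𝓡 d)) x).baseSet) :
    ext v y = (trivializationAt (EuclideanSpace ℝ (Fin d)) (TangentSpace (𝓡 d)) x).symmₗ ℝ y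
      ((trivializationAt (EuclideanSpace ℝ (Fin d)) (TangentSpace (𝓡 d)) x).linearMapAt ℝ x v) := by
  rw [Bundle.Trivialization.symmₗ_apply _ hy, Bundle.Trivialization.coe_linearMapAt_of_mem _
    (FiberBundle.mem_baseSet_trivializationAt' x)]
  rfl

@[simp] lemma ext_self {x : M} (v : TangentSpace (𝓡 d) x) : ext v x = v :=
  FiberBundle.extend_apply_self _ v

section T2

variable [T2Space M]

lemma exists_bump {x : M} {U : Set M} (hU : U ∈ 𝓝 x) :
    ∃ ψ : Fn d M, (∀ᶠ y in 𝓝 x, ψ y = 1) ∧ tsupport ψ ⊆ U := by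
  obtain ⟨f, -, hf⟩ := (SmoothBumpFunction.nhds_basis_tsupport (I := 𝓡 d) x).mem_iff.1 hU
  exact ⟨⟨f, f.contMDiff⟩, f.eventuallyEq_one, hf⟩

/-- A field that is smooth on an open set agrees near each point of the set with a global one. -/
lemma exists_global {U : Set M} (hU : IsOpen U) {X : VField d M} (hX : SmoothFieldOn X U) {x : M}
    (hx : x ∈ U) : ∃ Y : Vec d M, ∀ᶠ y in 𝓝 x, Y y = X y := by
  obtain ⟨ψ, h1, h2⟩ := exists_bump (d := d) (hU.mem_nhds hx)
  refine ⟨⟨_, ψ.contMDiff.contMDiffOn.smul_section_of_tsupport hU h2 hX⟩, ?_⟩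
  filter_upwards [h1] with y hy
  simp [hy]

/-- A smooth bump function at `x` supported in the domain of the preferred chart. -/
def bumpAt (x : M) : Fn d M := (exists_bump (d := d) ((trivializationAt (EuclideanSpace ℝ (Fin d))
    (TangentSpace (𝓡 d)) x).open_baseSet.mem_nhds
      (FiberBundle.mem_baseSet_trivializationAt' x))).choose

lemma bumpAt_eventually (x : M) : ∀ᶠ y in 𝓝 x, bumpAt (d := d) x y = 1 :=
  (exists_bump (d := d) ((trivializationAt (EuclideanSpace ℝ (Fin d))
    (TangentSpace (𝓡 d)) x).open_baseSet.mem_nhds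
      (FiberBundle.mem_baseSet_trivializationAt' x))).choose_spec.1

lemma tsupport_bumpAt (x : M) : tsupport (bumpAt (d := d) x) ⊆
    (trivializationAt (EuclideanSpace ℝ (Fin d)) (TangentSpace (𝓡 d)) x).baseSet :=
  (exists_bump (d := d) ((trivializationAt (EuclideanSpace ℝ (Fin d))
    (TangentSpace (𝓡 d)) x).open_baseSet.mem_nhds
      (FiberBundle.mem_baseSet_trivializationAt' x))).choose_spec.2

/-- Outside the trivialising neighbourhood `ext` need not be given by this linear formula, but the
bump function is zero there; the product is therefore linear in `v` everywhere. -/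
lemma bumpAt_smul_ext {x : M} (v : TangentSpace (𝓡 d) x) (y : M) : bumpAt (d := d) x y • ext v y
    = bumpAt (d := d) x y •
      (trivializationAt (EuclideanSpace ℝ (Fin d)) (TangentSpace (𝓡 d)) x).symmₗ ℝ y
      ((trivializationAt (EuclideanSpace ℝ (Fin d)) (TangentSpace (𝓡 d)) x).linearMapAt ℝ x v) := by
  by_cases hy : y ∈ (trivializationAt (EuclideanSpace ℝ (Fin d)) (TangentSpace (𝓡 d)) x).baseSet
  · rw [ext_eq_symm v hy]
  · rw [image_eq_zero_of_notMem_tsupport fun h => hy (tsupport_bumpAt x h), zero_smul, zero_smul]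

/-- A global smooth extension of a tangent vector, linear in the vector. -/
def gext (x : M) : TangentSpace (𝓡 d) x →ₗ[ℝ] Vec d M where
  toFun v := ⟨_, (bumpAt (d := d) x).contMDiff.contMDiffOn.smul_section_of_tsupport
    (Bundle.Trivialization.open_baseSet _) (tsupport_bumpAt x) (smoothFieldOn_ext v)⟩
  map_add' v w := by
    ext1 y
    show bumpAt (d := d) x y • ext (v + w) y
      = bumpAt (d := d) x y • ext v y + bumpAt (d := d) x y • ext w y
    simp only [bumpAt_smul_ext, map_add, smul_add]
  map_smul' c v := by
    ext1 y
    show bumpAt (d := d) x y • ext (c • v) y = c • bumpAt (d := d) x y • ext v y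
    simp only [bumpAt_smul_ext, map_smul]
    rw [smul_comm]

lemma gext_eventually {x : M} (v : TangentSpace (𝓡 d) x) : ∀ᶠ y in 𝓝 x, gext x v y = ext v y := by
  filter_upwards [bumpAt_eventually (d := d) x] with y hy
  show bumpAt (d := d) x y • ext v y = _
  rw [hy, one_smul]

@[simp] lemma gext_self {x : M} (v : TangentSpace (𝓡 d) x) : gext x v x = v := by
  rw [(gext_eventually v).self_of_nhds, ext_self]

/-- Expanding the Jacobi identity for `X, Y, f • Z` and removing `f` times the one for `X, Y, Z`
leaves the difference of the two sides times `Z`, where `Z` is chosen nonzero at the point. When the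
tangent space is zero there is nothing to compare. -/
lemma derV_brV (X Y : Vec d M) (f : Fn d M) :
    derV (brV X Y) f = derV X (derV Y f) - derV Y (derV X f) := by
  ext x
  by_cases h : ∃ v : TangentSpace (𝓡 d) x, v ≠ 0
  · obtain ⟨v, hv⟩ := h
    have key : (derV (brV X Y) f - (derV X (derV Y f) - derV Y (derV X f))) • gext x v = 0 := by
      have h1 := brV_jacobi X Y (f • gext x v)
      have h2 := brV_jacobi X Y (gext x v)
      simp only [brV_smul, map_add] at h1
      rw [h2] at h1
      simp only [smul_add] at h1
      rw [← sub_eq_zero] at h1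
      rw [← neg_eq_zero, ← h1]
      module
    have h3 := congrArg (fun Z : Vec d M => Z x) key
    simp only [smul_vec_apply, gext_self, vec_zero_apply, smul_eq_zero, hv, or_false,
      fn_sub_apply, sub_eq_zero] at h3
    exact h3
  · push Not at h
    simp only [derV_apply, fn_sub_apply, dirDeriv]
    rw [h (brV X Y x), h (X x), h (Y x)]
    simp

/-- A smooth field vanishing at `x` is a combination of smooth fields with coefficients vanishing
at `x`. -/
lemma exists_eq_sum_of_apply_eq_zero (X : Vec d M) {x : M} (h : X x = 0) :
    ∃ (f : Option (Fin d) → Fn d M) (Y : Option (Fin d) → Vec d M),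
      (∀ i, f i x = 0) ∧ X = ∑ i, f i • Y i := by
  set t := trivializationAt (EuclideanSpace ℝ (Fin d)) (TangentSpace (𝓡 d) : M → Type _) x
  let b := (EuclideanSpace.basisFun (Fin d) ℝ).toBasis
  have hx : x ∈ t.baseSet := FiberBundle.mem_baseSet_trivializationAt' x
  have hs : ∀ i, SmoothFieldOn (t.localFrame b i) t.baseSet := fun i =>
    t.contMDiffOn_localFrame_baseSet _ b i
  have hc : ∀ i, ContMDiffOn (𝓡 d) 𝓘(ℝ, ℝ) ∞
      (fun y => t.localFrameCoeff (𝓡 d) b i y (X y)) t.baseSet := fun i =>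
    contMDiffOn_baseSet_localFrameCoeff (k := ∞) b X.contMDiff.contMDiffOn i
  have hψ := tsupport_bumpAt (d := d) x
  let c : Fin d → Fn d M := fun i => ⟨fun y => bumpAt (d := d) x y *
      t.localFrameCoeff (𝓡 d) b i y (X y), contMDiff_of_tsupport fun y hy =>
        (bumpAt (d := d) x).contMDiff.contMDiffAt.mul
          ((hc i).contMDiffAt (t.open_baseSet.mem_nhds (hψ (tsupport_mul_subset_left hy))))⟩
  let s : Fin d → Vec d M := fun i => ⟨_, (bumpAt (d := d) x).contMDiff.contMDiffOn
    |>.smul_section_of_tsupport t.open_baseSet hψ (hs i)⟩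
  -- The decomposition is `X = (1 - ψ²) X + ∑ (ψ cᵢ)(ψ sᵢ)` with `ψ` the bump function, `sᵢ` a local
  -- frame and `cᵢ` the coefficients of `X`. The first factor is zero at `x` as `ψ(x) = 1`, the
  -- others as `X` is zero there.
  refine ⟨fun o => o.elim (1 - bumpAt x * bumpAt x) c, fun o => o.elim X s, ?_, ?_⟩
  · rintro (_ | i)
    · simp [(bumpAt_eventually (d := d) x).self_of_nhds]
    · show bumpAt (d := d) x x * t.localFrameCoeff (𝓡 d) b i x (X x) = 0
      rw [h, map_zero, mul_zero]
  · rw [Fintype.sum_option]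
    ext1 y
    simp only [Option.elim, vec_add_apply, vec_sum_apply, smul_vec_apply]
    show X y = (1 - bumpAt (d := d) x y * bumpAt (d := d) x y) • X y
      + ∑ i, (bumpAt (d := d) x y * t.localFrameCoeff (𝓡 d) b i y (X y)) •
        (bumpAt (d := d) x y • t.localFrame b i y)
    by_cases hy : y ∈ t.baseSet
    · have h1 := t.eq_sum_localFrameCoeff_smul (I := 𝓡 d) (b := b) (s := X) hy
      have h2 : ∑ i, (bumpAt (d := d) x y * t.localFrameCoeff (𝓡 d) b i y (X y)) •
        (bumpAt (d := d) x y • t.localFrame b i y) = (bumpAt (d := d) x y * bumpAt (d := d) x y) •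
          ∑ i, t.localFrameCoeff (𝓡 d) b i y (X y) • t.localFrame b i y := by
        rw [Finset.smul_sum]
        exact Finset.sum_congr rfl fun i _ => by module
      rw [h2, ← h1]
      module
    · have h3 : bumpAt (d := d) x y = 0 :=
        image_eq_zero_of_notMem_tsupport fun h => hy (hψ h)
      simp [h3]

lemma tensor_congr (F : Vec d M →ₗ[Fn d M] Fn d M) {X Y : Vec d M} {x : M} (h : X x = Y x) :
    F X x = F Y x := by
  obtain ⟨f, Z, hf, hZ⟩ := exists_eq_sum_of_apply_eq_zero (X - Y) (x := x) (by simp [h])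
  have h1 : F (X - Y) x = 0 := by
    rw [hZ, map_sum, fn_sum_apply]
    exact Finset.sum_eq_zero fun i _ => by simp [hf i]
  rw [map_sub] at h1
  exact sub_eq_zero.1 h1

lemma tensor_congr_vec (F : Vec d M →ₗ[Fn d M] Vec d M) {X Y : Vec d M} {x : M} (h : X x = Y x) :
    F X x = F Y x := by
  obtain ⟨f, Z, hf, hZ⟩ := exists_eq_sum_of_apply_eq_zero (X - Y) (x := x) (by simp [h])
  have h1 : F (X - Y) x = 0 := by
    rw [hZ, map_sum, vec_sum_apply]
    exact Finset.sum_eq_zero fun i _ => by simp [hf i, smul_vec_apply]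
  rw [map_sub] at h1
  exact sub_eq_zero.1 h1

end T2

end TGFoliation

namespace TGFoliation
open Topology

/-! ### Traces over orthonormal bases of subspaces. -/

section LinearAlgebra

variable {E : Type*} [NormedAddCommGroup E] [InnerProductSpace ℝ E]
  {A : Type*} [AddCommGroup A] [Module ℝ A] {ι κ : Type*} [Fintype ι] [Fintype κ]

/-- Expand one basis in the other and use Parseval's identity. This makes every `frameSum` of a
bilinear expression independent of the basis chosen in its definition. -/
lemma sum_orthonormalBasis_eq (B : E →ₗ[ℝ] E →ₗ[ℝ] A) (u : OrthonormalBasis ι ℝ E)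
    (v : OrthonormalBasis κ ℝ E) : ∑ i, B (u i) (u i) = ∑ j, B (v j) (v j) := by
  classical
  have h : ∀ j, B (v j) (v j)
      = ∑ i, ∑ k, (inner ℝ (u i) (v j) * inner ℝ (v j) (u k)) • B (u i) (u k) := by
    intro j
    conv_lhs => rw [← u.sum_repr' (v j)]
    simp only [map_sum, map_smul, LinearMap.sum_apply, LinearMap.smul_apply, Finset.smul_sum,
      smul_smul]
    rw [Finset.sum_comm]
    refine Finset.sum_congr rfl fun i _ => Finset.sum_congr rfl fun k _ => ?_
    rw [real_inner_comm (u k), mul_comm]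
  simp only [h]
  rw [Finset.sum_comm]
  refine Finset.sum_congr rfl fun i _ => ?_
  rw [Finset.sum_comm]
  simp only [← Finset.sum_smul, v.sum_inner_mul_inner]
  rw [Finset.sum_eq_single i]
  · simp
  · intro k _ hk
    rw [u.orthonormal.2 hk.symm, zero_smul]
  · simp

lemma orthonormal_subtype {S : Submodule ℝ E} {b : ι → E} (hb : Orthonormal ℝ b)
    (hS : ∀ i, b i ∈ S) : Orthonormal ℝ (fun i => (⟨b i, hS i⟩ : S)) :=
  ⟨fun i => hb.1 i, fun _ _ h => hb.2 h⟩

lemma top_le_span_subtype {S : Submodule ℝ E} {b : ι → E}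
    (hS : Submodule.span ℝ (Set.range b) = S) (h : ∀ i, b i ∈ S) :
    ⊤ ≤ Submodule.span ℝ (Set.range fun i => (⟨b i, h i⟩ : S)) := by
  rintro ⟨x, hx⟩ -
  have h1 : S.subtype '' (Set.range fun i => (⟨b i, h i⟩ : S)) = Set.range b := by
    rw [← Set.range_comp]; rfl
  have h2 : x ∈ (Submodule.span ℝ (Set.range fun i => (⟨b i, h i⟩ : S))).map S.subtype := by
    rw [Submodule.map_span, h1, hS]; exact hx
  obtain ⟨y, hy, hyx⟩ := h2
  have : y = ⟨x, hx⟩ := Subtype.ext hyx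
  exact this ▸ hy

lemma mem_of_span_eq {S : Submodule ℝ E} {b : ι → E}
    (hS : Submodule.span ℝ (Set.range b) = S) (i : ι) : b i ∈ S :=
  hS ▸ Submodule.subset_span ⟨i, rfl⟩

/-- An orthonormal basis of a subspace from an orthonormal family spanning it. -/
def orthonormalBasisOfSpan {S : Submodule ℝ E} {b : ι → E} (hb : Orthonormal ℝ b)
    (hS : Submodule.span ℝ (Set.range b) = S) : OrthonormalBasis ι ℝ S :=
  OrthonormalBasis.mk (orthonormal_subtype hb (mem_of_span_eq hS))
    (top_le_span_subtype hS (mem_of_span_eq hS))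

lemma orthonormalBasisOfSpan_apply {S : Submodule ℝ E} {b : ι → E} (hb : Orthonormal ℝ b)
    (hS : Submodule.span ℝ (Set.range b) = S) (i : ι) :
    (orthonormalBasisOfSpan hb hS i : E) = b i := by
  rw [orthonormalBasisOfSpan, OrthonormalBasis.coe_mk]

/-- For continuous fields this makes independence an open condition, as needed to extend a basis at
one point to a local frame. -/
lemma linearIndependent_of_det_ne_zero [DecidableEq ι] {v : ι → E}
    (h : (Matrix.of fun i j => inner ℝ (v i) (v j) : Matrix ι ι ℝ).det ≠ 0) :
    LinearIndependent ℝ v := by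
  rw [Fintype.linearIndependent_iff]
  intro c hc
  have h1 : (Matrix.of fun i j => inner ℝ (v i) (v j) : Matrix ι ι ℝ).mulVec c = 0 := by
    ext i
    have h2 := congrArg (inner ℝ (v i)) hc
    simp only [inner_sum, inner_smul_right, inner_zero_right] at h2
    simp only [Matrix.mulVec, dotProduct, Matrix.of_apply, Pi.zero_apply]
    rw [← h2]
    exact Finset.sum_congr rfl fun j _ => mul_comm _ _
  have := Matrix.eq_zero_of_mulVec_eq_zero h h1
  exact fun i => congrFun this i

lemma starProjection_eq_sum {S : Submodule ℝ E} [S.HasOrthogonalProjection] {b : ι → E}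
    (hb : Orthonormal ℝ b)
    (hS : Submodule.span ℝ (Set.range b) = S) (x : E) :
    S.starProjection x = ∑ i, (inner ℝ (b i) x : ℝ) • b i := by
  have h := (orthonormalBasisOfSpan hb hS).sum_repr' (S.orthogonalProjectionOnto x)
  have h2 := congrArg (Subtype.val) h
  rw [Submodule.starProjection_apply, ← h2]
  simp only [Submodule.coe_sum, Submodule.coe_smul, orthonormalBasisOfSpan_apply]
  refine Finset.sum_congr rfl fun i _ => ?_
  congr 1
  rw [Submodule.coe_inner, orthonormalBasisOfSpan_apply]
  have hbi : b i ∈ S := hS ▸ Submodule.subset_span ⟨i, rfl⟩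
  rw [← Submodule.starProjection_apply, ← Submodule.inner_starProjection_left_eq_right,
    Submodule.starProjection_eq_self_iff.2 hbi]

end LinearAlgebra

variable {d : ℕ} {M : Type*} [TopologicalSpace M]
  [ChartedSpace (EuclideanSpace ℝ (Fin d)) M] [IsManifold (𝓡 d) ∞ M]
  [Bundle.RiemannianBundle (fun x : M => TangentSpace (𝓡 d) x)]

lemma frameSum_eq_sum {A : Type*} [AddCommGroup A] [Module ℝ A] {x : M}
    {S : Submodule ℝ (TangentSpace (𝓡 d) x)}
    (B : TangentSpace (𝓡 d) x →ₗ[ℝ] TangentSpace (𝓡 d) x →ₗ[ℝ] A) {ι : Type*} [Fintype ι]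
    {b : ι → TangentSpace (𝓡 d) x} (hb : Orthonormal ℝ b)
    (hS : Submodule.span ℝ (Set.range b) = S) :
    frameSum S (fun e => B e e) = ∑ i, B (b i) (b i) := by
  have h := sum_orthonormalBasis_eq (B.compl₁₂ S.subtype S.subtype)
    (stdOrthonormalBasis ℝ S) (orthonormalBasisOfSpan hb hS)
  simp only [LinearMap.compl₁₂_apply, Submodule.subtype_apply, orthonormalBasisOfSpan_apply] at h
  exact h

variable [IsContMDiffRiemannianBundle (𝓡 d) ∞ (EuclideanSpace ℝ (Fin d))
      (fun x : M => TangentSpace (𝓡 d) x)]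

/-- The metric on smooth vector fields. -/
def ipV : Vec d M →ₗ[Fn d M] Vec d M →ₗ[Fn d M] Fn d M :=
  LinearMap.mk₂ (Fn d M)
    (fun X Y => ⟨fun x => inner ℝ (X x) (Y x), X.contMDiff.inner_bundle Y.contMDiff⟩)
    (fun X X' Y => by ext x; exact inner_add_left (𝕜 := ℝ) (X x) (X' x) (Y x))
    (fun f X Y => by ext x; exact real_inner_smul_left (X x) (Y x) (f x))
    (fun X Y Y' => by ext x; exact inner_add_right (𝕜 := ℝ) (X x) (Y x) (Y' x))
    (fun f X Y => by ext x; exact real_inner_smul_right (X x) (Y x) (f x))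

/-! ### Gram–Schmidt orthonormalization of local frames -/

lemma SmoothFieldOn.smul {U : Set M} {f : M → ℝ} {X : VField d M}
    (hf : ContMDiffOn (𝓡 d) 𝓘(ℝ, ℝ) ∞ f U) (hX : SmoothFieldOn X U) :
    SmoothFieldOn (fun x => f x • X x) U := ContMDiffOn.smul_section hf hX

lemma SmoothFieldOn.sum {U : Set M} {ι : Type*} {s : Finset ι} {X : ι → VField d M}
    (hX : ∀ i ∈ s, SmoothFieldOn (X i) U) :
    SmoothFieldOn (fun x => ∑ i ∈ s, X i x) U := ContMDiffOn.sum_section hX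

lemma SmoothFieldOn.inner {U : Set M} {X Y : VField d M}
    (hX : SmoothFieldOn X U) (hY : SmoothFieldOn Y U) :
    ContMDiffOn (𝓡 d) 𝓘(ℝ, ℝ) ∞ (fun x => (inner ℝ (X x) (Y x) : ℝ)) U :=
  ContMDiffOn.inner_bundle hX hY

lemma contMDiffOn_inv {U : Set M} {f : M → ℝ} (hf : ContMDiffOn (𝓡 d) 𝓘(ℝ, ℝ) ∞ f U)
    (h0 : ∀ x ∈ U, f x ≠ 0) : ContMDiffOn (𝓡 d) 𝓘(ℝ, ℝ) ∞ (fun x => (f x)⁻¹) U :=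
  fun x hx => (contDiffAt_inv ℝ (h0 x hx)).contMDiffAt.comp_contMDiffWithinAt x (hf x hx)

lemma contMDiffOn_sqrt {U : Set M} {f : M → ℝ} (hf : ContMDiffOn (𝓡 d) 𝓘(ℝ, ℝ) ∞ f U)
    (h0 : ∀ x ∈ U, f x ≠ 0) : ContMDiffOn (𝓡 d) 𝓘(ℝ, ℝ) ∞ (fun x => √(f x)) U :=
  fun x hx => (Real.contDiffAt_sqrt (h0 x hx)).contMDiffAt.comp_contMDiffWithinAt x (hf x hx)

open InnerProductSpace in
lemma smoothFieldOn_gramSchmidt {U : Set M} {k : ℕ} {Z : Fin k → VField d M}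
    (hZ : ∀ l, SmoothFieldOn (Z l) U) (hli : ∀ x ∈ U, LinearIndependent ℝ fun l => Z l x)
    (l : Fin k) : SmoothFieldOn (fun x => gramSchmidt ℝ (fun l => Z l x) l) U := by
  induction l using WellFoundedLT.induction with
  | ind l ih =>
    -- The recursion is rewritten with inner products and inverses of nonzero inner products only,
    -- which are smooth.
    have h : (fun x => gramSchmidt ℝ (fun l => Z l x) l) = fun x => Z l x +
        ∑ i ∈ Finset.Iio l, (- ((inner ℝ (gramSchmidt ℝ (fun l => Z l x) i) (Z l x)) *
          (inner ℝ (gramSchmidt ℝ (fun l => Z l x) i) (gramSchmidt ℝ (fun l => Z l x) i))⁻¹))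
          • gramSchmidt ℝ (fun l => Z l x) i := by
      funext x
      have := gramSchmidt_def'' ℝ (fun l => Z l x) l
      simp only [neg_smul, Finset.sum_neg_distrib, ← sub_eq_add_neg]
      rw [eq_sub_iff_add_eq]
      refine (this.trans ?_).symm
      congr 1
      refine Finset.sum_congr rfl fun i _ => ?_
      rw [real_inner_self_eq_norm_sq, div_eq_mul_inv]; rfl
    rw [h]
    refine ContMDiffOn.add_section (hZ l) (SmoothFieldOn.sum fun i hi => ?_)
    have hi' := ih i (Finset.mem_Iio.1 hi)
    refine SmoothFieldOn.smul ?_ hi'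
    refine ContMDiffOn.neg (ContMDiffOn.mul (hi'.inner (hZ l)) (contMDiffOn_inv (hi'.inner hi') ?_))
    intro x hx
    rw [inner_self_ne_zero]
    exact gramSchmidt_ne_zero _ (hli x hx)

open InnerProductSpace in
lemma exists_orthonormal_frame {U : Set M} {k : ℕ} {Z : Fin k → VField d M}
    (hZ : ∀ l, SmoothFieldOn (Z l) U) (hli : ∀ x ∈ U, LinearIndependent ℝ fun l => Z l x) :
    ∃ E : Fin k → VField d M, (∀ l, SmoothFieldOn (E l) U) ∧ ∀ x ∈ U,
      Orthonormal ℝ (fun l => E l x) ∧ Submodule.span ℝ (Set.range fun l => E l x)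
        = Submodule.span ℝ (Set.range fun l => Z l x) := by
  refine ⟨fun l x => gramSchmidtNormed ℝ (fun l => Z l x) l, fun l => ?_, fun x hx =>
    ⟨gramSchmidtNormed_orthonormal (hli x hx), ?_⟩⟩
  · have h1 := smoothFieldOn_gramSchmidt hZ hli l
    have h2 : ∀ x ∈ U, (inner ℝ (gramSchmidt ℝ (fun l => Z l x) l)
      (gramSchmidt ℝ (fun l => Z l x) l) : ℝ) ≠ 0 := fun x hx => by
        rw [inner_self_ne_zero]; exact gramSchmidt_ne_zero _ (hli x hx)
    have h3 : SmoothFieldOn (fun x => (√(inner ℝ (gramSchmidt ℝ (fun l => Z l x) l)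
      (gramSchmidt ℝ (fun l => Z l x) l)))⁻¹ • gramSchmidt ℝ (fun l => Z l x) l) U := by
      refine SmoothFieldOn.smul (contMDiffOn_inv (contMDiffOn_sqrt (h1.inner h1) h2) ?_) h1
      intro x hx
      exact (Real.sqrt_ne_zero real_inner_self_nonneg).2 (h2 x hx)
    refine h3.congr fun x hx => ?_
    simp only [gramSchmidtNormed, real_inner_self_eq_norm_sq, Real.sqrt_sq (norm_nonneg _)]
    rfl
  · rw [span_gramSchmidtNormed_range, span_gramSchmidt]

section Frames

variable [T2Space M] {V : Distribution d M} {m : ℕ}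

lemma smoothFieldOn_projV (hV : IsSmoothDistribution m V) {X : VField d M} {U : Set M}
    (hU : IsOpen U) (hX : SmoothFieldOn X U) : SmoothFieldOn (partV V X) U := by
  intro x hx
  obtain ⟨W, hW, hxW, Z, hZ, hspan⟩ := hV x
  obtain ⟨E, hE, hon⟩ := exists_orthonormal_frame hZ fun y hy => (hspan y hy).1
  have h1 : SmoothFieldOn (fun y => ∑ l, (inner ℝ (E l y) (X y) : ℝ) • E l y) (U ∩ W) :=
    SmoothFieldOn.sum fun l _ => SmoothFieldOn.smul
      (ContMDiffOn.inner_bundle ((hE l).mono Set.inter_subset_right)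
        (hX.mono Set.inter_subset_left))
      ((hE l).mono Set.inter_subset_right)
  have h2 : SmoothFieldOn (partV V X) (U ∩ W) := h1.congr fun y hy => by
    have := (hon y hy.2).2.trans (hspan y hy.2).2
    simp only [partV, projV, starProjection_eq_sum (hon y hy.2).1 this]
  exact (h2.contMDiffAt ((hU.inter hW).mem_nhds ⟨hx, hxW⟩)).contMDiffWithinAt

lemma projV_add_projH (x : M) (v : TangentSpace (𝓡 d) x) : projV V x v + projH V x v = v := by
  simp [projV, projH, Submodule.starProjection_orthogonal]

/-- The projection of smooth vector fields to a smooth distribution. -/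
def pvV (hV : IsSmoothDistribution m V) : Vec d M →ₗ[Fn d M] Vec d M where
  toFun X := ⟨partV V X, contMDiffOn_univ.1
    (smoothFieldOn_projV hV isOpen_univ X.contMDiff.contMDiffOn)⟩
  map_add' X Y := by ext1 x; exact map_add (V x).starProjection (X x) (Y x)
  map_smul' f X := by ext1 x; exact map_smul (V x).starProjection (f x) (X x)

lemma pvV_apply (hV : IsSmoothDistribution m V) (X : Vec d M) (x : M) :
    pvV hV X x = projV V x (X x) := rfl

/-- Near each point there are orthonormal frames of `V` and of its orthogonal complement,
consisting of globally defined smooth sections of the two distributions. -/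
lemma exists_adapted_frame (hV : IsSmoothDistribution m V) (x : M) :
    ∃ (E : Fin (Module.finrank ℝ (V x)ᗮ) → Vec d M) (Z : Fin m → Vec d M),
      (∀ i, pvV hV (E i) = 0) ∧ (∀ l, pvV hV (Z l) = Z l) ∧ ∀ᶠ y in 𝓝 x,
        (Orthonormal ℝ (fun i => E i y) ∧
          Submodule.span ℝ (Set.range fun i => E i y) = (V y)ᗮ) ∧
        (Orthonormal ℝ (fun l => Z l y) ∧
          Submodule.span ℝ (Set.range fun l => Z l y) = V y) := by
  obtain ⟨W, hW, hxW, Z₀, hZ₀, hspan⟩ := hV x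
  obtain ⟨F, hF, hon⟩ := exists_orthonormal_frame hZ₀ fun y hy => (hspan y hy).1
  have hFV : ∀ y ∈ W, Submodule.span ℝ (Set.range fun l => F l y) = V y := fun y hy =>
    (hon y hy).2.trans (hspan y hy).2
  choose Zg hZg using fun l => exists_global hW (hF l) hxW
  let h : Fin (Module.finrank ℝ (V x)ᗮ) → TangentSpace (𝓡 d) x :=
    fun i => stdOrthonormalBasis ℝ (V x)ᗮ i
  -- An orthonormal basis of the horizontal space at `x` is extended and then made horizontal
  -- everywhere; its Gram determinant is one at `x`, hence nonzero nearby.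
  let X : Fin (Module.finrank ℝ (V x)ᗮ) → Vec d M := fun i => gext x (h i) - pvV hV (gext x (h i))
  have hXH : ∀ i y, X i y ∈ (V y)ᗮ := fun i y => by
    have : X i y = projH V y (gext x (h i) y) :=
      (eq_sub_of_add_eq' (projV_add_projH (V := V) y (gext x (h i) y))).symm
    rw [this]
    exact Submodule.starProjection_apply_mem _ _
  have hXx : ∀ i, X i x = h i := fun i => by
    have h1 : projV V x (h i) = 0 := by
      rw [projV, Submodule.starProjection_apply_eq_zero_iff]
      exact (stdOrthonormalBasis ℝ (V x)ᗮ i).2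
    show gext x (h i) x - projV V x (gext x (h i) x) = h i
    rw [gext_self, h1, sub_zero]
  let G : M → ℝ := fun y => (Matrix.of fun i j => (inner ℝ (X i y) (X j y) : ℝ)).det
  have hG : Continuous G := Continuous.matrix_det
    (continuous_matrix fun i j => (ipV (X i) (X j)).contMDiff.continuous)
  have hGx : G x ≠ 0 := by
    have h1 : (Matrix.of fun i j => (inner ℝ (X i x) (X j x) : ℝ)) = 1 := by
      ext i j
      simp only [Matrix.of_apply, hXx, h, Matrix.one_apply]
      rw [← Submodule.coe_inner]
      exact orthonormal_iff_ite.1 (stdOrthonormalBasis ℝ (V x)ᗮ).orthonormal i j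
    show (Matrix.of fun i j => (inner ℝ (X i x) (X j x) : ℝ)).det ≠ 0
    rw [h1, Matrix.det_one]
    exact one_ne_zero
  let U : Set M := {y | G y ≠ 0}
  have hU : IsOpen U := isOpen_ne_fun hG continuous_const
  obtain ⟨e, he, heon⟩ := exists_orthonormal_frame (U := U) (Z := fun i => ⇑(X i))
    (fun i => (X i).contMDiff.contMDiffOn) fun y hy => linearIndependent_of_det_ne_zero hy
  choose Eg hEg using fun i => exists_global hU (he i) hGx
  -- Globalising controls the fields only near `x`. Projecting afterwards puts them in their
  -- distribution at every point and changes nothing near `x`.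
  refine ⟨fun i => Eg i - pvV hV (Eg i), fun l => pvV hV (Zg l), fun i => ?_, fun l => ?_, ?_⟩
  · ext1 y
    show projV V y (Eg i y - projV V y (Eg i y)) = 0
    have := projV_add_projH (V := V) y (Eg i y)
    rw [← eq_sub_of_add_eq' this, projV, Submodule.starProjection_apply_eq_zero_iff]
    exact Submodule.starProjection_apply_mem _ _
  · ext1 y
    exact Submodule.starProjection_eq_self_iff.2 (Submodule.starProjection_apply_mem _ _)
  · have hfr : ∀ y ∈ W, Module.finrank ℝ (V y) = m := fun y hy => by
      rw [← (hspan y hy).2, finrank_span_eq_card (hspan y hy).1, Fintype.card_fin]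
    filter_upwards [Filter.eventually_all.2 hEg, Filter.eventually_all.2 hZg,
      hU.mem_nhds hGx, hW.mem_nhds hxW] with y h1 h2 hyU hyW
    have hspanE : Submodule.span ℝ (Set.range fun i => e i y) = (V y)ᗮ := by
      refine Submodule.eq_of_le_of_finrank_eq ?_ ?_
      · rw [(heon y hyU).2, Submodule.span_le]
        rintro _ ⟨i, rfl⟩
        exact hXH i y
      · rw [finrank_span_eq_card (heon y hyU).1.linearIndependent, Fintype.card_fin]
        have a1 := Submodule.finrank_add_finrank_orthogonal (V x)
        have a2 := Submodule.finrank_add_finrank_orthogonal (V y)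
        rw [hfr x hxW] at a1
        rw [hfr y hyW] at a2
        have a3 : Module.finrank ℝ (TangentSpace (𝓡 d) x)
          = Module.finrank ℝ (TangentSpace (𝓡 d) y) := rfl
        omega
    have hE : ∀ i, (Eg i - pvV hV (Eg i)) y = e i y := fun i => by
      show Eg i y - projV V y (Eg i y) = e i y
      rw [h1 i]
      have : projV V y (e i y) = 0 := by
        rw [projV, Submodule.starProjection_apply_eq_zero_iff, ← hspanE]
        exact Submodule.subset_span ⟨i, rfl⟩
      rw [this, sub_zero]
    have hZ : ∀ l, pvV hV (Zg l) y = F l y := fun l => by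
      rw [pvV_apply, h2 l]
      exact Submodule.starProjection_eq_self_iff.2 (hFV y hyW ▸ Submodule.subset_span ⟨l, rfl⟩)
    simp only [hE, hZ]
    exact ⟨⟨(heon y hyU).1, hspanE⟩, (hon y hyW).1, hFV y hyW⟩

end Frames

end TGFoliation

namespace TGFoliation
open Topology

variable {d : ℕ} {M : Type*} [TopologicalSpace M]
  [ChartedSpace (EuclideanSpace ℝ (Fin d)) M] [IsManifold (𝓡 d) ∞ M]
  [Bundle.RiemannianBundle (fun x : M => TangentSpace (𝓡 d) x)]
  [IsContMDiffRiemannianBundle (𝓡 d) ∞ (EuclideanSpace ℝ (Fin d))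
      (fun x : M => TangentSpace (𝓡 d) x)]

/-- Treating the whole tangent bundle as a distribution makes the frame results available for the
musical isomorphism and for the divergence. -/
lemma isSmoothDistribution_top :
    IsSmoothDistribution d (fun x : M => (⊤ : Submodule ℝ (TangentSpace (𝓡 d) x))) := by
  intro x
  set t := trivializationAt (EuclideanSpace ℝ (Fin d)) (TangentSpace (𝓡 d) : M → Type _) x
  let b := (EuclideanSpace.basisFun (Fin d) ℝ).toBasis
  have h := t.isLocalFrameOn_localFrame_baseSet (𝓡 d) ∞ b
  exact ⟨t.baseSet, t.open_baseSet, FiberBundle.mem_baseSet_trivializationAt' x, t.localFrame b,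
    h.contMDiffOn, fun y hy => ⟨h.linearIndependent hy, top_le_iff.1 (h.generating hy)⟩⟩

lemma span_range_orthonormalBasis {E ι : Type*} [NormedAddCommGroup E] [InnerProductSpace ℝ E]
    [Fintype ι] {S : Submodule ℝ E} (u : OrthonormalBasis ι ℝ S) :
    Submodule.span ℝ (Set.range fun i => (u i : E)) = S := by
  have h2 := congrArg (Submodule.map S.subtype) u.toBasis.span_eq
  rwa [Submodule.map_span, Submodule.map_top, Submodule.range_subtype, ← Set.range_comp,
    u.coe_toBasis] at h2

lemma exists_orthonormal_span {x : M} (S : Submodule ℝ (TangentSpace (𝓡 d) x)) :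
    ∃ b : Fin (Module.finrank ℝ S) → TangentSpace (𝓡 d) x, Orthonormal ℝ b ∧
      Submodule.span ℝ (Set.range b) = S ∧
        ∀ (A : Type) [AddCommGroup A] (F : TangentSpace (𝓡 d) x → A),
          frameSum S F = ∑ i, F (b i) := by
  refine ⟨fun i => stdOrthonormalBasis ℝ S i, ?_, ?_, fun A _ F => rfl⟩
  · exact (stdOrthonormalBasis ℝ S).orthonormal.comp_linearIsometry S.subtypeₗᵢ
  · exact span_range_orthonormalBasis _

lemma frameSum_top {x : M} (S : Submodule ℝ (TangentSpace (𝓡 d) x))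
    (B : TangentSpace (𝓡 d) x →ₗ[ℝ] TangentSpace (𝓡 d) x →ₗ[ℝ] ℝ) :
    frameSum (⊤ : Submodule ℝ (TangentSpace (𝓡 d) x)) (fun e => B e e)
      = frameSum Sᗮ (fun e => B e e) + frameSum S (fun e => B e e) := by
  obtain ⟨u, hu, hu', hu2⟩ := exists_orthonormal_span Sᗮ
  obtain ⟨v, hv, hv', hv2⟩ := exists_orthonormal_span S
  have h : Orthonormal ℝ (Sum.elim u v) := by
    refine ⟨?_, ?_⟩
    · rintro (i | i)
      · exact hu.1 i
      · exact hv.1 i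
    · rintro (i | i) (j | j) hij
      · exact hu.2 fun h => hij (h ▸ rfl)
      · exact Submodule.inner_left_of_mem_orthogonal (mem_of_span_eq hv' j) (mem_of_span_eq hu' i)
      · exact Submodule.inner_right_of_mem_orthogonal (mem_of_span_eq hv' i) (mem_of_span_eq hu' j)
      · exact hv.2 fun h => hij (h ▸ rfl)
  have h2 : Submodule.span ℝ (Set.range (Sum.elim u v)) = ⊤ := by
    rw [Set.Sum.elim_range, Submodule.span_union, hu', hv', sup_comm]
    exact Submodule.sup_orthogonal_of_hasOrthogonalProjection
  rw [frameSum_eq_sum B h h2, Fintype.sum_sum_type, hu2, hv2]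
  rfl

lemma inner_sharp {x : M} {a : TangentSpace (𝓡 d) x → ℝ} (ha : IsLinearMap ℝ a)
    (v : TangentSpace (𝓡 d) x) : inner ℝ (sharp a) v = a v := by
  obtain ⟨u, hu, hu', -⟩ := exists_orthonormal_span (⊤ : Submodule ℝ (TangentSpace (𝓡 d) x))
  have h1 : sharp a = ∑ i, a (u i) • u i := by
    have := frameSum_eq_sum ((LinearMap.lsmul ℝ (TangentSpace (𝓡 d) x)).comp
      (ha.mk' a)) hu hu'
    exact this
  have h2 := starProjection_eq_sum hu hu' v
  rw [Submodule.starProjection_eq_self_iff.2 Submodule.mem_top] at h2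
  rw [h1, sum_inner]
  conv_rhs => rw [h2]
  have h3 : a (∑ i, (inner ℝ (u i) v : ℝ) • u i) = ∑ i, (inner ℝ (u i) v : ℝ) * a (u i) := by
    have := map_sum (ha.mk' a) (fun i => (inner ℝ (u i) v : ℝ) • u i) Finset.univ
    refine this.trans (Finset.sum_congr rfl fun i _ => ha.map_smul _ _)
  rw [h3]
  exact Finset.sum_congr rfl fun i _ => by rw [real_inner_smul_left, mul_comm]

lemma fn_two_apply (x : M) : (2 : Fn d M) x = 2 := map_ofNat (evF x) 2

section T2

variable [T2Space M]

lemma isLinearMap_gext (α : Vec d M →ₗ[Fn d M] Fn d M) (x : M) :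
    IsLinearMap ℝ (fun v : TangentSpace (𝓡 d) x => α (gext x v) x) := by
  refine ⟨fun v w => by simp, fun c v => ?_⟩
  have h := tensor_congr α (X := gext x (c • v)) (Y := constFn c • gext x v) (x := x)
    (by rw [gext_self, smul_vec_apply, gext_self]; rfl)
  rw [h, map_smul]
  rfl

lemma apply_gext (α : Vec d M →ₗ[Fn d M] Fn d M) (x : M) (X : Vec d M) :
    α (gext x (X x)) x = α X x := tensor_congr α (by simp)

/-- The vector field dual to a one-form. -/
def sharpV (α : Vec d M →ₗ[Fn d M] Fn d M) : Vec d M :=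
  ⟨fun x => sharp fun w => α (gext x w) x, by
    intro x
    obtain ⟨E, Z, hE, hZ', hZ⟩ := exists_adapted_frame (isSmoothDistribution_top (d := d) (M := M)) x
    refine ContMDiffAt.congr_of_eventuallyEq ((∑ l, α (Z l) • Z l : Vec d M).contMDiff x) ?_
    filter_upwards [hZ] with y hy
    have h := frameSum_eq_sum ((LinearMap.lsmul ℝ (TangentSpace (𝓡 d) y)).comp
      ((isLinearMap_gext α y).mk' _)) hy.2.1 hy.2.2
    refine congrArg (Bundle.TotalSpace.mk (F := EuclideanSpace ℝ (Fin d)) y) (h.trans ?_)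
    rw [vec_sum_apply]
    refine Finset.sum_congr rfl fun l _ => ?_
    show α (gext y (Z l y)) y • Z l y = _
    rw [apply_gext]; rfl⟩

lemma ipV_sharpV (α : Vec d M →ₗ[Fn d M] Fn d M) (Y : Vec d M) : ipV (sharpV α) Y = α Y := by
  ext x
  exact (inner_sharp (isLinearMap_gext α x) (Y x)).trans (apply_gext α x Y)

lemma ipV_comm (X Y : Vec d M) : ipV X Y = ipV Y X := by
  ext x; exact real_inner_comm (Y x) (X x)

lemma ipV_nondeg (X : Vec d M) (h : ∀ Y, ipV X Y = 0) : X = 0 := by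
  ext1 x
  have := congrArg (fun f : Fn d M => f x) (h X)
  exact inner_self_eq_zero.1 this

/-- The right-hand side of Koszul's formula as a one-form. -/
def koszulF (X Y : Vec d M) : Vec d M →ₗ[Fn d M] Fn d M where
  toFun W := constFn (1 / 2) * (derV X (ipV Y W) + derV Y (ipV X W) - derV W (ipV X Y)
      + ipV (brV X Y) W - ipV (brV X W) Y - ipV (brV Y W) X)
  map_add' W W' := by
    simp only [map_add, AddMonoidHom.add_apply, LinearMap.add_apply]; ring
  map_smul' f W := by
    simp only [map_smul, smul_eq_mul, derV_mul, derV_smul, brV_smul, map_add, LinearMap.add_apply,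
      LinearMap.smul_apply, RingHom.id_apply]
    rw [ipV_comm W X, ipV_comm W Y]
    ring

/-- The Levi-Civita connection on smooth vector fields. -/
def lcV (X Y : Vec d M) : Vec d M := sharpV (koszulF X Y)

end T2

/-! ### Locality -/

/-- An operation on pairs of vector fields that is local. -/
def IsLocalOp (D : Conn d M) : Prop :=
  ∀ (x : M) (X X' Y Y' : VField d M), (∀ᶠ y in 𝓝 x, X y = X' y) → (∀ᶠ y in 𝓝 x, Y y = Y' y) →
    D X Y x = D X' Y' x

/-- Agreement near a point is inherited by the results, so local operations may be iterated;
curvature and the rough Laplacian need this, as `ext` is controlled only near its base point. -/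
lemma IsLocalOp.eventually {D : Conn d M} (hD : IsLocalOp D) {x : M} {X X' Y Y' : VField d M}
    (h : ∀ᶠ y in 𝓝 x, X y = X' y) (h' : ∀ᶠ y in 𝓝 x, Y y = Y' y) :
    ∀ᶠ y in 𝓝 x, D X Y y = D X' Y' y := by
  filter_upwards [h.eventually_nhds, h'.eventually_nhds] with y hy hy'
  exact hD y _ _ _ _ hy hy'

lemma dirDeriv_congr {f g : M → ℝ} {x : M} (h : ∀ᶠ y in 𝓝 x, f y = g y)
    (v : TangentSpace (𝓡 d) x) : dirDeriv f x v = dirDeriv g x v := by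
  have h1 : f =ᶠ[𝓝 x] g := h
  have h2 := h1.mfderiv_eq (I := 𝓡 d) (I' := 𝓘(ℝ, ℝ))
  simp only [dirDeriv, mvfderiv, h2]
  rw [h1.self_of_nhds]

lemma isLocalOp_bracket : IsLocalOp (bracket : Conn d M) := fun _ _ _ _ _ h h' =>
  Filter.EventuallyEq.mlieBracket_vectorField_eq h h'

lemma koszul_congr {x : M} {X X' Y Y' W W' : VField d M} (hX : ∀ᶠ y in 𝓝 x, X y = X' y)
    (hY : ∀ᶠ y in 𝓝 x, Y y = Y' y) (hW : ∀ᶠ y in 𝓝 x, W y = W' y) :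
    koszul X Y W x = koszul X' Y' W' x := by
  have e : ∀ {A A' B B' : VField d M}, (∀ᶠ y in 𝓝 x, A y = A' y) → (∀ᶠ y in 𝓝 x, B y = B' y) →
      ∀ᶠ y in 𝓝 x, (inner ℝ (A y) (B y) : ℝ) = inner ℝ (A' y) (B' y) := fun h h' => by
    filter_upwards [h, h'] with y h h'
    rw [h, h']
  simp only [koszul]
  rw [dirDeriv_congr (e hY hW), dirDeriv_congr (e hX hW), dirDeriv_congr (e hX hY),
    isLocalOp_bracket x _ _ _ _ hX hY, isLocalOp_bracket x _ _ _ _ hX hW,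
    isLocalOp_bracket x _ _ _ _ hY hW, hX.self_of_nhds, hY.self_of_nhds, hW.self_of_nhds]

lemma isLocalOp_leviCivita : IsLocalOp (leviCivita : Conn d M) := fun x _ _ _ _ h h' => by
  simp only [leviCivita]
  congr 1
  funext w
  exact koszul_congr h h' (Filter.Eventually.of_forall fun _ => rfl)

variable {V : Distribution d M}

lemma isLocalOp_bott : IsLocalOp (bott V) := fun x X X' Y Y' h h' => by
  have h1 : ∀ᶠ y in 𝓝 x, partH V X y = partH V X' y := h.mono fun y hy => by simp [partH, hy]
  have h2 : ∀ᶠ y in 𝓝 x, partV V X y = partV V X' y := h.mono fun y hy => by simp [partV, hy]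
  have h3 : ∀ᶠ y in 𝓝 x, partH V Y y = partH V Y' y := h'.mono fun y hy => by simp [partH, hy]
  have h4 : ∀ᶠ y in 𝓝 x, partV V Y y = partV V Y' y := h'.mono fun y hy => by simp [partV, hy]
  simp only [bott]
  rw [isLocalOp_leviCivita x _ _ _ _ h1 h3, isLocalOp_leviCivita x _ _ _ _ h2 h4,
    isLocalOp_bracket x _ _ _ _ h2 h3, isLocalOp_bracket x _ _ _ _ h1 h4]

lemma IsLocalOp.torsion {D : Conn d M} (hD : IsLocalOp D) : IsLocalOp (torsion D) :=
  fun x X X' Y Y' h h' => by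
  simp only [TGFoliation.torsion]
  rw [hD x _ _ _ _ h h', hD x _ _ _ _ h' h, isLocalOp_bracket x _ _ _ _ h h']

lemma isLocalOp_connEps (ε : ℝ≥0∞) : IsLocalOp (connEps V ε) := fun x X X' Y Y' h h' => by
  simp only [connEps]
  rw [isLocalOp_bott x _ _ _ _ h h', isLocalOp_bott.torsion x _ _ _ _ h h', h.self_of_nhds,
    h'.self_of_nhds]

/-! ### The Lie–Rinehart pair of a totally geodesic Riemannian foliation -/

section T2

variable [T2Space M] {m : ℕ}

lemma coe_lcV (X Y : Vec d M) : ⇑(lcV X Y) = leviCivita X Y := by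
  funext x
  show sharp (fun w => koszulF X Y (gext x w) x) = sharp fun w => koszul X Y (ext w) x
  congr 1
  funext w
  exact koszul_congr (Filter.Eventually.of_forall fun _ => rfl)
    (Filter.Eventually.of_forall fun _ => rfl) (gext_eventually w)

lemma projV_mem (x : M) (v : TangentSpace (𝓡 d) x) : projV V x v ∈ V x :=
  Submodule.starProjection_apply_mem _ _

lemma projH_mem (x : M) (v : TangentSpace (𝓡 d) x) : projH V x v ∈ (V x)ᗮ :=
  Submodule.starProjection_apply_mem _ _

lemma projV_of_mem {x : M} {v : TangentSpace (𝓡 d) x} (h : v ∈ V x) : projV V x v = v :=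
  Submodule.starProjection_eq_self_iff.2 h

lemma projH_eq_sub (x : M) (v : TangentSpace (𝓡 d) x) : projH V x v = v - projV V x v :=
  eq_sub_of_add_eq' (projV_add_projH x v)

lemma isLocalSection_pvV (hV : IsSmoothDistribution m V) (X : Vec d M) :
    IsLocalSection V Set.univ (pvV hV X) :=
  ⟨(pvV hV X).contMDiff.contMDiffOn, fun x _ => projV_mem x _⟩

lemma isLocalSection_sub_pvV (hV : IsSmoothDistribution m V) (X : Vec d M) :
    IsLocalSection (fun x => (V x)ᗮ) Set.univ (X - pvV hV X : Vec d M) :=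
  ⟨(X - pvV hV X).contMDiff.contMDiffOn, fun x _ => by
    have h : (X - pvV hV X) x = projH V x (X x) := (projH_eq_sub x _).symm
    rw [h]
    exact projH_mem x _⟩

/-- The Lie–Rinehart pair of smooth functions and vector fields on a manifold with a totally
geodesic Riemannian foliation. -/
def lieRinehart (hV : IsTotallyGeodesicRiemannianFoliation m V) :
    FoliatedLieRinehart (Fn d M) (Vec d M) where
  half := constFn (1 / 2)
  two_half := by ext x; simp only [fn_add_apply, constFn_apply, fn_one_apply]; norm_num
  der := derV
  der_smul := derV_smul
  der_mul := derV_mul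
  br := brV
  br_swap := brV_swap
  br_smul := brV_smul
  jacobi := brV_jacobi
  der_br := derV_brV
  ip := ipV
  ip_comm := ipV_comm
  ip_nondeg := ipV_nondeg
  sharp := sharpV
  ip_sharp := ipV_sharpV
  lc := lcV
  koszul X Y W := by
    rw [lcV, ipV_sharpV]
    have : (2 : Fn d M) * constFn (1 / 2) = 1 := by
      ext x
      show ((2 : Fn d M) x) * (1 / 2 : ℝ) = 1
      rw [fn_two_apply]; norm_num
    show 2 * (constFn (1 / 2) * _) = _
    rw [← mul_assoc, this, one_mul]
  pv := pvV hV.smooth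
  pv_pv X := by ext1 x; exact projV_of_mem (projV_mem x _)
  ip_pv X Y := by ext x; exact Submodule.inner_starProjection_left_eq_right (V x) (X x) (Y x)
  involutive X Y := by
    ext1 x
    exact projV_of_mem (hV.involutive _ _ _ isOpen_univ (isLocalSection_pvV hV.smooth X)
      (isLocalSection_pvV hV.smooth Y) x trivial)
  bundleLike Z X := by
    ext x
    have := hV.bundleLike _ _ _ isOpen_univ (isLocalSection_pvV hV.smooth Z)
      (isLocalSection_sub_pvV hV.smooth X) x trivial
    rw [fn_mul_apply, fn_two_apply]
    exact sub_eq_zero.1 this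
  totallyGeodesic X Y := by
    ext1 x
    refine projV_of_mem ?_
    rw [coe_lcV]
    exact hV.totallyGeodesic _ _ _ isOpen_univ (isLocalSection_pvV hV.smooth X)
      (isLocalSection_pvV hV.smooth Y) x trivial

end T2

end TGFoliation

namespace TGFoliation
open Topology

variable {d : ℕ} {M : Type*} [TopologicalSpace M]
  [ChartedSpace (EuclideanSpace ℝ (Fin d)) M] [IsManifold (𝓡 d) ∞ M]
  [Bundle.RiemannianBundle (fun x : M => TangentSpace (𝓡 d) x)]
  [IsContMDiffRiemannianBundle (𝓡 d) ∞ (EuclideanSpace ℝ (Fin d))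
      (fun x : M => TangentSpace (𝓡 d) x)]

variable {V : Distribution d M}

/-! ### Locality of tensorial operations -/

lemma IsLocalOp.covTorsion {D : Conn d M} (hD : IsLocalOp D) {x : M}
    {X X' Y Y' Z Z' : VField d M} (hX : ∀ᶠ y in 𝓝 x, X y = X' y) (hY : ∀ᶠ y in 𝓝 x, Y y = Y' y)
    (hZ : ∀ᶠ y in 𝓝 x, Z y = Z' y) : covTorsion D X Y Z x = covTorsion D X' Y' Z' x := by
  simp only [TGFoliation.covTorsion]
  rw [hD x _ _ _ _ hX (hD.torsion.eventually hY hZ), hD.torsion x _ _ _ _ (hD.eventually hX hY) hZ,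
    hD.torsion x _ _ _ _ hY (hD.eventually hX hZ)]

lemma IsLocalOp.curvature {D : Conn d M} (hD : IsLocalOp D) {x : M}
    {X X' Y Y' Z Z' : VField d M} (hX : ∀ᶠ y in 𝓝 x, X y = X' y) (hY : ∀ᶠ y in 𝓝 x, Y y = Y' y)
    (hZ : ∀ᶠ y in 𝓝 x, Z y = Z' y) : curvature D X Y Z x = curvature D X' Y' Z' x := by
  simp only [TGFoliation.curvature]
  rw [hD x _ _ _ _ hX (hD.eventually hY hZ), hD x _ _ _ _ hY (hD.eventually hX hZ),
    hD x _ _ _ _ (isLocalOp_bracket.eventually hX hY) hZ]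

lemma IsLocalOp.covForm {D : Conn d M} (hD : IsLocalOp D) {x : M} {X X' : VField d M}
    {α α' : CoField d M} (hX : ∀ᶠ y in 𝓝 x, X y = X' y) (hα : ∀ᶠ y in 𝓝 x, α y = α' y) :
    covForm D X α x = covForm D X' α' x := by
  funext w
  simp only [TGFoliation.covForm]
  rw [hD x _ _ _ _ hX (Filter.Eventually.of_forall fun _ => rfl), hX.self_of_nhds,
    hα.self_of_nhds, dirDeriv_congr (hα.mono fun y hy => by rw [hy])]

lemma IsLocalOp.covForm_eventually {D : Conn d M} (hD : IsLocalOp D) {x : M} {X X' : VField d M}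
    {α α' : CoField d M} (hX : ∀ᶠ y in 𝓝 x, X y = X' y) (hα : ∀ᶠ y in 𝓝 x, α y = α' y) :
    ∀ᶠ y in 𝓝 x, TGFoliation.covForm D X α y = TGFoliation.covForm D X' α' y := by
  filter_upwards [hX.eventually_nhds, hα.eventually_nhds] with y hy hy'
  exact hD.covForm hy hy'

section T2

variable [T2Space M] {m : ℕ}

/-! ### Bilinear forms over the smooth functions at a point -/

/-- The value at `x` of a bilinear form on smooth vector fields. -/
def evB (x : M) (B : Vec d M →ₗ[Fn d M] Vec d M →ₗ[Fn d M] Fn d M) :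
    TangentSpace (𝓡 d) x →ₗ[ℝ] TangentSpace (𝓡 d) x →ₗ[ℝ] ℝ :=
  LinearMap.mk₂ ℝ (fun v w => B (gext x v) (gext x w) x)
    (fun v v' w => (isLinearMap_gext (B.flip (gext x w)) x).map_add v v')
    (fun c v w => (isLinearMap_gext (B.flip (gext x w)) x).map_smul c v)
    (fun v w w' => (isLinearMap_gext (B (gext x v)) x).map_add w w')
    (fun c v w => (isLinearMap_gext (B (gext x v)) x).map_smul c w)

lemma evB_def (x : M) (B : Vec d M →ₗ[Fn d M] Vec d M →ₗ[Fn d M] Fn d M)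
    (v w : TangentSpace (𝓡 d) x) : evB x B v w = B (gext x v) (gext x w) x := rfl

lemma tensor_congr₂ (B : Vec d M →ₗ[Fn d M] Vec d M →ₗ[Fn d M] Fn d M) {X X' Y Y' : Vec d M}
    {x : M} (hX : X x = X' x) (hY : Y x = Y' x) : B X Y x = B X' Y' x :=
  (tensor_congr (B X) hY).trans (tensor_congr (B.flip Y') hX)

lemma evB_apply (B : Vec d M →ₗ[Fn d M] Vec d M →ₗ[Fn d M] Fn d M) (X Y : Vec d M) (x : M) :
    evB x B (X x) (Y x) = B X Y x := tensor_congr₂ B (by simp) (by simp)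

lemma tensor_congr_vec₂ (B : Vec d M →ₗ[Fn d M] Vec d M →ₗ[Fn d M] Vec d M)
    {X X' Y Y' : Vec d M} {x : M} (hX : X x = X' x) (hY : Y x = Y' x) : B X Y x = B X' Y' x :=
  (tensor_congr_vec (B X) hY).trans (tensor_congr_vec (B.flip Y') hX)

lemma frameSum_evB {x : M} {S : Submodule ℝ (TangentSpace (𝓡 d) x)}
    (B : Vec d M →ₗ[Fn d M] Vec d M →ₗ[Fn d M] Fn d M) {ι : Type*} [Fintype ι]
    {b : ι → Vec d M} (hb : Orthonormal ℝ fun i => b i x)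
    (hS : Submodule.span ℝ (Set.range fun i => b i x) = S) :
    frameSum S (fun e => B (gext x e) (gext x e) x) = ∑ i, B (b i) (b i) x :=
  (frameSum_eq_sum (evB x B) hb hS).trans
    (Finset.sum_congr rfl fun i _ => evB_apply B (b i) (b i) x)

lemma inner_frameSum {x : M} (S : Submodule ℝ (TangentSpace (𝓡 d) x))
    (F : TangentSpace (𝓡 d) x → TangentSpace (𝓡 d) x) (w : TangentSpace (𝓡 d) x) :
    inner ℝ (frameSum S F) w = frameSum S fun e => (inner ℝ (F e) w : ℝ) := sum_inner _ _ _

lemma inner_eq_sum {x : M} {S : Submodule ℝ (TangentSpace (𝓡 d) x)} {ι : Type*} [Fintype ι]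
    {b : ι → TangentSpace (𝓡 d) x} (hb : Orthonormal ℝ b)
    (hS : Submodule.span ℝ (Set.range b) = S) (u : TangentSpace (𝓡 d) x)
    {w : TangentSpace (𝓡 d) x} (hw : w ∈ S) :
    (inner ℝ u w : ℝ) = ∑ i, inner ℝ u (b i) * inner ℝ w (b i) := by
  have h := starProjection_eq_sum hb hS w
  rw [Submodule.starProjection_eq_self_iff.2 hw] at h
  conv_lhs => rw [h]
  rw [inner_sum]
  exact Finset.sum_congr rfl fun i _ => by
    rw [real_inner_smul_right, real_inner_comm (b i) w, mul_comm]

/-! ### Comparison with the Lie–Rinehart pair -/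

variable (hV : IsTotallyGeodesicRiemannianFoliation m V)

lemma coe_pv (X : Vec d M) : partV V X = (lieRinehart hV).pv X := rfl

lemma coe_ph (X : Vec d M) : partH V X = (lieRinehart hV).ph X := by
  funext x
  exact projH_eq_sub x (X x)

lemma coe_nab (X Y : Vec d M) : bott V X Y = (lieRinehart hV).nab X Y := by
  funext x
  simp only [bott, coe_pv hV, coe_ph hV, ← coe_lcV, ← coe_brV]
  have h : ∀ A : Vec d M, projH V x (A x) = (lieRinehart hV).ph A x := fun A =>
    congrFun (coe_ph hV A) x
  simp only [h]
  rfl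

lemma coe_tor (X Y : Vec d M) : torsion (bott V) X Y = (lieRinehart hV).tor X Y := by
  funext x
  simp only [torsion, coe_nab hV, ← coe_brV]
  rfl

lemma coe_covT (X Y Z : Vec d M) :
    covTorsion (bott V) X Y Z = (lieRinehart hV).covT X Y Z := by
  funext x
  simp only [covTorsion, coe_nab hV, coe_tor hV]
  rfl

lemma coe_curv (X Y Z : Vec d M) :
    curvature (bott V) X Y Z = (lieRinehart hV).curv X Y Z := by
  funext x
  simp only [curvature, coe_nab hV, ← coe_brV]
  rfl

lemma ext_eventually {x : M} (v : TangentSpace (𝓡 d) x) : ∀ᶠ y in 𝓝 x, ext v y = gext x v y :=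
  (gext_eventually v).mono fun _ h => h.symm

lemma torsionAt_apply (X Y : Vec d M) (x : M) :
    torsionAt V x (X x) (Y x) = (lieRinehart hV).tor X Y x := by
  rw [torsionAt, isLocalOp_bott.torsion x _ _ _ _ (ext_eventually _) (ext_eventually _), coe_tor hV]
  exact tensor_congr_vec₂ (lieRinehart hV).torL (by simp) (by simp)

lemma projV_apply (X : Vec d M) (x : M) : projV V x (X x) = (lieRinehart hV).pv X x := rfl

lemma projH_apply (X : Vec d M) (x : M) : projH V x (X x) = (lieRinehart hV).ph X x :=
  congrFun (coe_ph hV X) x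

lemma mem_orthogonal_of_pv {X : Vec d M} (h : (lieRinehart hV).pv X = 0) (x : M) :
    X x ∈ (V x)ᗮ := by
  rw [← (lieRinehart hV).eq_ph h, ← projH_apply]
  exact projH_mem x _

/-- Both sides are horizontal, so coefficients in a horizontal orthonormal basis decide. The
projections in `J` do not affect them, since the torsion is vertical and ignores vertical parts. -/
lemma J_apply (Z X : Vec d M) (x : M) : J V x (Z x) (X x) = (lieRinehart hV).jop Z X x := by
  obtain ⟨u, hu, hu', hu2⟩ := exists_orthonormal_span (V x)ᗮ
  rw [J, hu2]
  have h := starProjection_eq_sum hu hu' ((lieRinehart hV).jop Z X x)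
  rw [Submodule.starProjection_eq_self_iff.2
    (mem_orthogonal_of_pv hV ((lieRinehart hV).pv_jop Z X) x)] at h
  rw [h]
  refine Finset.sum_congr rfl fun i _ => congrArg (· • u i) ?_
  have h1 : u i = gext x (u i) x := (gext_self _).symm
  rw [h1, projV_apply hV, projH_apply hV, torsionAt_apply hV,
    real_inner_comm ((lieRinehart hV).jop Z X x)]
  have h2 : (lieRinehart hV).ip ((lieRinehart hV).pv Z)
      ((lieRinehart hV).tor ((lieRinehart hV).ph X) (gext x (u i)))
      = (lieRinehart hV).ip ((lieRinehart hV).jop Z X) (gext x (u i)) := by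
    rw [FoliatedLieRinehart.ip_jop, FoliatedLieRinehart.ip_pv, FoliatedLieRinehart.pv_tor,
      ← (lieRinehart hV).tor_ph_right ((lieRinehart hV).ph X), FoliatedLieRinehart.tor_ph]
  exact congrArg (fun f : Fn d M => f x) h2

/-- The function `1 / ε`. -/
abbrev recipFn (ε : ℝ≥0∞) : Fn d M := constFn (recip ε)

lemma coe_cn (ε : ℝ≥0∞) (X Y : Vec d M) :
    connEps V ε X Y = (lieRinehart hV).cn (recipFn ε) X Y := by
  funext x
  simp only [connEps, coe_nab hV, coe_tor hV, J_apply hV]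
  rfl

/-- A field of covectors that is represented by a form on smooth vector fields. -/
def Represents (α : CoField d M) (a : Vec d M →ₗ[Fn d M] Fn d M) : Prop :=
  ∀ (y : M) (w : TangentSpace (𝓡 d) y), α y w = a (gext y w) y

variable {hV} {α : CoField d M} {a : Vec d M →ₗ[Fn d M] Fn d M}

lemma Represents.apply (h : Represents α a) (W : Vec d M) (y : M) : α y (W y) = a W y :=
  (h y _).trans (tensor_congr a (by simp))

lemma represents_of_apply (h : ∀ (W : Vec d M) (y : M), α y (W y) = a W y) : Represents α a :=
  fun y w => by rw [← h (gext y w) y, gext_self]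

lemma Represents.sharp_eq {S : Vec d M} (h : Represents α ((lieRinehart hV).ip S)) (x : M) :
    sharp (α x) = S x := by
  have hl : IsLinearMap ℝ (α x) := by
    have : α x = fun w => (lieRinehart hV).ip S (gext x w) x := funext (h x)
    rw [this]; exact isLinearMap_gext _ x
  refine ext_inner_right ℝ fun w => ?_
  rw [inner_sharp hl, h x w]
  have : w = gext x w x := by simp
  conv_rhs => rw [this]
  rfl

lemma Represents.isSmoothOneForm (h : Represents α a) : IsSmoothOneForm α := by
  refine ⟨fun x => ?_, fun U X hU hX x hx => ?_⟩
  · have : α x = fun w => a (gext x w) x := funext (h x)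
    rw [this]; exact isLinearMap_gext _ x
  · obtain ⟨Y, hY⟩ := exists_global hU hX hx
    refine (ContMDiffAt.congr_of_eventuallyEq ((a Y).contMDiff x) ?_).contMDiffWithinAt
    filter_upwards [hY] with y hy
    rw [← hy, h.apply]

lemma IsSmoothOneForm.exists_represents (h : IsSmoothOneForm α) :
    ∃ a : Vec d M →ₗ[Fn d M] Fn d M, Represents α a := by
  refine ⟨⟨⟨fun X => ⟨fun x => α x (X x), contMDiffOn_univ.1
    (h.2 Set.univ X isOpen_univ X.contMDiff.contMDiffOn)⟩, fun X Y => ?_⟩, fun f X => ?_⟩,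
      represents_of_apply fun W y => rfl⟩
  · ext x; exact (h.1 x).map_add _ _
  · ext x; exact (h.1 x).map_smul _ _

variable (hV) in
lemma IsSmoothOneForm.exists_dual (h : IsSmoothOneForm α) :
    ∃ S : Vec d M, Represents α ((lieRinehart hV).ip S) := by
  obtain ⟨a, ha⟩ := h.exists_represents
  refine ⟨(lieRinehart hV).sharp a, represents_of_apply fun W y => ?_⟩
  rw [ha.apply, (lieRinehart hV).ip_sharp]

variable (hV) in
-- Being represented survives covariant differentiation, so the second derivative in the rough
-- Laplacian can be treated by applying this twice.
lemma Represents.covForm (h : Represents α a) (ε : ℝ≥0∞) (X : Vec d M) :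
    Represents (covForm (connEps V ε) X α) ((lieRinehart hV).cnF (recipFn ε) X a) := by
  intro y w
  have h1 := (isLocalOp_connEps (V := V) ε) y X X (ext w) (gext y w)
    (Filter.Eventually.of_forall fun _ => rfl) (ext_eventually w)
  rw [TGFoliation.covForm, h1, coe_cn hV, h.apply, dirDeriv_congr
    (g := (a (gext y w))) ((ext_eventually w).mono fun z hz => by rw [hz, h.apply])]
  rfl

variable (hV) in
lemma Represents.covForm_ext (h : Represents α a) (ε : ℝ≥0∞) {x : M}
    (e : TangentSpace (𝓡 d) x) (W : Vec d M) :
    TGFoliation.covForm (connEps V ε) (ext e) α x (W x)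
      = (lieRinehart hV).cnF (recipFn ε) (gext x e) a W x := by
  rw [(isLocalOp_connEps ε).covForm (ext_eventually e) (Filter.Eventually.of_forall fun _ => rfl)]
  exact (h.covForm hV ε (gext x e)).apply W x

variable (hV) in
lemma Represents.divEps₁ (h : Represents α a) (ε : ℝ≥0∞) {x : M} {ι : Type*} [Fintype ι]
    {b : ι → Vec d M} (hp : ∀ i, (lieRinehart hV).pv (b i) = 0) (hb : Orthonormal ℝ fun i => b i x)
    (hS : Submodule.span ℝ (Set.range fun i => b i x) = (V x)ᗮ) :
    divEps₁ V ε α x = - ∑ i, (lieRinehart hV).nabF (b i) a (b i) x := by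
  have h1 : ∀ e : TangentSpace (𝓡 d) x, TGFoliation.covForm (connEps V ε) (ext e) α x e
      = (lieRinehart hV).cnFL (recipFn ε) a (gext x e) (gext x e) x := fun e => by
    have := h.covForm_ext hV ε e (gext x e)
    rw [gext_self] at this
    exact this
  simp only [TGFoliation.divEps₁, h1]
  rw [frameSum_evB ((lieRinehart hV).cnFL (recipFn ε) a) hb hS]
  congr 1
  refine Finset.sum_congr rfl fun i _ => ?_
  rw [FoliatedLieRinehart.cnFL_apply, FoliatedLieRinehart.cnF_apply,
    (lieRinehart hV).cn_self _ (hp i)]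
  rfl

variable (hV) in
lemma Represents.roughLaplacian (h : Represents α a) (ε : ℝ≥0∞) {x : M} {ι : Type*} [Fintype ι]
    {b : ι → Vec d M} (hb : Orthonormal ℝ fun i => b i x)
    (hS : Submodule.span ℝ (Set.range fun i => b i x) = (V x)ᗮ) (W : Vec d M) :
    roughLaplacian V ε α x (W x) = ∑ i, (lieRinehart hV).rough (recipFn ε) a (b i) W x := by
  have h1 : ∀ e : TangentSpace (𝓡 d) x, TGFoliation.covForm (connEps V ε) (ext e)
        (TGFoliation.covForm (connEps V ε) (ext e) α) x (W x)
      - TGFoliation.covForm (connEps V ε) (connEps V ε (ext e) (ext e)) α x (W x)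
      -- Writing the summand through the second covariant derivative, which is linear over the
      -- functions in both directions, allows the trace to be computed in any horizontal orthonormal
      -- frame.
      = ((lieRinehart hV).hess (recipFn ε) a).compr₂ (LinearMap.applyₗ W)
        (gext x e) (gext x e) x := fun e => by
    have e1 := (isLocalOp_connEps (V := V) ε).covForm_eventually (ext_eventually e)
      (Filter.Eventually.of_forall fun y => rfl : ∀ᶠ y in 𝓝 x, α y = α y)
    have e2 := (isLocalOp_connEps (V := V) ε).eventually (ext_eventually e) (ext_eventually e)
    rw [(isLocalOp_connEps (V := V) ε).covForm (ext_eventually e) e1,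
      (isLocalOp_connEps (V := V) ε).covForm e2 (Filter.Eventually.of_forall fun y => rfl),
      coe_cn hV, ((h.covForm hV ε _).covForm hV ε _).apply, (h.covForm hV ε _).apply]
    rfl
  simp only [TGFoliation.roughLaplacian, h1]
  rw [frameSum_evB _ hb hS]
  rfl

/-- A field of bilinear forms that is represented by a bilinear form on smooth vector fields. -/
def Represents₂ (τ : CoField₂ d M) (t : Vec d M →ₗ[Fn d M] Vec d M →ₗ[Fn d M] Fn d M) : Prop :=
  ∀ (X Y : Vec d M) (y : M), τ y (X y) (Y y) = t X Y y

variable (hV) in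
lemma Represents.extD₁ (h : Represents α a) :
    Represents₂ (extD₁ α) ((lieRinehart hV).extF a) := by
  intro X Y y
  have hd : ∀ w v : TangentSpace (𝓡 d) y,
      dirDeriv (fun z => α z (ext w z)) y v = dirDeriv (a (gext y w)) y v := fun w v =>
    dirDeriv_congr ((ext_eventually w).mono fun z hz => by rw [hz, h.apply]) v
  rw [TGFoliation.extD₁, hd, hd,
    isLocalOp_bracket y _ _ _ _ (ext_eventually (X y)) (ext_eventually (Y y)), ← coe_brV, h.apply]
  rw [← tensor_congr₂ ((lieRinehart hV).extF a) (gext_self (X y)) (gext_self (Y y)),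
    FoliatedLieRinehart.extF_apply, fn_sub_apply, fn_sub_apply]
  have h1 : ∀ (A : Vec d M) (f : Fn d M), (lieRinehart hV).der A f y = dirDeriv f y (A y) :=
    fun A f => rfl
  rw [h1, h1, gext_self, gext_self]
  rfl

variable (hV) in
lemma Represents₂.divEps₂ {τ : CoField₂ d M} {t : Vec d M →ₗ[Fn d M] Vec d M →ₗ[Fn d M] Fn d M}
    (h : Represents₂ τ t) (ε : ℝ≥0∞) {x : M} {ι : Type*} [Fintype ι]
    {b : ι → Vec d M} (hb : Orthonormal ℝ fun i => b i x)
    (hS : Submodule.span ℝ (Set.range fun i => b i x) = (V x)ᗮ) (w : TangentSpace (𝓡 d) x) :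
    divEps₂ V ε τ x w = - ∑ i, (lieRinehart hV).cnF₂ (recipFn ε) t (b i) (b i) (gext x w) x := by
  have h1 : ∀ e : TangentSpace (𝓡 d) x, covForm₂ (connEps V ε) (ext e) τ x e w
      = (lieRinehart hV).cnF₂L (recipFn ε) t (gext x w) (gext x e) (gext x e) x := fun e => by
    have e1 := (isLocalOp_connEps (V := V) ε) x _ _ _ _ (ext_eventually e) (ext_eventually e)
    have e2 := (isLocalOp_connEps (V := V) ε) x _ _ _ _ (ext_eventually e) (ext_eventually w)
    rw [covForm₂, e1, e2, coe_cn hV, coe_cn hV, dirDeriv_congr (g := t (gext x e) (gext x w))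
      (by
        filter_upwards [ext_eventually e, ext_eventually w] with z h1 h2
        rw [h1, h2, h])]
    have h2 := h ((lieRinehart hV).cn (recipFn ε) (gext x e) (gext x e)) (gext x w) x
    have h3 := h (gext x e) ((lieRinehart hV).cn (recipFn ε) (gext x e) (gext x w)) x
    have h4 : (lieRinehart hV).der (gext x e) (t (gext x e) (gext x w)) x
      = dirDeriv (t (gext x e) (gext x w)) x (gext x e x) := rfl
    rw [gext_self] at h2 h3 h4
    rw [h2, h3, ext_self, FoliatedLieRinehart.cnF₂L_apply, FoliatedLieRinehart.cnF₂, fn_sub_apply,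
      fn_sub_apply, h4]
  simp only [TGFoliation.divEps₂, h1]
  rw [frameSum_evB _ hb hS]
  rfl

end T2

end TGFoliation

namespace TGFoliation
open Topology

variable {d : ℕ} {M : Type*} [TopologicalSpace M]
  [ChartedSpace (EuclideanSpace ℝ (Fin d)) M] [IsManifold (𝓡 d) ∞ M]
  [Bundle.RiemannianBundle (fun x : M => TangentSpace (𝓡 d) x)]
  [IsContMDiffRiemannianBundle (𝓡 d) ∞ (EuclideanSpace ℝ (Fin d))
      (fun x : M => TangentSpace (𝓡 d) x)]

variable {V : Distribution d M} [T2Space M] {m : ℕ}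
  (hV : IsTotallyGeodesicRiemannianFoliation m V)

/-! ### The Weitzenböck formula -/

lemma lieRinehart_ip_apply (X Y : Vec d M) (x : M) :
    (lieRinehart hV).ip X Y x = inner ℝ (X x) (Y x) := rfl

/-- A skew transformation of an orthonormal frame does not contribute to a trace. -/
lemma sum_skew_eq_zero {x : M} {S : Submodule ℝ (TangentSpace (𝓡 d) x)}
    (B : Vec d M →ₗ[Fn d M] Vec d M →ₗ[Fn d M] Fn d M) {ι : Type*} [Fintype ι]
    {b t : ι → Vec d M} (hb : Orthonormal ℝ fun i => b i x)
    (hS : Submodule.span ℝ (Set.range fun i => b i x) = S) (ht : ∀ i, t i x ∈ S)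
    (hskew : ∀ i j, (inner ℝ (t i x) (b j x) : ℝ) + inner ℝ (b i x) (t j x) = 0) :
    ∑ i, (B (b i) (t i) x + B (t i) (b i) x) = 0 := by
  have h : ∀ i, t i x = ∑ j, (inner ℝ (b j x) (t i x) : ℝ) • b j x := fun i => by
    have := starProjection_eq_sum hb hS (t i x)
    rwa [Submodule.starProjection_eq_self_iff.2 (ht i)] at this
  have h2 : ∀ i, B (b i) (t i) x + B (t i) (b i) x = ∑ j, (inner ℝ (b j x) (t i x) *
      (B (b i) (b j) x + B (b j) (b i) x)) := fun i => by
    rw [← evB_apply B (b i) (t i), ← evB_apply B (t i) (b i)]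
    conv_lhs => rw [h i]
    simp only [map_sum, map_smul, LinearMap.sum_apply, LinearMap.smul_apply, smul_eq_mul,
      evB_apply, ← Finset.sum_add_distrib, mul_add]
  simp only [h2]
  -- The coefficients are skew in the two indices and the bracketed expression is symmetric, so
  -- exchanging the indices changes the sign of the sum.
  have h3 : ∀ i j, (inner ℝ (b j x) (t i x) : ℝ) = - inner ℝ (b i x) (t j x) := fun i j => by
    rw [real_inner_comm (t i x)]; linarith [hskew i j]
  set c := ∑ i, ∑ j, (inner ℝ (b j x) (t i x) * (B (b i) (b j) x + B (b j) (b i) x)) with hc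
  have h4 : c = - c := by
    conv_lhs => rw [hc, Finset.sum_comm]
    rw [hc, ← Finset.sum_neg_distrib]
    refine Finset.sum_congr rfl fun j _ => ?_
    rw [← Finset.sum_neg_distrib]
    refine Finset.sum_congr rfl fun i _ => ?_
    rw [h3 i j]; ring
  linarith

variable {hV} {α : CoField d M} {S : Vec d M}

lemma deltaT_apply {x : M} {ι : Type*} [Fintype ι] {b : ι → Vec d M}
    (hb : Orthonormal ℝ fun i => b i x)
    (hS : Submodule.span ℝ (Set.range fun i => b i x) = (V x)ᗮ) (S W : Vec d M) :
    (inner ℝ (deltaT V x (S x)) (W x) : ℝ)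
      = - ∑ i, (lieRinehart hV).ip W ((lieRinehart hV).covT (b i) (b i) S) x := by
  have h1 : ∀ e : TangentSpace (𝓡 d) x,
      (inner ℝ (covTorsion (bott V) (ext e) (ext e) (ext (S x)) x) (W x) : ℝ)
        = ((lieRinehart hV).covTL S).compr₂ ((lieRinehart hV).ip W)
          (gext x e) (gext x e) x := fun e => by
    rw [isLocalOp_bott.covTorsion (ext_eventually e) (ext_eventually e) (ext_eventually (S x)),
      coe_covT hV, real_inner_comm]
    have : (lieRinehart hV).covT (gext x e) (gext x e) (gext x (S x)) x
        = (lieRinehart hV).covT (gext x e) (gext x e) S x :=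
      tensor_congr_vec ((lieRinehart hV).covTR (gext x e) (gext x e)) (by simp)
    rw [this]
    rfl
  rw [deltaT, inner_neg_left, inner_frameSum]
  simp only [h1]
  rw [frameSum_evB _ hb hS]
  rfl

/-- Since `J_z` is skew, `⟨J_z J_z S, W⟩ = -⟨J_z S, J_z W⟩`. Expanding in the horizontal frame gives
products `⟨z, T(S, b)⟩⟨z, T(W, b)⟩`, and the sum over the vertical frame recombines them because the
torsion is vertical. -/
lemma Jsq_apply {x : M} {ι κ : Type*} [Fintype ι] [Fintype κ] {b : ι → Vec d M} {z : κ → Vec d M}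
    (hb : Orthonormal ℝ fun i => b i x)
    (hS : Submodule.span ℝ (Set.range fun i => b i x) = (V x)ᗮ)
    (hz : Orthonormal ℝ fun i => z i x)
    (hS' : Submodule.span ℝ (Set.range fun i => z i x) = V x) (S W : Vec d M) :
    (inner ℝ (Jsq V x (S x)) (W x) : ℝ) = - ∑ i, (lieRinehart hV).ip
      ((lieRinehart hV).tor S (b i)) ((lieRinehart hV).tor W (b i)) x := by
  set F := lieRinehart hV with hF
  have hJ : ∀ Z X Y : Vec d M, (inner ℝ (F.jop Z X x) (Y x) : ℝ) = inner ℝ (Z x) (F.tor X Y x) :=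
    fun Z X Y => congrArg (fun f : Fn d M => f x) (F.ip_jop Z X Y)
  have h1 : ∀ e : TangentSpace (𝓡 d) x, (inner ℝ (J V x e (J V x e (S x))) (W x) : ℝ)
      = - (F.ip.compl₁₂ (F.jopL.flip S) (F.jopL.flip W)) (gext x e) (gext x e) x := fun e => by
    have h2 : J V x e (J V x e (S x)) = F.jop (gext x e) (F.jop (gext x e) S) x := by
      rw [← J_apply hV, ← J_apply hV, gext_self]
    have h3 : F.ip (F.jop (gext x e) (F.jop (gext x e) S)) W
        = - F.ip (F.jop (gext x e) S) (F.jop (gext x e) W) := by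
      rw [F.ip_jop, F.tor_swap, map_neg, ← F.ip_jop, F.ip_comm]
    rw [h2]
    exact congrArg (fun f : Fn d M => f x) h3
  rw [Jsq, inner_frameSum]
  simp only [h1]
  have h4 : frameSum (V x) (fun e => - (F.ip.compl₁₂ (F.jopL.flip S) (F.jopL.flip W))
      (gext x e) (gext x e) x) = - frameSum (V x) (fun e =>
        (F.ip.compl₁₂ (F.jopL.flip S) (F.jopL.flip W)) (gext x e) (gext x e) x) :=
    Finset.sum_neg_distrib _
  rw [h4, frameSum_evB _ hz hS']
  congr 1
  have h5 : ∀ l, (F.ip.compl₁₂ (F.jopL.flip S) (F.jopL.flip W)) (z l) (z l) x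
      = ∑ i, inner ℝ (z l x) (F.tor S (b i) x) * inner ℝ (z l x) (F.tor W (b i) x) := fun l => by
    have := inner_eq_sum hb hS (F.jop (z l) S x)
      (mem_orthogonal_of_pv hV (F.pv_jop (z l) W) x)
    refine this.trans ?_
    simp only [hJ]
  simp only [h5]
  rw [Finset.sum_comm]
  refine Finset.sum_congr rfl fun i _ => ?_
  have hm : F.tor W (b i) x ∈ V x := by
    rw [← F.pv_tor, hF, ← projV_apply]
    exact projV_mem x _
  have := inner_eq_sum hz hS' (F.tor S (b i) x) hm
  rw [hF, lieRinehart_ip_apply, ← hF, this]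
  exact Finset.sum_congr rfl fun l _ => by
    rw [real_inner_comm (F.tor S (b i) x), real_inner_comm (F.tor W (b i) x)]

/-- The Ricci trace runs over the whole tangent space, but the curvature maps horizontal fields to
horizontal fields, so vertical frame vectors contribute nothing. On horizontal ones `ip_curv_eq`
applies. -/
lemma Represents.ricH (h : Represents α ((lieRinehart hV).ip S)) {x : M} {ι : Type*} [Fintype ι]
    {b : ι → Vec d M} (hp : ∀ i, (lieRinehart hV).pv (b i) = 0) (hb : Orthonormal ℝ fun i => b i x)
    (hS : Submodule.span ℝ (Set.range fun i => b i x) = (V x)ᗮ) (W : Vec d M) :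
    ricH V α x (W x) = ∑ i, (lieRinehart hV).ip S ((lieRinehart hV).curv W (b i) (b i)) x := by
  set F := lieRinehart hV with hF
  let B := F.ip.comp (F.curv₁ (F.ph S) (F.ph W))
  have h1 : ∀ e : TangentSpace (𝓡 d) x, (inner ℝ (curvature (bott V) (ext e)
      (ext (F.ph S x)) (ext (F.ph W x)) x) e : ℝ) = evB x B e e := fun e => by
    rw [isLocalOp_bott.curvature (ext_eventually _) (ext_eventually _) (ext_eventually _),
      coe_curv hV]
    have e1 : F.curv (gext x e) (gext x (F.ph S x)) (gext x (F.ph W x)) x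
        = F.curv (gext x e) (F.ph S) (F.ph W) x :=
      (tensor_congr_vec (F.curv₃ _ _) (gext_self (F.ph W x))).trans (by
        rw [F.curv₃_apply, ← F.curv₂_apply, ← F.curv₂_apply]
        exact tensor_congr_vec (F.curv₂ _ _) (by simp))
    rw [← hF, e1, evB_def]
    have e2 : e = gext x e x := by simp
    conv_lhs => enter [3]; rw [e2]
    rfl
  rw [TGFoliation.ricH, h.sharp_eq, projH_apply hV, projH_apply hV, ricci]
  simp only [← hF, h1]
  have h2 : frameSum (V x) (fun e => evB x B e e) = 0 := by
    refine Finset.sum_eq_zero fun i _ => ?_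
    set e : TangentSpace (𝓡 d) x := (stdOrthonormalBasis ℝ (V x) i : V x).1
    have he : e = F.pv (gext x e) x := by
      rw [hF, ← projV_apply, gext_self, projV_of_mem (Subtype.mem _)]
    show evB x B e e = 0
    have h3 : F.ip (F.curv (F.pv (gext x e)) (F.ph S) (F.ph W)) (F.pv (gext x e)) = 0 := by
      rw [← F.ph_curv]; simp
    have h4 : evB x B e e = B (F.pv (gext x e)) (F.pv (gext x e)) x := by
      conv_lhs => rw [he]
      rw [evB_apply]
    rw [h4]
    exact congrArg (fun f : Fn d M => f x) h3
  rw [frameSum_top (V x), h2, add_zero, frameSum_eq_sum _ hb hS]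
  refine Finset.sum_congr rfl fun i _ => ?_
  rw [evB_apply]
  exact congrArg (fun f : Fn d M => f x) (F.ip_curv_eq S W (hp i)).symm

/-- The horizontal Laplacian on one-forms is a Hodge Laplacian. -/
theorem lapEps_eq (hV : IsTotallyGeodesicRiemannianFoliation m V) (ε : ℝ≥0∞)
    (hα : IsSmoothOneForm α) (x : M) (v : TangentSpace (𝓡 d) x) :
    lapEps V ε α x v = - extD₀ (divEps₁ V ε α) x v - divEps₂ V ε (extD₁ α) x v := by
  obtain ⟨S, h⟩ := hα.exists_dual hV
  obtain ⟨b, z, hp, -, hbz⟩ := exists_adapted_frame hV.smooth x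
  replace hp : ∀ i, (lieRinehart hV).pv (b i) = 0 := hp
  obtain ⟨⟨hb, hS⟩, hz, hS'⟩ := hbz.self_of_nhds
  set F := lieRinehart hV with hF
  set r : Fn d M := recipFn ε with hr
  have h3 := (h.extD₁ hV).divEps₂ hV ε hb hS v
  obtain ⟨W, hW⟩ : ∃ W : Vec d M, W = gext x v := ⟨_, rfl⟩
  have hv : W x = v := by simp [hW]
  rw [← hW] at h3
  have h1 : roughLaplacian V ε α x v = ∑ i, F.rough r (F.ip S) (b i) W x := by
    have := h.roughLaplacian hV ε hb hS W
    rw [hv] at this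
    rw [this]
  have h2 : extD₀ (divEps₁ V ε α) x v = - ∑ i, F.der W (F.nabF (b i) (F.ip S) (b i)) x := by
    -- The frame is orthonormal near `x` and not only at `x`; therefore the formula for the
    -- divergence may be differentiated.
    have e1 : ∀ᶠ y in 𝓝 x, divEps₁ V ε α y = (- ∑ i, F.nabF (b i) (F.ip S) (b i) : Fn d M) y := by
      filter_upwards [hbz] with y hy
      rw [h.divEps₁ hV ε hp hy.1.1 hy.1.2, fn_neg_apply, fn_sum_apply]
    rw [extD₀, dirDeriv_congr e1, ← hv, ← derV_apply, map_neg, map_sum, fn_neg_apply, fn_sum_apply]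
    rfl
  have h4 : onForms (deltaT V) α x v = - ∑ i, F.ip W (F.covT (b i) (b i) S) x := by
    rw [onForms, h.sharp_eq, ← hv, deltaT_apply (hV := hV) hb hS]
  have h5 : onForms (Jsq V) α x v = - ∑ i, F.ip (F.tor S (b i)) (F.tor W (b i)) x := by
    rw [onForms, h.sharp_eq, ← hv, Jsq_apply (hV := hV) hb hS hz hS']
  have h6 : ricH V α x v = ∑ i, F.ip S (F.curv W (b i) (b i)) x := by
    rw [← hv, h.ricH hp hb hS]
  -- `J_W` is skew with horizontal values, so its contribution to the trace is zero.
  have k1 : ∑ i, (F.nabF (b i) (F.ip S) (F.jop W (b i)) x + F.nabF (F.jop W (b i)) (F.ip S) (b i) x)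
      = 0 := by
    refine sum_skew_eq_zero (F.nabFL (F.ip S)) hb hS
      (fun i => mem_orthogonal_of_pv hV (F.pv_jop _ _) x) fun i j => ?_
    have e : F.ip (F.jop W (b i)) (b j) + F.ip (b i) (F.jop W (b j)) = 0 := by
      rw [F.ip_comm (b i), F.ip_jop, F.ip_jop, F.tor_swap]; simp
    exact congrArg (fun f : Fn d M => f x) e
  have k2 : ∑ i, (F.nabF (b i) (F.ip S) (F.nab W (b i)) x + F.nabF (F.nab W (b i)) (F.ip S) (b i) x)
      = 0 := by
    refine sum_skew_eq_zero (F.nabFL (F.ip S)) hb hS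
      (fun i => mem_orthogonal_of_pv hV (by rw [F.pv_nab, hp, map_zero]) x) fun i j => ?_
    have e := congrArg (fun f : Fn d M => f x) (F.der_ip W (b i) (b j))
    -- The products `⟨bᵢ, bⱼ⟩` are constant near `x`; as the Bott connection is metric, `∇_W` acts
    -- on the frame as a skew transformation.
    have e1 : F.der W (F.ip (b i) (b j)) x = 0 := by
      have e2 : ∀ᶠ y in 𝓝 x, F.ip (b i) (b j) y
          = (constFn (if i = j then (1 : ℝ) else 0) : Fn d M) y := by
        filter_upwards [hbz] with y hy
        exact (orthonormal_iff_ite.1 hy.1.1) i j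
      show dirDeriv (F.ip (b i) (b j)) x (W x) = 0
      rw [dirDeriv_congr e2, ← derV_apply, derV_const]
      rfl
    exact e.symm.trans e1
  have key : ∀ i, F.rough r (F.ip S) (b i) W x - F.der W (F.nabF (b i) (F.ip S) (b i)) x
        - F.cnF₂ r (F.extF (F.ip S)) (b i) (b i) W x
      = - recip ε * (F.nabF (b i) (F.ip S) (F.jop W (b i)) x
          + F.nabF (F.jop W (b i)) (F.ip S) (b i) x)
        - (F.nabF (b i) (F.ip S) (F.nab W (b i)) x + F.nabF (F.nab W (b i)) (F.ip S) (b i) x)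
        - recip ε * F.ip W (F.covT (b i) (b i) S) x
        - recip ε * F.ip (F.tor S (b i)) (F.tor W (b i)) x
        + F.ip S (F.curv W (b i) (b i)) x := fun i => by
    have := congrArg (fun f : Fn d M => f x)
      (F.weitzenboeck r (fun X => derV_const X _) S W (hp i))
    simp only [fn_sub_apply, fn_add_apply, fn_mul_apply, fn_neg_apply] at this
    have hrx : r x = recip ε := rfl
    rw [hrx] at this
    rw [this]; ring
  have sum := Finset.sum_congr (rfl : (Finset.univ : Finset (Fin _)) = _) fun i _ => key i
  simp only [Finset.sum_sub_distrib, Finset.sum_add_distrib, ← Finset.mul_sum] at sum k1 k2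
  rw [lapEps, h1, h2, h3, h4, h5, h6]
  linear_combination sum - recip ε * k1 - k2

end TGFoliation

namespace TGFoliation
open Topology

variable {d : ℕ} {M : Type*} [TopologicalSpace M]
  [ChartedSpace (EuclideanSpace ℝ (Fin d)) M] [IsManifold (𝓡 d) ∞ M]

/-! ### Coordinate fields -/

scoped instance instIsManifoldOne : IsManifold (𝓡 d) 1 M := IsManifold.of_le (n := ∞) (by simp)

/-- The coordinate fields of the chart at `c`. -/
def coordField (c : M) (i : Fin d) : VField d M := fun p =>
  (trivializationAt (EuclideanSpace ℝ (Fin d)) (TangentSpace (𝓡 d) : M → Type _) c).symmₗ ℝ p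
    (EuclideanSpace.single i 1)

lemma mem_baseSet_iff {c p : M} :
    p ∈ (trivializationAt (EuclideanSpace ℝ (Fin d)) (TangentSpace (𝓡 d) : M → Type _) c).baseSet
      ↔ p ∈ (extChartAt (𝓡 d) c).source := by
  rw [TangentBundle.trivializationAt_baseSet, extChartAt_source]

lemma smoothFieldOn_coordField (c : M) (i : Fin d) :
    SmoothFieldOn (coordField c i) (extChartAt (𝓡 d) c).source := by
  set t := trivializationAt (EuclideanSpace ℝ (Fin d)) (TangentSpace (𝓡 d) : M → Type _) c
  intro y hy
  rw [t.contMDiffWithinAt_section _ (mem_baseSet_iff.2 hy)]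
  have : ContMDiffOn (𝓡 d) 𝓘(ℝ, EuclideanSpace ℝ (Fin d)) ∞
      (fun _ : M => (EuclideanSpace.single i 1 : EuclideanSpace ℝ (Fin d)))
      (extChartAt (𝓡 d) c).source := contMDiffOn_const
  exact this.congr (fun z hz ↦ by
    show (t ⟨z, t.symmₗ ℝ z _⟩).2 = _
    rw [t.symmₗ_apply (mem_baseSet_iff.2 hz), t.apply_mk_symm (mem_baseSet_iff.2 hz)]) y hy

lemma coordField_eq_tangentCoordChange {c p : M} (hp : p ∈ (extChartAt (𝓡 d) c).source)
    (i : Fin d) : coordField c i p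
      = tangentCoordChange (𝓡 d) c p p (EuclideanSpace.single i (1 : ℝ)) := by
  rw [extChartAt_source] at hp
  have h := TangentBundle.symmL_trivializationAt_eq_core (I := 𝓡 d) hp
  exact congrArg (fun L : EuclideanSpace ℝ (Fin d) →L[ℝ] EuclideanSpace ℝ (Fin d) =>
    L (EuclideanSpace.single i (1 : ℝ))) h

lemma coordField_symm {c : M} {y : EuclideanSpace ℝ (Fin d)}
    (hy : y ∈ (extChartAt (𝓡 d) c).target) (i : Fin d) :
    coordField c i ((extChartAt (𝓡 d) c).symm y)
      = mfderiv 𝓘(ℝ, EuclideanSpace ℝ (Fin d)) (𝓡 d) (extChartAt (𝓡 d) c).symm y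
          (EuclideanSpace.single i (1 : ℝ)) := by
  have hp := (extChartAt (𝓡 d) c).map_target hy
  rw [extChartAt_source] at hp
  have h := TangentBundle.symmL_trivializationAt (I := 𝓡 d) hp
  have hy' := (extChartAt (𝓡 d) c).right_inv hy
  have h2 : ∀ y', y' = y → (mfderivWithin 𝓘(ℝ, EuclideanSpace ℝ (Fin d)) (𝓡 d)
      (extChartAt (𝓡 d) c).symm (Set.range (𝓡 d)) y' :
        EuclideanSpace ℝ (Fin d) →L[ℝ] EuclideanSpace ℝ (Fin d))
      = mfderiv 𝓘(ℝ, EuclideanSpace ℝ (Fin d)) (𝓡 d) (extChartAt (𝓡 d) c).symm y := by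
    rintro _ rfl
    have : Set.range (𝓡 d) = Set.univ := by simp
    rw [this, mfderivWithin_univ]
  exact congrArg (fun L : EuclideanSpace ℝ (Fin d) →L[ℝ] EuclideanSpace ℝ (Fin d) =>
    L (EuclideanSpace.single i (1 : ℝ))) (Eq.trans h (h2 _ hy'))

lemma coordField_transition {c c' p : M} (hp : p ∈ (extChartAt (𝓡 d) c).source)
    (hp' : p ∈ (extChartAt (𝓡 d) c').source) (i : Fin d) :
    coordField c i p = ∑ k, (tangentCoordChange (𝓡 d) c c' p
      (EuclideanSpace.single i (1 : ℝ))) k • coordField c' k p := by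
  rw [coordField_eq_tangentCoordChange hp,
    ← tangentCoordChange_comp (I := 𝓡 d) (x := c') ⟨⟨hp, hp'⟩, mem_extChartAt_source p⟩]
  set v := tangentCoordChange (𝓡 d) c c' p (EuclideanSpace.single i (1 : ℝ))
  have hv : v = ∑ k, v k • EuclideanSpace.single k (1 : ℝ) := by
    have := (EuclideanSpace.basisFun (Fin d) ℝ).sum_repr v
    simpa using this.symm
  conv_lhs => rw [hv, map_sum]
  refine Finset.sum_congr rfl fun k _ => ?_
  rw [map_smul, coordField_eq_tangentCoordChange hp']
  rfl

variable [Bundle.RiemannianBundle (fun x : M => TangentSpace (𝓡 d) x)]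

/-- The Gram matrix of the coordinate fields. -/
def gramAt (c p : M) : Matrix (Fin d) (Fin d) ℝ := Matrix.gram ℝ fun i => coordField c i p

lemma gram_eq {c : M} {y : EuclideanSpace ℝ (Fin d)}
    (hy : y ∈ (extChartAt (𝓡 d) c).target) :
    gram d M c y = gramAt (d := d) c ((extChartAt (𝓡 d) c).symm y) := by
  ext i j
  rw [gramAt, Matrix.gram_apply, coordField_symm hy, coordField_symm hy]
  rfl

/-- The Gram matrices are related by `Aᵀ G A` with `A` the Jacobian matrix of the change of charts;
then take determinants. -/
lemma gramAt_transition {c c' p : M} (hp : p ∈ (extChartAt (𝓡 d) c).source)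
    (hp' : p ∈ (extChartAt (𝓡 d) c').source) :
    Real.sqrt (gramAt (d := d) c p).det
      = |(tangentCoordChange (𝓡 d) c c' p).det| * Real.sqrt (gramAt (d := d) c' p).det := by
  set D := tangentCoordChange (𝓡 d) c c' p with hD
  let b := (EuclideanSpace.basisFun (Fin d) ℝ).toBasis
  let A := LinearMap.toMatrix b b (D : EuclideanSpace ℝ (Fin d) →ₗ[ℝ] EuclideanSpace ℝ (Fin d))
  have hA : A.det = D.det := LinearMap.det_toMatrix b _
  have hA2 : ∀ i j, A i j = D (EuclideanSpace.single j (1 : ℝ)) i := fun i j => by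
    simp [A, b, LinearMap.toMatrix_apply]
  have h : gramAt c p = A.transpose * gramAt c' p * A := by
    ext i j
    simp only [gramAt, Matrix.gram_apply, Matrix.mul_apply, Matrix.transpose_apply, hA2,
      coordField_transition hp hp', sum_inner, inner_sum, real_inner_smul_left,
      real_inner_smul_right, Finset.sum_mul, ← hD]
    exact Finset.sum_congr rfl fun k _ => Finset.sum_congr rfl fun l _ => by
      rw [real_inner_comm (coordField c' k p)]; ring
  rw [h, Matrix.det_mul, Matrix.det_mul, Matrix.det_transpose, hA,
    show D.det * (gramAt c' p).det * D.det = D.det ^ 2 * (gramAt c' p).det by ring,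
    Real.sqrt_mul (sq_nonneg _), Real.sqrt_sq_eq_abs]

/-! ### The Riemannian measure in charts -/

variable [IsContMDiffRiemannianBundle (𝓡 d) ∞ (EuclideanSpace ℝ (Fin d))
      (fun x : M => TangentSpace (𝓡 d) x)]

/-- The volume density of the chart at `c`. -/
def density (c p : M) : ℝ := Real.sqrt (gramAt (d := d) c p).det

lemma contMDiffOn_gramAt (c : M) (i j : Fin d) : ContMDiffOn (𝓡 d) 𝓘(ℝ, ℝ) ∞
    (fun p => gramAt c p i j) (extChartAt (𝓡 d) c).source :=
  (smoothFieldOn_coordField c i).inner (smoothFieldOn_coordField c j)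

lemma det_gramAt_pos {c p : M} (hp : p ∈ (extChartAt (𝓡 d) c).source) :
    0 < (gramAt (d := d) c p).det := by
  refine (Matrix.posDef_gram_of_linearIndependent ?_).det_pos
  set t := trivializationAt (EuclideanSpace ℝ (Fin d)) (TangentSpace (𝓡 d) : M → Type _) c
  have hp' := mem_baseSet_iff.2 hp
  have h : Function.Injective (t.symmₗ ℝ p) := fun v w h => by
    rw [← t.linearMapAt_symmₗ (R := ℝ) hp' v, h, t.linearMapAt_symmₗ hp']
  have := (EuclideanSpace.basisFun (Fin d) ℝ).toBasis.linearIndependent.map'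
      (t.symmₗ ℝ p) (LinearMap.ker_eq_bot.2 h)
  rw [OrthonormalBasis.coe_toBasis] at this
  have h2 : (t.symmₗ ℝ p) ∘ (EuclideanSpace.basisFun (Fin d) ℝ) = fun i => coordField c i p := by
    funext i
    simp [coordField, t]
  rwa [h2] at this

lemma density_pos {c p : M} (hp : p ∈ (extChartAt (𝓡 d) c).source) : 0 < density (d := d) c p :=
  Real.sqrt_pos.2 (det_gramAt_pos hp)

lemma contMDiffOn_density (c : M) : ContMDiffOn (𝓡 d) 𝓘(ℝ, ℝ) ∞ (density (d := d) c)
    (extChartAt (𝓡 d) c).source := by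
  refine contMDiffOn_sqrt ?_ fun p hp => (det_gramAt_pos hp).ne'
  simp only [Matrix.det_apply]
  refine contMDiffOn_finsetSum fun σ _ => ?_
  have h := contMDiffOn_finsetProd (t := Finset.univ)
    (f := fun i p => gramAt (d := d) c p (σ i) i) fun i _ => contMDiffOn_gramAt c (σ i) i
  have h2 : ContMDiffOn (𝓡 d) 𝓘(ℝ, ℝ) ∞ (fun _ : M => ((Equiv.Perm.sign σ : ℤ) : ℝ))
    (extChartAt (𝓡 d) c).source := contMDiffOn_const
  refine (h2.mul h).congr fun p _ => ?_
  simp [Units.smul_def]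

variable [MeasurableSpace M] [BorelSpace M]

lemma measurableSet_chart_preimage (c : M) {s : Set M} (hs : MeasurableSet s) :
    MeasurableSet ((extChartAt (𝓡 d) c).symm ⁻¹' s ∩ (extChartAt (𝓡 d) c).target) := by
  have h := (continuousOn_iff_continuous_domRestrict.1
    (continuousOn_extChartAt_symm (I := 𝓡 d) c)).measurable hs
  have h2 := (isOpen_extChartAt_target (I := 𝓡 d) c).measurableSet.subtype_image h
  rw [Set.domRestrict_eq, Set.preimage_comp, Subtype.image_preimage_coe, Set.inter_comm] at h2
  exact h2

lemma chartVolume_apply (c : M) {s : Set M} (hs : MeasurableSet s) :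
    chartVolume d M c s = ∫⁻ y in (extChartAt (𝓡 d) c).symm ⁻¹' s ∩ (extChartAt (𝓡 d) c).target,
      ENNReal.ofReal (density (d := d) c ((extChartAt (𝓡 d) c).symm y)) := by
  have ht := (isOpen_extChartAt_target (I := 𝓡 d) c).measurableSet
  have h1 : AEMeasurable (extChartAt (𝓡 d) c).symm
      ((volume : Measure (EuclideanSpace ℝ (Fin d))).restrict (extChartAt (𝓡 d) c).target) :=
    (continuousOn_extChartAt_symm c).aemeasurable ht
  rw [chartVolume, Measure.map_apply_of_aemeasurable
    (h1.mono_ac (withDensity_absolutelyContinuous _ _)) hs, withDensity_apply', 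
    Measure.restrict_restrict' ht]
  exact setLIntegral_congr_fun (measurableSet_chart_preimage c hs) fun y hy => by
    simp only [gram_eq hy.2]; rfl

/-- In the change of variables formula the Jacobian factor is exactly the quotient of the two
densities. -/
lemma chartVolume_eq {c c' : M} {s : Set M} (hs : MeasurableSet s)
    (h : s ⊆ (extChartAt (𝓡 d) c).source) (h' : s ⊆ (extChartAt (𝓡 d) c').source) :
    chartVolume d M c s = chartVolume d M c' s := by
  rw [chartVolume_apply c hs, chartVolume_apply c' hs]
  set φ := extChartAt (𝓡 d) c with hφ
  set φ' := extChartAt (𝓡 d) c' with hφ'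
  have himg : (φ' ∘ φ.symm) '' (φ.symm ⁻¹' s ∩ φ.target) = φ'.symm ⁻¹' s ∩ φ'.target := by
    ext z
    constructor
    · rintro ⟨y, ⟨hy, hyt⟩, rfl⟩
      refine ⟨?_, φ'.map_source (h' hy)⟩
      show φ'.symm (φ' (φ.symm y)) ∈ s
      rw [φ'.left_inv (h' hy)]
      exact hy
    · rintro ⟨hz, hzt⟩
      refine ⟨φ (φ'.symm z), ⟨?_, φ.map_source (h hz)⟩, ?_⟩
      · show φ.symm (φ (φ'.symm z)) ∈ s
        rw [φ.left_inv (h hz)]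
        exact hz
      · show φ' (φ.symm (φ (φ'.symm z))) = z
        rw [φ.left_inv (h hz), φ'.right_inv hzt]
  rw [← himg, lintegral_image_eq_lintegral_abs_det_fderiv_mul volume
    (measurableSet_chart_preimage c hs)
    (f' := fun y => tangentCoordChange (𝓡 d) c c' (φ.symm y))]
  · refine setLIntegral_congr_fun (measurableSet_chart_preimage c hs) fun y hy => ?_
    have hy1 : φ'.symm ((φ' ∘ φ.symm) y) = φ.symm y := φ'.left_inv (h' hy.1)
    simp only [hy1]
    rw [← ENNReal.ofReal_mul (abs_nonneg _), density, gramAt_transition (h hy.1) (h' hy.1)]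
    rfl
  · intro y hy
    have := hasFDerivWithinAt_tangentCoordChange (I := 𝓡 d) (z := φ.symm y) ⟨h hy.1, h' hy.1⟩
    rw [← hφ, φ.right_inv hy.2] at this
    exact this.mono (by simp)
  · intro y hy z hz hyz
    exact φ.symm.injOn hy.2 hz.2 (φ'.injOn (h' hy.1) (h' hz.1) hyz)

lemma chartVolume_compl_source (c : M) :
    chartVolume d M c (extChartAt (𝓡 d) c).sourceᶜ = 0 := by
  rw [chartVolume_apply c (isOpen_extChartAt_source c).measurableSet.compl]
  have : (extChartAt (𝓡 d) c).symm ⁻¹' (extChartAt (𝓡 d) c).sourceᶜ ∩ (extChartAt (𝓡 d) c).target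
      = ∅ := by
    ext y
    simp only [Set.mem_inter_iff, Set.mem_preimage, Set.mem_compl_iff, Set.mem_empty_iff_false,
      iff_false, not_and]
    exact fun h h2 => h ((extChartAt (𝓡 d) c).map_target h2)
  rw [this]
  simp

/-- The measure of another chart sees only the part of `s` in its own domain, where the two measures
agree. Hence no chart exceeds the one whose domain contains `s`. -/
lemma chartVolume_le (c c' : M) {s : Set M} (hs : MeasurableSet s)
    (h : s ⊆ (extChartAt (𝓡 d) c).source) :
    chartVolume d M c' s ≤ chartVolume d M c s := by
  have hm := (isOpen_extChartAt_source (I := 𝓡 d) c').measurableSet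
  calc chartVolume d M c' s
      ≤ chartVolume d M c' (s ∩ (extChartAt (𝓡 d) c').source)
        + chartVolume d M c' (extChartAt (𝓡 d) c').sourceᶜ := by
        refine (measure_mono fun x hx => ?_).trans (measure_union_le _ _)
        by_cases hx' : x ∈ (extChartAt (𝓡 d) c').source
        · exact Or.inl ⟨hx, hx'⟩
        · exact Or.inr hx'
    _ = chartVolume d M c (s ∩ (extChartAt (𝓡 d) c').source) := by
        rw [chartVolume_compl_source, add_zero, chartVolume_eq (hs.inter hm)
          Set.inter_subset_right (Set.inter_subset_left.trans h)]
    _ ≤ chartVolume d M c s := measure_mono Set.inter_subset_left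

/-- Glueing of finitely many measures along a measurable partition. -/
lemma riemannianVolume_apply [CompactSpace M] (c : M) {s : Set M} (hs : MeasurableSet s)
    (h : s ⊆ (extChartAt (𝓡 d) c).source) :
    riemannianVolume d M s = chartVolume d M c s := by
  refine le_antisymm ?_ (Measure.le_iff'.1 (le_iSup (chartVolume d M) c) s)
  obtain ⟨t, ht⟩ := isCompact_univ.elim_finite_subcover (fun c : M => (extChartAt (𝓡 d) c).source)
    (fun c => isOpen_extChartAt_source c) (fun x _ => Set.mem_iUnion.2 ⟨x, mem_extChartAt_source x⟩)
  have hcov : ∀ x, ∃ c ∈ t, x ∈ (extChartAt (𝓡 d) c).source := fun x => by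
    simpa using ht (Set.mem_univ x)
  let l := t.toList
  let A : ℕ → Set M := fun k => if hk : k < l.length then (extChartAt (𝓡 d) l[k]).source else ∅
  have hA : ∀ k, MeasurableSet (A k) := fun k => by
    by_cases hk : k < l.length
    · simp only [A, hk, dif_pos]; exact (isOpen_extChartAt_source _).measurableSet
    · simp only [A, hk, dif_neg, not_false_eq_true, MeasurableSet.empty]
  let B := disjointed A
  have hB : ∀ k, MeasurableSet (B k) := fun k => MeasurableSet.disjointed hA k
  have hBu : ⋃ k, B k = Set.univ := by
    rw [iUnion_disjointed]
    refine Set.eq_univ_of_forall fun x => ?_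
    obtain ⟨c, hc, hx⟩ := hcov x
    obtain ⟨k, hk, rfl⟩ := List.getElem_of_mem (Finset.mem_toList.2 hc)
    exact Set.mem_iUnion.2 ⟨k, by simp only [A]; rw [dif_pos hk]; exact hx⟩
  -- Compactness gives finitely many chart domains, made disjoint. Their restricted chart measures
  -- add up to `ν`, which dominates every chart measure and so the supremum, while on `s` it is at
  -- most the measure of the chart at `c`.
  let ν : Measure M := Measure.sum fun k =>
    if hk : k < l.length then (chartVolume d M l[k]).restrict (B k) else 0
  have hle : riemannianVolume d M ≤ ν := by
    refine iSup_le fun c' => Measure.le_iff.2 fun s hs => ?_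
    rw [Measure.sum_apply _ hs]
    conv_lhs => rw [← Set.inter_univ s, ← hBu, Set.inter_iUnion]
    refine (measure_iUnion_le _).trans (ENNReal.tsum_le_tsum fun k => ?_)
    by_cases hk : k < l.length
    · rw [dif_pos hk, Measure.restrict_apply hs]
      refine chartVolume_le _ _ (hs.inter (hB k)) (Set.inter_subset_right.trans ?_)
      refine (disjointed_subset A k).trans ?_
      simp only [A]
      rw [dif_pos hk]
    · have : B k = ∅ := Set.subset_empty_iff.1 ((disjointed_subset A k).trans (by
        simp only [A]; rw [dif_neg hk]))
      simp [this]
  refine (Measure.le_iff'.1 hle s).trans ?_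
  rw [Measure.sum_apply _ hs]
  calc _ ≤ ∑' k, chartVolume d M c (s ∩ B k) := by
        refine ENNReal.tsum_le_tsum fun k => ?_
        by_cases hk : k < l.length
        · rw [dif_pos hk, Measure.restrict_apply hs]
          exact chartVolume_le _ _ (hs.inter (hB k)) (Set.inter_subset_left.trans h)
        · simp [hk]
    _ = chartVolume d M c (⋃ k, s ∩ B k) := by
        rw [measure_iUnion (fun i j hij => (disjoint_disjointed A hij).mono
          Set.inter_subset_right Set.inter_subset_right) fun k => hs.inter (hB k)]
    _ = chartVolume d M c s := by rw [← Set.inter_iUnion, hBu, Set.inter_univ]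

lemma riemannianVolume_restrict [CompactSpace M] (c : M) :
    (riemannianVolume d M).restrict (extChartAt (𝓡 d) c).source = chartVolume d M c := by
  have hm := (isOpen_extChartAt_source (I := 𝓡 d) c).measurableSet
  ext s hs
  rw [Measure.restrict_apply hs, riemannianVolume_apply c (hs.inter hm) Set.inter_subset_right]
  refine le_antisymm (measure_mono Set.inter_subset_left) ?_
  refine ((measure_mono fun x hx => ?_).trans (measure_union_le _ _)).trans_eq
    ((congrArg _ (chartVolume_compl_source c)).trans (add_zero _))
  by_cases hx' : x ∈ (extChartAt (𝓡 d) c).source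
  · exact Or.inl ⟨hx, hx'⟩
  · exact Or.inr hx'

end TGFoliation

namespace TGFoliation
open Topology

/-! ### Derivations of determinants -/

lemma derivation_prod {R ι : Type*} [CommRing R] [DecidableEq ι] (D : R →+ R)
    (hD : ∀ f g, D (f * g) = f * D g + g * D f) (s : Finset ι) (f : ι → R) :
    D (∏ i ∈ s, f i) = ∑ i ∈ s, D (f i) * ∏ j ∈ s.erase i, f j := by
  have h1 : D 1 = 0 := by simpa using hD 1 1
  induction s using Finset.induction_on with
  | empty => simp [h1]
  | insert a s ha ih =>
    rw [Finset.prod_insert ha, hD, ih, Finset.sum_insert ha, Finset.erase_insert ha, Finset.mul_sum,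
      add_comm, mul_comm]
    congr 1
    refine Finset.sum_congr rfl fun i hi => ?_
    have hai : a ≠ i := fun h => ha (h ▸ hi)
    rw [Finset.erase_insert_of_ne hai, Finset.prod_insert fun h => ha (Finset.mem_of_mem_erase h)]
    ring

/-- Jacobi's formula for the derivative of a determinant. -/
lemma derivation_det {R ι : Type*} [CommRing R] [Fintype ι] [DecidableEq ι] (D : R →+ R)
    (hD : ∀ f g, D (f * g) = f * D g + g * D f) (A : Matrix ι ι R) :
    D A.det = ∑ i, ∑ j, A.adjugate i j * D (A j i) := by
  -- By Cramer's rule the inner sum is the determinant with column `i` replaced by its derivative,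
  -- which is what the Leibniz rule produces.
  have h1 : ∀ i, ∑ j, A.adjugate i j * D (A j i) = (A.updateCol i fun j => D (A j i)).det :=
    fun i => by
    rw [← Matrix.cramer_apply, Matrix.cramer_eq_adjugate_mulVec]; rfl
  simp only [h1, Matrix.det_apply]
  rw [map_sum, Finset.sum_comm]
  refine Finset.sum_congr rfl fun σ _ => ?_
  have h2 : ∀ a : R, D (Equiv.Perm.sign σ • a) = Equiv.Perm.sign σ • D a := fun a => by
    rw [Units.smul_def, Units.smul_def, map_zsmul]
  rw [h2, derivation_prod D hD, Finset.smul_sum]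
  refine Finset.sum_congr rfl fun i _ => ?_
  rw [← Finset.mul_prod_erase _ _ (Finset.mem_univ i), Matrix.updateCol_self]
  congr 2
  exact Finset.prod_congr rfl fun j hj => by
    rw [Matrix.updateCol_ne (Finset.ne_of_mem_erase hj)]

/-! ### Traces in arbitrary bases -/

/-- Coordinates in the basis `b` are obtained by applying the inverse Gram matrix to the inner
products with `b`. This gives traces in coordinate frames, which are not orthonormal. -/
lemma trace_gram {E ι κ : Type*} [NormedAddCommGroup E] [InnerProductSpace ℝ E] [Fintype ι]
    [DecidableEq ι] [Fintype κ] (B : E →ₗ[ℝ] E →ₗ[ℝ] ℝ) {u : κ → E} (hu : Orthonormal ℝ u)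
    (hu' : Submodule.span ℝ (Set.range u) = ⊤) {b : ι → E} (hb : LinearIndependent ℝ b)
    (hb' : Submodule.span ℝ (Set.range b) = ⊤) :
    ∑ k, B (u k) (u k) = ∑ i, ∑ j, (Matrix.gram ℝ b)⁻¹ i j * B (b i) (b j) := by
  set G := Matrix.gram ℝ b
  have hG : IsUnit G.det := (Matrix.posDef_gram_of_linearIndependent hb).det_pos.ne'.isUnit
  have : FiniteDimensional ℝ E := Module.Finite.of_basis (Module.Basis.mk hb hb'.ge)
  have he : ∀ v, v = ∑ i, (∑ j, G⁻¹ i j * inner ℝ (b j) v) • b i := fun v => by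
    obtain ⟨x, hx⟩ := (Submodule.mem_span_range_iff_exists_fun ℝ).1
      (hb'.ge (Submodule.mem_top : v ∈ ⊤))
    have h1 : ∀ j, (inner ℝ (b j) v : ℝ) = (G.mulVec x) j := fun j => by
      rw [← hx, inner_sum]
      exact Finset.sum_congr rfl fun k _ => by rw [real_inner_smul_right, mul_comm]; rfl
    have h2 : ∀ i, ∑ j, G⁻¹ i j * inner ℝ (b j) v = x i := fun i => by
      simp only [h1]
      have : (G⁻¹.mulVec (G.mulVec x)) i = x i := by
        rw [Matrix.mulVec_mulVec, Matrix.nonsing_inv_mul _ hG, Matrix.one_mulVec]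
      exact this
    simp only [h2, hx]
  have hs : ∀ v, v = ∑ k, (inner ℝ (u k) v : ℝ) • u k := fun v => by
    have := starProjection_eq_sum hu hu' v
    rwa [Submodule.starProjection_eq_self_iff.2 Submodule.mem_top] at this
  calc ∑ k, B (u k) (u k)
      = ∑ k, ∑ i, (∑ j, G⁻¹ i j * inner ℝ (b j) (u k)) * B (b i) (u k) := by
        refine Finset.sum_congr rfl fun k _ => ?_
        conv_lhs => enter [1]; rw [he (u k)]
        simp
    _ = ∑ i, ∑ j, G⁻¹ i j * ∑ k, inner ℝ (u k) (b j) * B (b i) (u k) := by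
        rw [Finset.sum_comm]
        refine Finset.sum_congr rfl fun i _ => ?_
        simp only [Finset.sum_mul, Finset.mul_sum]
        rw [Finset.sum_comm]
        exact Finset.sum_congr rfl fun j _ => Finset.sum_congr rfl fun k _ => by
          rw [real_inner_comm (u k)]; ring
    _ = ∑ i, ∑ j, G⁻¹ i j * B (b i) (b j) := by
        refine Finset.sum_congr rfl fun i _ => Finset.sum_congr rfl fun j _ => ?_
        conv_rhs => rw [hs (b j)]
        simp

variable {d : ℕ} {M : Type*} [TopologicalSpace M]
  [ChartedSpace (EuclideanSpace ℝ (Fin d)) M] [IsManifold (𝓡 d) ∞ M]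

/-! ### Coordinate fields commute -/

/-- A constant vector field on the model space. -/
def constField (v : EuclideanSpace ℝ (Fin d)) (y : EuclideanSpace ℝ (Fin d)) :
    TangentSpace 𝓘(ℝ, EuclideanSpace ℝ (Fin d)) y := v

lemma bracket_constField (v w y : EuclideanSpace ℝ (Fin d)) : VectorField.mlieBracket
    𝓘(ℝ, EuclideanSpace ℝ (Fin d)) (constField v) (constField w) y = 0 := by
  rw [← VectorField.mlieBracketWithin_univ, VectorField.mlieBracketWithin_eq_lieBracketWithin]
  have h : ∀ v w : EuclideanSpace ℝ (Fin d), fderivWithin ℝ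
    (fun _ : EuclideanSpace ℝ (Fin d) => v) Set.univ y w = 0 := fun v w => by simp
  show fderivWithin ℝ (fun _ : EuclideanSpace ℝ (Fin d) => w) Set.univ y v
    - fderivWithin ℝ (fun _ : EuclideanSpace ℝ (Fin d) => v) Set.univ y w = 0
  rw [h, h, sub_zero]

lemma mdifferentiableAt_constField (v y : EuclideanSpace ℝ (Fin d)) :
    MDifferentiableAt 𝓘(ℝ, EuclideanSpace ℝ (Fin d)) 𝓘(ℝ, EuclideanSpace ℝ (Fin d)).tangent
      (fun y : EuclideanSpace ℝ (Fin d) => (⟨y, constField v y⟩ :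
        TangentBundle 𝓘(ℝ, EuclideanSpace ℝ (Fin d)) (EuclideanSpace ℝ (Fin d)))) y := by
  rw [mdifferentiableAt_section]
  have : MDifferentiableAt 𝓘(ℝ, EuclideanSpace ℝ (Fin d)) 𝓘(ℝ, EuclideanSpace ℝ (Fin d))
    (fun _ : EuclideanSpace ℝ (Fin d) => v) y := mdifferentiableAt_const
  simpa [constField] using this

lemma coordField_eq_mpullback {c p : M} (hp : p ∈ (extChartAt (𝓡 d) c).source) (i : Fin d) :
    coordField c i p = VectorField.mpullback (𝓡 d) 𝓘(ℝ, EuclideanSpace ℝ (Fin d))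
      (extChartAt (𝓡 d) c) (constField (EuclideanSpace.single i (1 : ℝ))) p := by
  set t := trivializationAt (EuclideanSpace ℝ (Fin d)) (TangentSpace (𝓡 d) : M → Type _) c
  have hpt := mem_baseSet_iff.2 hp
  have hp' := hp
  rw [extChartAt_source] at hp'
  have h := TangentBundle.continuousLinearMapAt_trivializationAt (I := 𝓡 d) hp'
  rw [← t.coe_continuousLinearEquivAt_eq' hpt] at h
  rw [VectorField.mpullback_apply, ← h]
  have h3 := ContinuousLinearMap.inverse_equiv (t.continuousLinearEquivAt ℝ p hpt)
  have h4 := t.symm_continuousLinearEquivAt_eq' (R := ℝ) hpt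
  exact (congrArg (fun L : EuclideanSpace ℝ (Fin d) →L[ℝ] EuclideanSpace ℝ (Fin d) =>
    L (EuclideanSpace.single i (1 : ℝ))) (h3.trans h4)).symm

/-- Coordinate fields are pullbacks of constant fields under the chart, and pullback respects
brackets. -/
lemma bracket_coordField {c p : M} (hp : p ∈ (extChartAt (𝓡 d) c).source) (i j : Fin d) :
    bracket (coordField c i) (coordField c j) p = 0 := by
  have hn : ∀ i : Fin d, ∀ᶠ q in 𝓝 p, coordField c i q
      = VectorField.mpullback (𝓡 d) 𝓘(ℝ, EuclideanSpace ℝ (Fin d))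
        (extChartAt (𝓡 d) c) (constField (EuclideanSpace.single i (1 : ℝ))) q := fun i => by
    filter_upwards [(isOpen_extChartAt_source (I := 𝓡 d) c).mem_nhds hp] with q hq
    exact coordField_eq_mpullback hq i
  rw [bracket, Filter.EventuallyEq.mlieBracket_vectorField_eq (hn i) (hn j)]
  rw [← VectorField.mpullback_mlieBracket (n := ((⊤ : ℕ∞) : WithTop ℕ∞))
    (mdifferentiableAt_constField _ _) (mdifferentiableAt_constField _ _)
    (contMDiffAt_extChartAt' (by rwa [extChartAt_source] at hp)) (by
        rw [minSmoothness_of_isRCLikeNormedField]; exact ENat.LEInfty.out)]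
  rw [VectorField.mpullback_apply, bracket_constField, map_zero]

end TGFoliation

/-- The bilinear form `(X, W) ↦ ⟨∇^g_X Y, W⟩`. -/
def FoliatedLieRinehart.lcForm {R L : Type*} [CommRing R] [AddCommGroup L] [Module R L]
    (F : FoliatedLieRinehart R L) (Y : L) : L →ₗ[R] L →ₗ[R] R :=
  LinearMap.mk₂ R (fun X W => F.ip (F.lc X Y) W)
    (fun X X' W => by simp [F.lc_add_left]) (fun f X W => by simp [F.lc_smul_left])
    (fun X W W' => by simp) (fun f X W => by simp)

lemma FoliatedLieRinehart.lcForm_apply {R L : Type*} [CommRing R] [AddCommGroup L] [Module R L]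
    (F : FoliatedLieRinehart R L) (Y X W : L) : F.lcForm Y X W = F.ip (F.lc X Y) W := rfl

namespace TGFoliation
open Topology

variable {d : ℕ} {M : Type*} [TopologicalSpace M]
  [ChartedSpace (EuclideanSpace ℝ (Fin d)) M] [IsManifold (𝓡 d) ∞ M]
  [Bundle.RiemannianBundle (fun x : M => TangentSpace (𝓡 d) x)]
  [IsContMDiffRiemannianBundle (𝓡 d) ∞ (EuclideanSpace ℝ (Fin d))
      (fun x : M => TangentSpace (𝓡 d) x)]

variable {V : Distribution d M} [T2Space M] {m : ℕ}

/-! ### Traces of bilinear forms -/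

/-- The trace of a bilinear form over a smooth distribution. -/
def traceV (hV : IsSmoothDistribution m V) (B : Vec d M →ₗ[Fn d M] Vec d M →ₗ[Fn d M] Fn d M) :
    Fn d M :=
  ⟨fun x => frameSum (V x) fun e => evB x B e e, fun x => by
    obtain ⟨E, Z, hE, hZ, h⟩ := exists_adapted_frame hV x
    refine ContMDiffAt.congr_of_eventuallyEq ((∑ l, B (Z l) (Z l) : Fn d M).contMDiff x) ?_
    filter_upwards [h] with y hy
    rw [fn_sum_apply]
    exact frameSum_evB B hy.2.1 hy.2.2⟩

/-- The trace of a bilinear form over the orthogonal complement of a smooth distribution. -/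
def traceH (hV : IsSmoothDistribution m V) (B : Vec d M →ₗ[Fn d M] Vec d M →ₗ[Fn d M] Fn d M) :
    Fn d M :=
  ⟨fun x => frameSum (V x)ᗮ fun e => evB x B e e, fun x => by
    obtain ⟨E, Z, hE, hZ, h⟩ := exists_adapted_frame hV x
    refine ContMDiffAt.congr_of_eventuallyEq ((∑ l, B (E l) (E l) : Fn d M).contMDiff x) ?_
    filter_upwards [h] with y hy
    rw [fn_sum_apply]
    exact frameSum_evB B hy.1.1 hy.1.2⟩

lemma traceV_apply (hV : IsSmoothDistribution m V)
    (B : Vec d M →ₗ[Fn d M] Vec d M →ₗ[Fn d M] Fn d M) (x : M) :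
    traceV hV B x = frameSum (V x) fun e => evB x B e e := rfl

lemma traceH_apply (hV : IsSmoothDistribution m V)
    (B : Vec d M →ₗ[Fn d M] Vec d M →ₗ[Fn d M] Fn d M) (x : M) :
    traceH hV B x = frameSum (V x)ᗮ fun e => evB x B e e := rfl

lemma traceV_add (hV : IsSmoothDistribution m V)
    (B B' : Vec d M →ₗ[Fn d M] Vec d M →ₗ[Fn d M] Fn d M) :
    traceV hV (B + B') = traceV hV B + traceV hV B' := by
  ext x
  have h : ∀ e, evB x (B + B') e e = evB x B e e + evB x B' e e := fun e => rfl
  simp only [traceV_apply, fn_add_apply, h, frameSum, Finset.sum_add_distrib]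

lemma traceH_add (hV : IsSmoothDistribution m V)
    (B B' : Vec d M →ₗ[Fn d M] Vec d M →ₗ[Fn d M] Fn d M) :
    traceH hV (B + B') = traceH hV B + traceH hV B' := by
  ext x
  have h : ∀ e, evB x (B + B') e e = evB x B e e + evB x B' e e := fun e => rfl
  simp only [traceH_apply, fn_add_apply, h, frameSum, Finset.sum_add_distrib]

lemma traceH_smul (hV : IsSmoothDistribution m V) (f : Fn d M)
    (B : Vec d M →ₗ[Fn d M] Vec d M →ₗ[Fn d M] Fn d M) :
    traceH hV (f • B) = f * traceH hV B := by
  ext x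
  have h : ∀ e, evB x (f • B) e e = f x * evB x B e e := fun e => rfl
  simp only [traceH_apply, fn_mul_apply, h, frameSum, Finset.mul_sum]

/-! ### The divergence of vector fields and its coordinate formula. -/

variable (hV : IsTotallyGeodesicRiemannianFoliation m V)

/-- The divergence of a vector field. -/
def divFn (Y : Vec d M) : Fn d M :=
  traceV isSmoothDistribution_top ((lieRinehart hV).lcForm Y)

lemma divFn_apply (Y : Vec d M) (x : M) : divFn hV Y x =
    frameSum (⊤ : Submodule ℝ (TangentSpace (𝓡 d) x)) fun e =>
      evB x ((lieRinehart hV).lcForm Y) e e := rfl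

lemma divFn_add (Y Y' : Vec d M) : divFn hV (Y + Y') = divFn hV Y + divFn hV Y' := by
  rw [divFn, divFn, divFn, ← traceV_add]
  congr 1
  ext X W : 2
  simp [FoliatedLieRinehart.lcForm_apply, FoliatedLieRinehart.lc_add_right]

lemma divFn_sum {ι : Type*} (s : Finset ι) (Y : ι → Vec d M) :
    divFn hV (∑ i ∈ s, Y i) = ∑ i ∈ s, divFn hV (Y i) :=
  map_sum (AddMonoidHom.mk' (divFn hV) (divFn_add hV)) Y s

lemma divFn_smul (f : Fn d M) (Y : Vec d M) :
    divFn hV (f • Y) = derV Y f + f * divFn hV Y := by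
  ext x
  obtain ⟨u, hu, hu', hu2⟩ := exists_orthonormal_span (⊤ : Submodule ℝ (TangentSpace (𝓡 d) x))
  rw [fn_add_apply, fn_mul_apply, divFn_apply, divFn_apply, hu2, hu2, Finset.mul_sum]
  have h : ∀ i, evB x ((lieRinehart hV).lcForm (f • Y)) (u i) (u i)
      = dirDeriv f x (u i) * inner ℝ (u i) (Y x)
        + f x * evB x ((lieRinehart hV).lcForm Y) (u i) (u i) := fun i => by
    rw [evB_def, evB_def, FoliatedLieRinehart.lcForm_apply, FoliatedLieRinehart.lcForm_apply,
      FoliatedLieRinehart.lc_smul_right, map_add, LinearMap.add_apply, map_smul, map_smul,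
      LinearMap.smul_apply, LinearMap.smul_apply, fn_add_apply, smul_eq_mul, smul_eq_mul,
      fn_mul_apply, fn_mul_apply]
    congr 2
    · show dirDeriv f x (gext x (u i) x) = _
      rw [gext_self]
    · rw [(lieRinehart hV).ip_comm, lieRinehart_ip_apply, gext_self]
  simp only [h, Finset.sum_add_distrib]
  congr 1
  have h2 := starProjection_eq_sum hu hu' (Y x)
  rw [Submodule.starProjection_eq_self_iff.2 Submodule.mem_top] at h2
  rw [derV_apply]
  conv_rhs => rw [h2]
  simp only [dirDeriv, map_sum, map_smul, smul_eq_mul]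
  exact Finset.sum_congr rfl fun i _ => mul_comm _ _

lemma divFn_congr {Y Y' : Vec d M} {x : M} (h : ∀ᶠ y in 𝓝 x, Y y = Y' y) :
    divFn hV Y x = divFn hV Y' x := by
  rw [divFn_apply, divFn_apply]
  refine Finset.sum_congr rfl fun i _ => ?_
  show inner ℝ (lcV _ Y x) _ = inner ℝ (lcV _ Y' x) _
  rw [coe_lcV, coe_lcV, isLocalOp_leviCivita x _ _ _ _ (Filter.Eventually.of_forall fun _ => rfl) h]

lemma exists_global_fn {U : Set M} (hU : IsOpen U) {f : M → ℝ}
    (hf : ContMDiffOn (𝓡 d) 𝓘(ℝ, ℝ) ∞ f U) {x : M} (hx : x ∈ U) :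
    ∃ g : Fn d M, ∀ᶠ y in 𝓝 x, g y = f y := by
  obtain ⟨ψ, h1, h2⟩ := exists_bump (d := d) (hU.mem_nhds hx)
  refine ⟨⟨fun y => ψ y * f y, contMDiff_of_tsupport fun y hy => ψ.contMDiff.contMDiffAt.mul
    (hf.contMDiffAt (hU.mem_nhds (h2 (tsupport_mul_subset_left hy))))⟩, ?_⟩
  filter_upwards [h1] with y hy
  show ψ y * f y = f y
  rw [hy, one_mul]

lemma linearIndependent_coordField {c p : M} (hp : p ∈ (extChartAt (𝓡 d) c).source) :
    LinearIndependent ℝ fun i : Fin d => coordField c i p :=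
  Matrix.linearIndependent_of_det_gram_ne_zero (det_gramAt_pos hp).ne'

lemma span_coordField {c p : M} (hp : p ∈ (extChartAt (𝓡 d) c).source) :
    Submodule.span ℝ (Set.range fun i : Fin d => coordField c i p) = ⊤ := by
  refine (linearIndependent_coordField hp).span_eq_top_of_card_eq_finrank' ?_
  rw [Fintype.card_fin]
  exact (finrank_euclideanSpace_fin (𝕜 := ℝ) (n := d)).symm

/-- The divergence in coordinates. -/
lemma density_mul_divFn {c p : M} (hp : p ∈ (extChartAt (𝓡 d) c).source) (k : Fin d) (f : Fn d M)
    {D : Fin d → Vec d M} (hD : ∀ᶠ q in 𝓝 p, ∀ i, D i q = coordField c i q) :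
    density (d := d) c p * divFn hV (f • D k) p
      = dirDeriv (fun q => density (d := d) c q * f q) p (coordField c k p) := by
  set F := lieRinehart hV with hF
  let g : Matrix (Fin d) (Fin d) (Fn d M) := Matrix.of fun i j => F.ip (D i) (D j)
  have hg : ∀ᶠ q in 𝓝 p, ∀ i j, g i j q = gramAt c q i j := by
    filter_upwards [hD] with q hq i j
    show inner ℝ (D i q) (D j q) = _
    rw [hq, hq]; rfl
  have hmap : ∀ᶠ q in 𝓝 p, (evF q).mapMatrix g = gramAt c q := by
    filter_upwards [hg] with q hq
    ext i j; exact hq i j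
  -- `H` is a global function equal to the density near `p`. Working with `H² = det g` avoids
  -- differentiating the square root and permits Jacobi's formula in the ring of functions.
  obtain ⟨H, hH⟩ := exists_global_fn (isOpen_extChartAt_source (I := 𝓡 d) c)
    (contMDiffOn_density c) hp
  have hHdet : ∀ᶠ q in 𝓝 p, (H * H) q = g.det q := by
    filter_upwards [hmap, hH, (isOpen_extChartAt_source (I := 𝓡 d) c).mem_nhds hp] with q h1 h2 h3
    rw [fn_mul_apply, h2, density, Real.mul_self_sqrt (det_gramAt_pos h3).le, ← h1,
      ← RingHom.map_det]
    rfl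
  have hDk : D k p = coordField c k p := hD.self_of_nhds k
  have hHp := hH.self_of_nhds
  have hpos : 0 < H p := by rw [hHp]; exact density_pos hp
  set G := gramAt (d := d) c p with hG
  -- the derivative of the density
  have e1 : 2 * H p * derV (D k) H p = H p ^ 2 * ∑ i, ∑ j, G⁻¹ i j * derV (D k) (g j i) p := by
    have h1 : derV (D k) (H * H) p = derV (D k) g.det p := by
      rw [derV_apply, derV_apply]; exact dirDeriv_congr hHdet _
    rw [derV_mul, derivation_det (derV (D k)) (derV_mul (D k)), fn_add_apply, fn_mul_apply,
      fn_sum_apply] at h1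
    have h2 : ∀ i j, g.adjugate i j p = G.det * G⁻¹ i j := fun i j => by
      have h3 : g.adjugate i j p = ((evF p).mapMatrix g.adjugate) i j := rfl
      rw [h3, RingHom.map_adjugate, hmap.self_of_nhds, Matrix.inv_def, Matrix.smul_apply,
        smul_eq_mul, ← mul_assoc, Ring.mul_inverse_cancel _ (det_gramAt_pos hp).ne'.isUnit, one_mul]
    have h4 : H p ^ 2 = G.det := by
      rw [hHp, density, Real.sq_sqrt (det_gramAt_pos hp).le]
    rw [h4, Finset.mul_sum]
    refine (by ring : _ = _).trans (h1.trans (Finset.sum_congr rfl fun i _ => ?_))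
    rw [fn_sum_apply, Finset.mul_sum]
    exact Finset.sum_congr rfl fun j _ => by rw [fn_mul_apply, h2]; ring
  -- the divergence of the coordinate field
  have hGs : ∀ i j, G⁻¹ i j = G⁻¹ j i := fun i j => by
    have : G.IsHermitian := Matrix.isHermitian_gram _ _
    have := this.inv.apply i j
    simpa using this.symm
  have e2 : divFn hV (D k) p = ∑ i, ∑ j, G⁻¹ i j * F.ip (F.lc (D i) (D k)) (D j) p := by
    obtain ⟨u, hu, hu', hu2⟩ := exists_orthonormal_span (⊤ : Submodule ℝ (TangentSpace (𝓡 d) p))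
    rw [divFn_apply, hu2, trace_gram _ hu hu' (linearIndependent_coordField hp) (span_coordField hp)]
    refine Finset.sum_congr rfl fun i _ => Finset.sum_congr rfl fun j _ => ?_
    rw [← hD.self_of_nhds i, ← hD.self_of_nhds j, evB_apply]
    rfl
  -- Coordinate fields commute and the Levi-Civita connection has no torsion, so `D i` and `D k` may
  -- be exchanged; the metric property then gives the derivative of the Gram matrix. Symmetrising
  -- the trace yields twice the divergence.
  have e3 : ∀ i j, F.ip (F.lc (D i) (D k)) (D j) p + F.ip (F.lc (D j) (D k)) (D i) p
      = derV (D k) (g i j) p := fun i j => by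
    have hb : ∀ i, F.br (D i) (D k) p = 0 := fun i => by
      show bracket (D i) (D k) p = 0
      rw [isLocalOp_bracket p _ _ _ _ (hD.mono fun q hq => hq i) (hD.mono fun q hq => hq k)]
      exact bracket_coordField hp i k
    have h1 : ∀ i j, F.ip (F.lc (D i) (D k)) (D j) p = F.ip (F.lc (D k) (D i)) (D j) p :=
      fun i j => by
      have h2 := congrArg (fun Z : Vec d M => Z p) (F.lc_torsion (D i) (D k))
      simp only [hb, vec_sub_apply, sub_eq_zero] at h2
      rw [hF, lieRinehart_ip_apply, lieRinehart_ip_apply, ← hF, h2]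
    rw [h1, h1, F.ip_comm (F.lc (D k) (D j))]
    exact congrArg (fun f : Fn d M => f p) (F.ip_lc_comm (D k) (D i) (D j))
  have e4 : 2 * divFn hV (D k) p = ∑ i, ∑ j, G⁻¹ i j * derV (D k) (g j i) p := by
    rw [two_mul]
    nth_rewrite 2 [e2]
    rw [e2.trans Finset.sum_comm, ← Finset.sum_add_distrib]
    refine Finset.sum_congr rfl fun i _ => ?_
    rw [← Finset.sum_add_distrib]
    refine Finset.sum_congr rfl fun j _ => ?_
    rw [← e3 j i, hGs j i]; ring
  have e5 : derV (D k) H p = H p * divFn hV (D k) p := by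
    rw [← e4] at e1
    have : H p ≠ 0 := hpos.ne'
    apply mul_left_cancel₀ (mul_ne_zero two_ne_zero this)
    rw [e1]; ring
  have e6 : dirDeriv (fun q => density (d := d) c q * f q) p (coordField c k p)
      = derV (D k) (H * f) p := by
    rw [derV_apply, hDk]
    refine dirDeriv_congr ?_ _
    filter_upwards [hH] with q hq
    rw [fn_mul_apply, hq]
  rw [e6, divFn_smul, derV_mul, fn_add_apply, fn_add_apply, fn_mul_apply, fn_mul_apply,
    fn_mul_apply, e5, hHp]
  ring

end TGFoliation

namespace TGFoliation
open Topology

variable {d : ℕ} {M : Type*} [TopologicalSpace M]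
  [ChartedSpace (EuclideanSpace ℝ (Fin d)) M] [IsManifold (𝓡 d) ∞ M]
  [Bundle.RiemannianBundle (fun x : M => TangentSpace (𝓡 d) x)]
  [IsContMDiffRiemannianBundle (𝓡 d) ∞ (EuclideanSpace ℝ (Fin d))
      (fun x : M => TangentSpace (𝓡 d) x)]

/-! ### The divergence theorem -/

lemma integral_fderiv_eq_zero {u : EuclideanSpace ℝ (Fin d) → ℝ} (hu : ContDiff ℝ 1 u)
    (hc : HasCompactSupport u) (v : EuclideanSpace ℝ (Fin d)) : ∫ y, fderiv ℝ u y v = 0 := by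
  have h1 : Integrable fun y => fderiv ℝ u y v :=
    ((hu.continuous_fderiv one_ne_zero).clm_apply continuous_const).integrable_of_hasCompactSupport
      (hc.fderiv_apply ℝ v)
  have h2 : Integrable u := hu.continuous.integrable_of_hasCompactSupport hc
  -- Integration by parts against the constant function one.
  have := integral_mul_fderiv_eq_neg_fderiv_mul_of_integrable (μ := volume) (f := fun _ => (1 : ℝ))
    (g := u) (v := v) (by simp) (by simpa using h1) (by simpa using h2)
    (fun x _ => differentiableAt_const _) (fun x _ => hu.differentiable one_ne_zero x)
  simpa using this

/-- A function supported in a chart domain, in coordinates. -/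
def inChart (c : M) (f : M → ℝ) : EuclideanSpace ℝ (Fin d) → ℝ :=
  (extChartAt (𝓡 d) c).target.indicator fun y => f ((extChartAt (𝓡 d) c).symm y)

lemma inChart_eventuallyEq (c : M) (f : M → ℝ) {y : EuclideanSpace ℝ (Fin d)}
    (hy : y ∈ (extChartAt (𝓡 d) c).target) :
    inChart c f =ᶠ[𝓝 y] f ∘ (extChartAt (𝓡 d) c).symm := by
  filter_upwards [(isOpen_extChartAt_target (I := 𝓡 d) c).mem_nhds hy] with z hz
  rw [inChart, Set.indicator_of_mem hz]
  rfl

lemma inChart_eq_zero {c : M} {f : M → ℝ} {y : EuclideanSpace ℝ (Fin d)}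
    (hy : y ∉ extChartAt (𝓡 d) c '' tsupport f) : inChart c f y = 0 := by
  rw [inChart, Set.indicator_apply_eq_zero]
  intro hyt
  by_contra h
  exact hy ⟨_, subset_tsupport _ h, (extChartAt (𝓡 d) c).right_inv hyt⟩

lemma isCompact_image_tsupport [CompactSpace M] {c : M} {f : M → ℝ}
    (hf : tsupport f ⊆ (extChartAt (𝓡 d) c).source) :
    IsCompact (extChartAt (𝓡 d) c '' tsupport f) :=
  (isClosed_tsupport f).isCompact.image_of_continuousOn ((continuousOn_extChartAt c).mono hf)

lemma hasCompactSupport_inChart [CompactSpace M] {c : M} {f : M → ℝ}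
    (hf : tsupport f ⊆ (extChartAt (𝓡 d) c).source) : HasCompactSupport (inChart (d := d) c f) :=
  HasCompactSupport.of_support_subset_isCompact (isCompact_image_tsupport hf) fun y hy => by
    by_contra h
    exact hy (inChart_eq_zero h)

/-- On the image of the support the function is locally a composite of smooth maps. That image is
compact, hence closed, and the function is zero on its open complement. -/
lemma contDiff_inChart [CompactSpace M] {c : M} {f : M → ℝ}
    (hf : tsupport f ⊆ (extChartAt (𝓡 d) c).source)
    (hs : ContMDiffOn (𝓡 d) 𝓘(ℝ, ℝ) ∞ f (extChartAt (𝓡 d) c).source) :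
    ContDiff ℝ 1 (inChart (d := d) c f) := by
  rw [contDiff_iff_contDiffAt]
  intro y
  by_cases hy : y ∈ extChartAt (𝓡 d) c '' tsupport f
  · obtain ⟨p, hp, rfl⟩ := hy
    have hyt := (extChartAt (𝓡 d) c).map_source (hf hp)
    refine ContDiffAt.congr_of_eventuallyEq ?_ (inChart_eventuallyEq c f hyt)
    rw [← contMDiffAt_iff_contDiffAt]
    have h1 : ContMDiffOn 𝓘(ℝ, EuclideanSpace ℝ (Fin d)) (𝓡 d) ∞ (extChartAt (𝓡 d) c).symm
      (extChartAt (𝓡 d) c).target := contMDiffOn_extChartAt_symm c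
    have h2 := hs.comp h1 fun z hz => (extChartAt (𝓡 d) c).map_target hz
    exact (h2.contMDiffAt ((isOpen_extChartAt_target (I := 𝓡 d) c).mem_nhds hyt)).of_le (by simp)
  · refine ContDiffAt.congr_of_eventuallyEq (contDiffAt_const (c := (0 : ℝ))) ?_
    filter_upwards [(isCompact_image_tsupport hf).isClosed.isOpen_compl.mem_nhds hy] with z hz
    exact inChart_eq_zero hz

lemma fderiv_inChart {c : M} {f : M → ℝ}
    (hs : ContMDiffOn (𝓡 d) 𝓘(ℝ, ℝ) ∞ f (extChartAt (𝓡 d) c).source)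
    {y : EuclideanSpace ℝ (Fin d)} (hy : y ∈ (extChartAt (𝓡 d) c).target) (k : Fin d) :
    fderiv ℝ (inChart (d := d) c f) y (EuclideanSpace.single k (1 : ℝ))
      = dirDeriv f ((extChartAt (𝓡 d) c).symm y)
          (coordField c k ((extChartAt (𝓡 d) c).symm y)) := by
  have hp := (extChartAt (𝓡 d) c).map_target hy
  rw [(inChart_eventuallyEq c f hy).fderiv_eq, coordField_symm hy]
  have h1 : MDifferentiableAt 𝓘(ℝ, EuclideanSpace ℝ (Fin d)) (𝓡 d) (extChartAt (𝓡 d) c).symm y :=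
    ((contMDiffOn_extChartAt_symm (n := ∞) c).contMDiffAt
      ((isOpen_extChartAt_target (I := 𝓡 d) c).mem_nhds hy)).mdifferentiableAt (by simp)
  have h2 : MDifferentiableAt (𝓡 d) 𝓘(ℝ, ℝ) f ((extChartAt (𝓡 d) c).symm y) :=
    (hs.contMDiffAt ((isOpen_extChartAt_source (I := 𝓡 d) c).mem_nhds hp)).mdifferentiableAt
      (by simp)
  have h3 := mfderiv_comp y h2 h1
  rw [mfderiv_eq_fderiv] at h3
  exact congrArg (fun L : EuclideanSpace ℝ (Fin d) →L[ℝ] ℝ =>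
    L (EuclideanSpace.single k (1 : ℝ))) h3

variable [MeasurableSpace M] [BorelSpace M]

lemma aemeasurable_extChartAt_symm (c : M) : AEMeasurable (extChartAt (𝓡 d) c).symm
    ((volume : Measure (EuclideanSpace ℝ (Fin d))).restrict (extChartAt (𝓡 d) c).target) :=
  (continuousOn_extChartAt_symm c).aemeasurable (isOpen_extChartAt_target c).measurableSet

lemma aemeasurable_gram (c : M) : AEMeasurable
    (fun y => ENNReal.ofReal (Real.sqrt (gram d M c y).det))
    ((volume : Measure (EuclideanSpace ℝ (Fin d))).restrict (extChartAt (𝓡 d) c).target) := by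
  have h : ContinuousOn (fun y => density (d := d) c ((extChartAt (𝓡 d) c).symm y))
      (extChartAt (𝓡 d) c).target := (contMDiffOn_density c).continuousOn.comp
    (continuousOn_extChartAt_symm c) fun z hz => (extChartAt (𝓡 d) c).map_target hz
  have hm := (isOpen_extChartAt_target (I := 𝓡 d) c).measurableSet
  refine AEMeasurable.ennreal_ofReal ((h.aemeasurable hm).congr ?_)
  filter_upwards [ae_restrict_mem hm] with y hy
  rw [gram_eq hy]; rfl

lemma integral_riemannianVolume [CompactSpace M] {c : M} {w : M → ℝ} (hw : Continuous w)
    (h0 : ∀ p ∉ (extChartAt (𝓡 d) c).source, w p = 0) :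
    ∫ p, w p ∂(riemannianVolume d M) = ∫ y in (extChartAt (𝓡 d) c).target,
      density (d := d) c ((extChartAt (𝓡 d) c).symm y) * w ((extChartAt (𝓡 d) c).symm y) := by
  have hm := (isOpen_extChartAt_target (I := 𝓡 d) c).measurableSet
  rw [← setIntegral_eq_integral_of_forall_compl_eq_zero h0, riemannianVolume_restrict, chartVolume,
    integral_map ((aemeasurable_extChartAt_symm c).mono_ac (withDensity_absolutelyContinuous _ _))
      hw.aestronglyMeasurable,
    integral_withDensity_eq_integral_toReal_smul₀ (aemeasurable_gram c) (by simp)]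
  refine setIntegral_congr_fun hm fun y hy => ?_
  simp only [gram_eq hy, smul_eq_mul]
  rw [ENNReal.toReal_ofReal (Real.sqrt_nonneg _)]
  rfl

instance [CompactSpace M] : IsFiniteMeasure (riemannianVolume d M) := by
  have : IsLocallyFiniteMeasure (riemannianVolume d M) := ⟨fun p => by
    have hy := mem_extChartAt_target (I := 𝓡 d) p
    have hc : ContinuousAt (fun y => density (d := d) p ((extChartAt (𝓡 d) p).symm y))
        (extChartAt (𝓡 d) p p) := ((contMDiffOn_density p).continuousOn.comp
      (continuousOn_extChartAt_symm p) fun z hz => (extChartAt (𝓡 d) p).map_target hz).continuousAt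
        ((isOpen_extChartAt_target (I := 𝓡 d) p).mem_nhds hy)
    -- The density is continuous, hence at most `C` on a small ball, so the measure is locally
    -- finite; compactness then makes it finite.
    set C := density (d := d) p ((extChartAt (𝓡 d) p).symm (extChartAt (𝓡 d) p p)) + 1 with hC
    have hlt := hc.eventually_lt_const (show _ < C by rw [hC]; linarith)
    obtain ⟨r, hr, hball⟩ := Metric.eventually_nhds_iff_ball.1 hlt
    have ho : IsOpen ((extChartAt (𝓡 d) p).source ∩ extChartAt (𝓡 d) p ⁻¹'
        Metric.ball (extChartAt (𝓡 d) p p) r) :=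
      (continuousOn_extChartAt p).isOpen_inter_preimage (isOpen_extChartAt_source p)
        Metric.isOpen_ball
    refine ⟨_, ho.mem_nhds ⟨mem_extChartAt_source p, Metric.mem_ball_self hr⟩, ?_⟩
    rw [riemannianVolume_apply p ho.measurableSet Set.inter_subset_left,
      chartVolume_apply p ho.measurableSet]
    calc _ ≤ ∫⁻ y in Metric.ball (extChartAt (𝓡 d) p p) r, ENNReal.ofReal C := by
          refine (setLIntegral_mono' (measurableSet_chart_preimage p ho.measurableSet)
            fun y hy => ENNReal.ofReal_le_ofReal ?_).trans (lintegral_mono_set fun y hy => ?_)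
          · refine (hball y ?_).le
            have := hy.1.2
            rwa [Set.mem_preimage, (extChartAt (𝓡 d) p).right_inv hy.2] at this
          · have := hy.1.2
            rwa [Set.mem_preimage, (extChartAt (𝓡 d) p).right_inv hy.2] at this
      _ < ⊤ := by
          rw [setLIntegral_const]
          exact ENNReal.mul_lt_top ENNReal.ofReal_lt_top measure_ball_lt_top⟩
  infer_instance

/-- The densities are positive. This is what turns a vanishing integral of a continuous nonnegative
function into pointwise vanishing, and gives both uniqueness assertions. -/
instance [CompactSpace M] : (riemannianVolume d M).IsOpenPosMeasure := ⟨fun U hU hne h => by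
  obtain ⟨p, hp⟩ := hne
  have ho := hU.inter (isOpen_extChartAt_source (I := 𝓡 d) p)
  have h0 : riemannianVolume d M (U ∩ (extChartAt (𝓡 d) p).source) = 0 :=
    measure_mono_null Set.inter_subset_left h
  rw [riemannianVolume_apply p ho.measurableSet Set.inter_subset_right,
    chartVolume_apply p ho.measurableSet] at h0
  set A := (extChartAt (𝓡 d) p).symm ⁻¹' (U ∩ (extChartAt (𝓡 d) p).source)
    ∩ (extChartAt (𝓡 d) p).target with hA
  have hAo : IsOpen A := by
    rw [hA, Set.inter_comm]
    exact (continuousOn_extChartAt_symm p).isOpen_inter_preimage (isOpen_extChartAt_target p) ho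
  have hpA : extChartAt (𝓡 d) p p ∈ A := by
    refine ⟨?_, mem_extChartAt_target p⟩
    rw [Set.mem_preimage, extChartAt_to_inv]
    exact ⟨hp, mem_extChartAt_source p⟩
  have hc : ContinuousOn (fun y => density (d := d) p ((extChartAt (𝓡 d) p).symm y)) A :=
    ((contMDiffOn_density p).continuousOn.comp
      (continuousOn_extChartAt_symm p) fun z hz => (extChartAt (𝓡 d) p).map_target hz).mono
        Set.inter_subset_right
  rw [lintegral_eq_zero_iff' (hc.aemeasurable hAo.measurableSet).ennreal_ofReal] at h0
  have h1 : ∀ᵐ y ∂((volume : Measure (EuclideanSpace ℝ (Fin d))).restrict A), False := by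
    filter_upwards [h0, ae_restrict_mem hAo.measurableSet] with y hy hyA
    have := density_pos (d := d) (c := p) ((extChartAt (𝓡 d) p).map_target hyA.2)
    exact (ENNReal.ofReal_pos.2 this).ne' hy
  have h2 : volume A = 0 := by
    rw [ae_iff] at h1
    simpa using h1
  exact (hAo.measure_pos volume ⟨_, hpA⟩).ne' h2⟩

variable {V : Distribution d M} [T2Space M] {m : ℕ} [CompactSpace M]
  (hV : IsTotallyGeodesicRiemannianFoliation m V)

lemma integrable_fn (f : Fn d M) : Integrable f (riemannianVolume d M) :=
  f.contMDiff.continuous.integrable_of_hasCompactSupport (HasCompactSupport.of_compactSpace _)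

lemma localFrame_eq_coordField {c p : M} (hp : p ∈ (extChartAt (𝓡 d) c).source) (i : Fin d) :
    (trivializationAt (EuclideanSpace ℝ (Fin d)) (TangentSpace (𝓡 d) : M → Type _) c).localFrame
      (EuclideanSpace.basisFun (Fin d) ℝ).toBasis i p = coordField c i p := by
  have hp' := mem_baseSet_iff.2 hp
  rw [Bundle.Trivialization.localFrame_apply_of_mem_baseSet _ _ hp', coordField,
    Bundle.Trivialization.symmₗ_apply _ hp']
  simp [Bundle.Trivialization.basisAt]

lemma exists_coordinates {c : M} {ρ : Fn d M} (hρ : tsupport ρ ⊆ (extChartAt (𝓡 d) c).source)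
    (Y : Vec d M) : ∃ f : Fin d → Fn d M, (∀ k, tsupport (f k) ⊆ (extChartAt (𝓡 d) c).source) ∧
      ∀ p ∈ (extChartAt (𝓡 d) c).source, ρ p • Y p = ∑ k, f k p • coordField c k p := by
  set t := trivializationAt (EuclideanSpace ℝ (Fin d)) (TangentSpace (𝓡 d) : M → Type _) c
  let b := (EuclideanSpace.basisFun (Fin d) ℝ).toBasis
  have hc : ∀ i, ContMDiffOn (𝓡 d) 𝓘(ℝ, ℝ) ∞
      (fun y => t.localFrameCoeff (𝓡 d) b i y (Y y)) t.baseSet := fun i =>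
    contMDiffOn_baseSet_localFrameCoeff (k := ∞) b Y.contMDiff.contMDiffOn i
  refine ⟨fun k => ⟨fun y => ρ y * t.localFrameCoeff (𝓡 d) b k y (Y y),
    contMDiff_of_tsupport fun y hy => ρ.contMDiff.contMDiffAt.mul ((hc k).contMDiffAt
      (t.open_baseSet.mem_nhds (mem_baseSet_iff.2 (hρ (tsupport_mul_subset_left hy)))))⟩,
    fun k => tsupport_mul_subset_left.trans hρ, fun p hp => ?_⟩
  have h1 := t.eq_sum_localFrameCoeff_smul (I := 𝓡 d) (b := b) (s := Y) (mem_baseSet_iff.2 hp)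
  conv_lhs => rw [h1]
  rw [Finset.smul_sum]
  refine Finset.sum_congr rfl fun k _ => ?_
  rw [localFrame_eq_coordField hp, smul_smul]
  rfl

/-- In the chart, density times divergence is a sum of partial derivatives of compactly supported
functions, each with zero integral. -/
lemma integral_divFn_smul {c : M} {ρ : Fn d M} (hρ : tsupport ρ ⊆ (extChartAt (𝓡 d) c).source)
    (Y : Vec d M) : ∫ p, divFn hV (ρ • Y) p ∂(riemannianVolume d M) = 0 := by
  have hopen := isOpen_extChartAt_source (I := 𝓡 d) c
  obtain ⟨f, hf, hsum⟩ := exists_coordinates hρ Y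
  have h0 : ∀ p ∉ (extChartAt (𝓡 d) c).source, divFn hV (ρ • Y) p = 0 := fun p hp => by
    have h1 : ∀ᶠ y in 𝓝 p, (ρ • Y) y = (0 : Vec d M) y := by
      filter_upwards [(isClosed_tsupport ρ).isOpen_compl.mem_nhds fun h => hp (hρ h)] with y hy
      rw [smul_vec_apply, image_eq_zero_of_notMem_tsupport hy, zero_smul]; rfl
    rw [divFn_congr hV h1]
    have h2 := divFn_add hV (0 : Vec d M) 0
    rw [add_zero, left_eq_add] at h2
    rw [h2]; rfl
  have hs : ∀ k, ContMDiffOn (𝓡 d) 𝓘(ℝ, ℝ) ∞ (fun q => density (d := d) c q * f k q)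
      (extChartAt (𝓡 d) c).source := fun k =>
    (contMDiffOn_density c).mul (f k).contMDiff.contMDiffOn
  have hts : ∀ k, tsupport (fun q => density (d := d) c q * f k q) ⊆ (extChartAt (𝓡 d) c).source :=
    fun k => tsupport_mul_subset_right.trans (hf k)
  rw [integral_riemannianVolume (divFn hV (ρ • Y)).contMDiff.continuous h0]
  have key : ∀ y ∈ (extChartAt (𝓡 d) c).target,
      density (d := d) c ((extChartAt (𝓡 d) c).symm y)
        * divFn hV (ρ • Y) ((extChartAt (𝓡 d) c).symm y)
      = ∑ k, fderiv ℝ (inChart (d := d) c fun q => density (d := d) c q * f k q) y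
          (EuclideanSpace.single k (1 : ℝ)) := fun y hy => by
    set p := (extChartAt (𝓡 d) c).symm y with hp'
    have hp := (extChartAt (𝓡 d) c).map_target hy
    choose D hD using fun k => exists_global hopen (smoothFieldOn_coordField c k) hp
    have hD' : ∀ᶠ q in 𝓝 p, ∀ k, D k q = coordField c k q := Filter.eventually_all.2 hD
    have h1 : ∀ᶠ q in 𝓝 p, (ρ • Y) q = (∑ k, f k • D k : Vec d M) q := by
      filter_upwards [hD', hopen.mem_nhds hp] with q hq hq'
      rw [smul_vec_apply, hsum q hq', vec_sum_apply]
      exact Finset.sum_congr rfl fun k _ => by rw [smul_vec_apply, hq]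
    rw [divFn_congr hV h1, divFn_sum, fn_sum_apply, Finset.mul_sum]
    exact Finset.sum_congr rfl fun k _ => by
      rw [density_mul_divFn hV hp k (f k) hD', fderiv_inChart (hs k) hy]
  rw [setIntegral_congr_fun (isOpen_extChartAt_target c).measurableSet key,
    integral_finsetSum]
  · refine Finset.sum_eq_zero fun k _ => ?_
    rw [setIntegral_eq_integral_of_forall_compl_eq_zero,
      integral_fderiv_eq_zero (contDiff_inChart (hts k) (hs k)) (hasCompactSupport_inChart (hts k))]
    intro y hy
    have : y ∉ extChartAt (𝓡 d) c '' tsupport (fun q => density (d := d) c q * f k q) := by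
      rintro ⟨q, hq, rfl⟩
      exact hy ((extChartAt (𝓡 d) c).map_source (hts k hq))
    have h1 : inChart (d := d) c (fun q => density (d := d) c q * f k q) =ᶠ[𝓝 y] fun _ => 0 := by
      filter_upwards [(isCompact_image_tsupport (hts k)).isClosed.isOpen_compl.mem_nhds this]
        with z hz
      exact inChart_eq_zero hz
    rw [h1.fderiv_eq]
    simp
  · intro k _
    have h1 := contDiff_inChart (hts k) (hs k)
    exact (((h1.continuous_fderiv one_ne_zero).clm_apply
      continuous_const).integrable_of_hasCompactSupport
        ((hasCompactSupport_inChart (hts k)).fderiv_apply ℝ _)).integrableOn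

/-- The divergence theorem. -/
theorem integral_divFn (Y : Vec d M) : ∫ p, divFn hV Y p ∂(riemannianVolume d M) = 0 := by
  obtain ⟨t, ht⟩ := isCompact_univ.elim_finite_subcover (fun c : M => (extChartAt (𝓡 d) c).source)
    (fun c => isOpen_extChartAt_source c) (fun x _ => Set.mem_iUnion.2 ⟨x, mem_extChartAt_source x⟩)
  obtain ⟨ρ, hρ⟩ := SmoothPartitionOfUnity.exists_isSubordinate (𝓡 d) isClosed_univ
    (fun c : t => (extChartAt (𝓡 d) (c : M)).source) (fun c => isOpen_extChartAt_source _)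
    (by simpa [Set.iUnion_subtype] using ht)
  have hY : Y = ∑ c : t, (ρ c : Fn d M) • Y := by
    ext1 p
    rw [vec_sum_apply]
    simp only [smul_vec_apply]
    rw [← Finset.sum_smul, ← finsum_eq_sum_of_fintype]
    have := ρ.sum_eq_one (Set.mem_univ p)
    rw [this, one_smul]
  rw [hY, divFn_sum]
  simp only [fn_sum_apply]
  rw [integral_finsetSum _ fun c _ => integrable_fn _]
  exact Finset.sum_eq_zero fun c _ => integral_divFn_smul hV (hρ c) Y

end TGFoliation

/-! ### The flux field whose divergence compares the rough Laplacian with the horizontal gradient.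
-/

namespace FoliatedLieRinehart

variable {R L : Type*} [CommRing R] [AddCommGroup L] [Module R L] (F : FoliatedLieRinehart R L)

lemma dualConn_add_left (r : R) (X X' S : L) :
    F.dualConn r (X + X') S = F.dualConn r X S + F.dualConn r X' S := by
  simp only [dualConn, map_add, AddMonoidHom.add_apply, jop_add_right, tor_add_left]; module

lemma dualConn_smul_left (r f : R) (X S : L) :
    F.dualConn r (f • X) S = f • F.dualConn r X S := by
  simp only [dualConn, nab_smul_left, jop_smul_right, tor_smul_left]; module

/-- The form `(X, W) ↦ ⟨∇^ε_X S, ∇^ε_W N⟩_ε`. -/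
def gradForm (e r : R) (S N : L) : L →ₗ[R] L →ₗ[R] R :=
  LinearMap.mk₂ R (fun X W => F.ipE e (F.dualConn r X S) (F.dualConn r W N))
    (fun X X' W => by simp [dualConn_add_left]) (fun f X W => by simp [dualConn_smul_left])
    (fun X W W' => by simp [dualConn_add_left]) (fun f X W => by simp [dualConn_smul_left])

/-- The one-form `X ↦ ⟨∇^ε_{X_H} S, N⟩_ε`. -/
def fluxForm (e r : R) (S N : L) : L →ₗ[R] R where
  toFun X := F.ipE e (F.dualConn r (F.ph X) S) N
  map_add' X X' := by simp [dualConn_add_left]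
  map_smul' f X := by simp [dualConn_smul_left]

lemma gradForm_apply (e r : R) (S N X W : L) :
    F.gradForm e r S N X W = F.ipE e (F.dualConn r X S) (F.dualConn r W N) := rfl

lemma fluxForm_of_horizontal (e r : R) (S N : L) {X : L} (hX : F.pv X = 0) :
    F.fluxForm e r S N X = F.ipE e (F.dualConn r X S) N := by
  simp only [fluxForm, LinearMap.coe_mk, AddHom.coe_mk, F.eq_ph hX]

lemma pv_sharp_fluxForm (e r : R) (S N : L) : F.pv (F.sharp (F.fluxForm e r S N)) = 0 := by
  refine F.eq_of_ip fun W => ?_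
  rw [F.ip_pv, F.ip_sharp]
  simp [fluxForm, dualConn, ← jopL_apply, ← torL_apply]

lemma lcForm_of_horizontal {Y E : L} (hY : F.pv Y = 0) (hE : F.pv E = 0) :
    F.lcForm Y E E = F.ip (F.nab E Y) E := by
  have h : F.nab E Y = F.ph (F.lc E Y) := by
    simp [nab_def, bott, hE, hY, F.eq_ph hE, F.eq_ph hY, lc_zero_right]
  rw [lcForm_apply, h, F.ip_of_horizontal hE]

/-- Because the leaves are totally geodesic, the divergence of a horizontal field is a horizontal
trace. -/
lemma lcForm_of_vertical {Y Z : L} (hY : F.pv Y = 0) (hZ : F.pv Z = Z) :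
    F.lcForm Y Z Z = 0 := by
  have := F.ip_lc_vertical Y Z Z
  rwa [hZ, F.eq_ph hY] at this

/-- The derivative of `⟨∇^ε_E S, N⟩_ε` along `E` is expanded twice: through the flux field, using
that the Bott connection is metric, and through `der_ipE`. -/
lemma ip_nab_sharp_fluxForm (e r : R) (he : ∀ X, F.der X e = 0) (her : e * r = 1) (S N : L) {E : L}
    (hE : F.pv E = 0) : F.ip (F.nab E (F.sharp (F.fluxForm e r S N))) E
      = F.ipE e (F.dualConn r E (F.dualConn r E S) - F.dualConn r (F.nab E E) S) N
        + F.gradForm e r S N E E := by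
  have h1 := F.der_ip E (F.sharp (F.fluxForm e r S N)) E
  have h2 := F.der_ipE e r he her E (F.dualConn r E S) N
  have h3 : F.pv (F.nab E E) = 0 := by rw [pv_nab, hE, map_zero]
  rw [F.ip_sharp, F.ip_sharp] at h1
  rw [F.fluxForm_of_horizontal e r S N hE, F.fluxForm_of_horizontal e r S N h3] at h1
  rw [gradForm_apply, map_sub, LinearMap.sub_apply]
  linear_combination h2 - h1

end FoliatedLieRinehart

/-! ### The rough Laplacian as the negative adjoint of the horizontal gradient. -/

namespace TGFoliation
open Topology

variable {d : ℕ} {M : Type*} [TopologicalSpace M]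
  [ChartedSpace (EuclideanSpace ℝ (Fin d)) M] [IsManifold (𝓡 d) ∞ M]
  [Bundle.RiemannianBundle (fun x : M => TangentSpace (𝓡 d) x)]
  [IsContMDiffRiemannianBundle (𝓡 d) ∞ (EuclideanSpace ℝ (Fin d))
      (fun x : M => TangentSpace (𝓡 d) x)]
  {V : Distribution d M} [T2Space M] {m : ℕ}
  (hV : IsTotallyGeodesicRiemannianFoliation m V)

lemma divFn_of_horizontal {Y : Vec d M} (hY : (lieRinehart hV).pv Y = 0) {x : M} {ι : Type*}
    [Fintype ι] {b : ι → Vec d M} (hp : ∀ i, (lieRinehart hV).pv (b i) = 0)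
    (hb : Orthonormal ℝ fun i => b i x)
    (hS : Submodule.span ℝ (Set.range fun i => b i x) = (V x)ᗮ) :
    divFn hV Y x = ∑ i, (lieRinehart hV).ip ((lieRinehart hV).nab (b i) Y) (b i) x := by
  obtain ⟨E, Z, -, hZ, h⟩ := exists_adapted_frame hV.smooth x
  obtain ⟨-, hz, hz'⟩ := h.self_of_nhds
  have e1 : frameSum (V x) (fun e => evB x ((lieRinehart hV).lcForm Y) e e) = 0 := by
    refine (frameSum_evB ((lieRinehart hV).lcForm Y) hz hz').trans
      (Finset.sum_eq_zero fun i _ => ?_)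
    rw [(lieRinehart hV).lcForm_of_vertical hY (hZ i)]; rfl
  rw [divFn_apply, frameSum_top (V x), e1, add_zero]
  refine (frameSum_evB ((lieRinehart hV).lcForm Y) hb hS).trans
    (Finset.sum_congr rfl fun i _ => ?_)
  rw [(lieRinehart hV).lcForm_of_horizontal hY (hp i)]

/-- The rough Laplacian of a one-form on smooth vector fields. -/
def roughForm (r : Fn d M) (a : Vec d M →ₗ[Fn d M] Fn d M) : Vec d M →ₗ[Fn d M] Fn d M where
  toFun W := traceH hV.smooth (((lieRinehart hV).hess r a).compr₂ (LinearMap.applyₗ W))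
  map_add' W W' := by
    rw [← traceH_add]
    congr 1
    ext X Y : 2
    simp
  map_smul' f W := by
    rw [RingHom.id_apply, smul_eq_mul, ← traceH_smul]
    congr 1
    ext X Y : 2
    simp

variable {hV} {α : CoField d M} {a : Vec d M →ₗ[Fn d M] Fn d M}

variable (hV) in
-- This is the source of the smoothness of the rough Laplacian, which membership in the domain of
-- the adjoint relation requires.
lemma Represents.roughLaplacian_form (h : Represents α a) (ε : ℝ≥0∞) :
    Represents (TGFoliation.roughLaplacian V ε α) (roughForm hV (recipFn ε) a) := by
  refine represents_of_apply fun W x => ?_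
  obtain ⟨b, Z, -, -, hb⟩ := exists_adapted_frame hV.smooth x
  obtain ⟨⟨hb, hS⟩, -⟩ := hb.self_of_nhds
  rw [h.roughLaplacian hV ε hb hS W]
  exact (frameSum_evB (((lieRinehart hV).hess (recipFn ε) a).compr₂ (LinearMap.applyₗ W)) hb hS).symm

lemma innerEps_apply (ε : ℝ≥0∞) {β : CoField d M} {S N : Vec d M}
    (h : Represents α ((lieRinehart hV).ip S)) (h' : Represents β ((lieRinehart hV).ip N)) (x : M) :
    innerEps V ε x (α x) (β x) = (lieRinehart hV).ipE (constFn ε.toReal) S N x := by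
  obtain ⟨b, z, -, -, hb⟩ := exists_adapted_frame hV.smooth x
  obtain ⟨⟨hb, hS⟩, hz, hS'⟩ := hb.self_of_nhds
  have hα : ∀ e, α x e = inner ℝ (S x) e := fun e => by
    rw [h x e, lieRinehart_ip_apply, gext_self]
  have hβ : ∀ e, β x e = inner ℝ (N x) e := fun e => by
    rw [h' x e, lieRinehart_ip_apply, gext_self]
  have key : ∀ {ι : Type} [Fintype ι] {b : ι → TangentSpace (𝓡 d) x}
      {S' : Submodule ℝ (TangentSpace (𝓡 d) x)}, S'.HasOrthogonalProjection → Orthonormal ℝ b →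
      Submodule.span ℝ (Set.range b) = S' → frameSum S' (fun e => α x e * β x e)
        = inner ℝ (S'.starProjection (S x)) (S'.starProjection (N x)) := by
    intro ι _ b S' _ hb hS
    obtain ⟨u, hu, hu', hu2⟩ := exists_orthonormal_span S'
    rw [hu2, inner_eq_sum hu hu' _ (Submodule.starProjection_apply_mem _ _)]
    refine Finset.sum_congr rfl fun i _ => ?_
    have hi := Submodule.starProjection_eq_self_iff.2 (mem_of_span_eq hu' i)
    rw [hα, hβ, Submodule.inner_starProjection_left_eq_right,
      Submodule.inner_starProjection_left_eq_right, hi]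
  rw [innerEps, key inferInstance hb hS, key inferInstance hz hS',
    FoliatedLieRinehart.ipE_apply, fn_add_apply, fn_mul_apply, lieRinehart_ip_apply,
    lieRinehart_ip_apply, ← projH_apply, ← projH_apply, ← projV_apply, ← projV_apply]
  rfl

lemma innerGradEps_apply (ε : ℝ≥0∞) {β : CoField d M} {S N : Vec d M}
    (h : Represents α ((lieRinehart hV).ip S)) (h' : Represents β ((lieRinehart hV).ip N)) (x : M) :
    innerGradEps V ε α β x = traceH hV.smooth
      ((lieRinehart hV).gradForm (constFn ε.toReal) (recipFn ε) S N) x := by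
  rw [traceH_apply, innerGradEps]
  congr 1
  funext e
  rw [(isLocalOp_connEps ε).covForm (ext_eventually e)
      (Filter.Eventually.of_forall fun y => rfl : ∀ᶠ y in 𝓝 x, α y = α y),
    (isLocalOp_connEps ε).covForm (ext_eventually e)
      (Filter.Eventually.of_forall fun y => rfl : ∀ᶠ y in 𝓝 x, β y = β y)]
  have h1 := h.covForm hV ε (gext x e)
  have h2 := h'.covForm hV ε (gext x e)
  rw [FoliatedLieRinehart.cnF_ip] at h1 h2
  rw [innerEps_apply ε h1 h2]
  rfl

lemma toReal_mul_recip {ε : ℝ≥0∞} (h0 : 0 < ε) (h : ε ≠ ⊤) : ε.toReal * recip ε = 1 := by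
  rw [recip, ENNReal.toReal_inv]
  exact mul_inv_cancel₀ (ENNReal.toReal_pos h0.ne' h).ne'

/-- This is integration by parts before integrating: `ip_nab_sharp_fluxForm` summed over a
horizontal frame. -/
lemma innerEps_add_innerGradEps {ε : ℝ≥0∞} (h0 : 0 < ε) (hε : ε ≠ ⊤) {β : CoField d M}
    {S N : Vec d M} (h : Represents α ((lieRinehart hV).ip S))
    (h' : Represents β ((lieRinehart hV).ip N)) (x : M) :
    innerEps V ε x (roughLaplacian V ε α x) (β x) + innerGradEps V ε α β x
      = divFn hV ((lieRinehart hV).sharp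
        ((lieRinehart hV).fluxForm (constFn ε.toReal) (recipFn ε) S N)) x := by
  set F := lieRinehart hV with hF
  set r : Fn d M := recipFn ε
  set e : Fn d M := constFn ε.toReal with he
  have her : e * r = 1 := by
    ext y; exact toReal_mul_recip h0 hε
  obtain ⟨b, z, hp, -, hb⟩ := exists_adapted_frame hV.smooth x
  replace hp : ∀ i, F.pv (b i) = 0 := hp
  obtain ⟨⟨hb, hS⟩, -⟩ := hb.self_of_nhds
  have hL := h.roughLaplacian_form hV ε
  have hL' : Represents (roughLaplacian V ε α) (F.ip (F.sharp (roughForm hV r (F.ip S)))) := by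
    refine represents_of_apply fun W y => ?_
    rw [hL.apply, F.ip_sharp]
  let T : Vec d M := ∑ i, (F.dualConn r (b i) (F.dualConn r (b i) S)
    - F.dualConn r (F.nab (b i) (b i)) S)
  -- The field `T` is tied to a frame adapted at `x`, so the two fields are compared only at `x`;
  -- this suffices because the scaled metric is tensorial.
  have hT : F.sharp (roughForm hV r (F.ip S)) x = T x := by
    refine ext_inner_right ℝ fun w => ?_
    have h0 := h.roughLaplacian hV ε hb hS (gext x w)
    have h1 := (hL'.apply (gext x w) x).symm.trans (h0.trans (Finset.sum_congr rfl fun i _ =>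
      congrArg (fun f : Fn d M => f x) (F.rough_ip r S (gext x w) (hp i))))
    have h2 : ∑ i, F.ip (F.dualConn r (b i) (F.dualConn r (b i) S)
        - F.dualConn r (F.nab (b i) (b i)) S) (gext x w) x = F.ip T (gext x w) x := by
      simp only [T, map_sum, LinearMap.sum_apply, fn_sum_apply]
    have h3 := h1.trans h2
    rw [hF, lieRinehart_ip_apply, lieRinehart_ip_apply, gext_self] at h3
    exact h3
  rw [innerEps_apply ε hL' h', innerGradEps_apply ε h h', tensor_congr₂ (F.ipE e) hT rfl,
    divFn_of_horizontal hV (F.pv_sharp_fluxForm e r S N) hp hb hS]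
  have h4 : traceH hV.smooth (F.gradForm e r S N) x = ∑ i, F.gradForm e r S N (b i) (b i) x :=
    frameSum_evB (F.gradForm e r S N) hb hS
  have h5 : F.ipE e T N x = ∑ i, F.ipE e (F.dualConn r (b i) (F.dualConn r (b i) S)
        - F.dualConn r (F.nab (b i) (b i)) S) N x := by
    simp only [T, map_sum, LinearMap.sum_apply, fn_sum_apply]
  rw [h4, h5, ← Finset.sum_add_distrib]
  refine Finset.sum_congr rfl fun i _ => ?_
  rw [← hF, F.ip_nab_sharp_fluxForm e r (fun X => derV_const X _) her S N (hp i)]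
  rfl

variable [MeasurableSpace M] [BorelSpace M] [CompactSpace M]

lemma integrable_innerEps (ε : ℝ≥0∞) {β : CoField d M} {S N : Vec d M}
    (h : Represents α ((lieRinehart hV).ip S)) (h' : Represents β ((lieRinehart hV).ip N)) :
    Integrable (fun x => innerEps V ε x (α x) (β x)) (riemannianVolume d M) := by
  simp only [innerEps_apply ε h h']
  exact integrable_fn _

lemma innerEps_self_pos {ε : ℝ≥0∞} (h0 : 0 < ε) (hε : ε ≠ ⊤) (D : Vec d M) (x : M) :
    0 ≤ (lieRinehart hV).ipE (constFn ε.toReal) D D x ∧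
      ((lieRinehart hV).ipE (constFn ε.toReal) D D x = 0 → D x = 0) := by
  have h1 : (lieRinehart hV).ipE (constFn ε.toReal) D D x
      = inner ℝ (projH V x (D x)) (projH V x (D x))
        + ε.toReal * inner ℝ (projV V x (D x)) (projV V x (D x)) := by
    rw [projH_apply hV, projV_apply hV]; rfl
  have hpos := ENNReal.toReal_pos h0.ne' hε
  rw [h1]
  have a1 := real_inner_self_nonneg (x := projH V x (D x))
  have a2 := real_inner_self_nonneg (x := projV V x (D x))
  have a3 := mul_nonneg hpos.le a2
  refine ⟨add_nonneg a1 a3, fun h => ?_⟩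
  have b1 : projH V x (D x) = 0 := inner_self_eq_zero (𝕜 := ℝ).1 (by linarith)
  have b2 : projV V x (D x) = 0 := by
    refine inner_self_eq_zero (𝕜 := ℝ).1 ?_
    rcases mul_eq_zero.1 (show ε.toReal * inner ℝ (projV V x (D x)) (projV V x (D x)) = 0 by
      linarith) with h | h
    · exact absurd h hpos.ne'
    · exact h
  rw [← projV_add_projH (V := V) x (D x), b1, b2, add_zero]

lemma fn_eq_zero_of_integral {f : Fn d M} (hf : ∀ x, 0 ≤ f x)
    (h : ∫ x, f x ∂(riemannianVolume d M) = 0) (x : M) : f x = 0 := by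
  have h1 := (integral_eq_zero_iff_of_nonneg hf (integrable_fn f)).1 h
  have h2 := Continuous.ae_eq_iff_eq (riemannianVolume d M) f.contMDiff.continuous
    (continuous_const (y := (0 : ℝ)))
  exact congrFun (h2.1 h1) x

/-- The adjoint formula for the rough Laplacian. -/
theorem isNegAdjointGrad_iff (hV : IsTotallyGeodesicRiemannianFoliation m V) {ε : ℝ≥0∞}
    (h0 : 0 < ε) (hε : ε ≠ ⊤) (hα : IsSmoothOneForm α) (β : CoField d M) :
    IsNegAdjointGrad V ε α β ↔ β = roughLaplacian V ε α := by
  obtain ⟨S, h⟩ := hα.exists_dual hV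
  have hs : IsSmoothOneForm (roughLaplacian V ε α) := (h.roughLaplacian_form hV ε).isSmoothOneForm
  obtain ⟨LS, hL⟩ := hs.exists_dual hV
  have hadj : IsNegAdjointGrad V ε α (roughLaplacian V ε α) := by
    refine ⟨hs, fun η hη => ?_⟩
    obtain ⟨N, hN⟩ := hη.exists_dual hV
    have h1 := integral_divFn hV ((lieRinehart hV).sharp
        ((lieRinehart hV).fluxForm (constFn ε.toReal) (recipFn ε) S N))
    simp only [← innerEps_add_innerGradEps h0 hε h hN] at h1
    rw [integral_add (integrable_innerEps ε hL hN)] at h1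
    · exact eq_neg_of_add_eq_zero_left h1
    · exact (integrable_fn _).congr
        (Filter.Eventually.of_forall fun x => (innerGradEps_apply ε h hN x).symm)
  refine ⟨fun hβ => ?_, fun hβ => hβ ▸ hadj⟩
  obtain ⟨B, hB⟩ := hβ.1.exists_dual hV
  -- Two candidates for the adjoint are tested against their difference, which leaves the integral
  -- of its squared norm.
  have hη : Represents (fun x w => (lieRinehart hV).ip (B - LS) (gext x w) x)
    ((lieRinehart hV).ip (B - LS)) := fun x w => rfl
  have h1 := (hβ.2 _ hη.isSmoothOneForm).trans (hadj.2 _ hη.isSmoothOneForm).symm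
  simp only [innerEps_apply ε hB hη, innerEps_apply ε hL hη] at h1
  have h2 : ∫ x, (lieRinehart hV).ipE (constFn ε.toReal) (B - LS) (B - LS) x
      ∂(riemannianVolume d M) = 0 := by
    have h3 := sub_eq_zero.2 h1
    rw [← integral_sub (integrable_fn _) (integrable_fn _)] at h3
    rw [← h3]
    congr 1
    funext x
    have h4 : ∀ D : Vec d M, (lieRinehart hV).ipE (constFn ε.toReal) (B - LS) D
        = (lieRinehart hV).ipE (constFn ε.toReal) B D
          - (lieRinehart hV).ipE (constFn ε.toReal) LS D := fun D => by
      rw [map_sub, LinearMap.sub_apply]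
    exact congrArg (fun f : Fn d M => f x) (h4 (B - LS))
  have h3 : ∀ x, B x = LS x := fun x => by
    have := (innerEps_self_pos (hV := hV) h0 hε (B - LS) x).2
      (fn_eq_zero_of_integral (fun x => (innerEps_self_pos h0 hε (B - LS) x).1) h2 x)
    exact sub_eq_zero.1 this
  funext x w
  rw [hB x w, hL x w, lieRinehart_ip_apply, lieRinehart_ip_apply, h3]

end TGFoliation

/-! ### The horizontal Laplacian on functions and its commutation with the differential. -/

namespace FoliatedLieRinehart

variable {R L : Type*} [CommRing R] [AddCommGroup L] [Module R L] (F : FoliatedLieRinehart R L)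

/-- Differentiating `⟨∇_H f, E⟩` along `E`, for `a = df`, shows that the divergence of the
horizontal gradient is the horizontal trace of the Bott Hessian. -/
lemma ip_nab_ph_sharp (a : L →ₗ[R] R) {E : L} (hE : F.pv E = 0) :
    F.ip (F.nab E (F.ph (F.sharp a))) E = F.nabF E a E := by
  have h := F.der_ip E (F.ph (F.sharp a)) E
  have h3 : F.pv (F.nab E E) = 0 := by rw [pv_nab, hE, map_zero]
  rw [F.ip_of_horizontal hE, F.ip_of_horizontal h3, F.ip_sharp, F.ip_sharp] at h
  rw [nabF_apply]
  linear_combination -h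

end FoliatedLieRinehart

namespace TGFoliation
open Topology

variable {d : ℕ} {M : Type*} [TopologicalSpace M]
  [ChartedSpace (EuclideanSpace ℝ (Fin d)) M] [IsManifold (𝓡 d) ∞ M]
  [Bundle.RiemannianBundle (fun x : M => TangentSpace (𝓡 d) x)]
  [IsContMDiffRiemannianBundle (𝓡 d) ∞ (EuclideanSpace ℝ (Fin d))
      (fun x : M => TangentSpace (𝓡 d) x)]
  {V : Distribution d M} [T2Space M] {m : ℕ}
  (hV : IsTotallyGeodesicRiemannianFoliation m V)

/-- The differential of a smooth function, on smooth vector fields. -/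
def dForm (f : Fn d M) : Vec d M →ₗ[Fn d M] Fn d M where
  toFun X := derV X f
  map_add' X Y := by rw [map_add, AddMonoidHom.add_apply]
  map_smul' g X := derV_smul g X f

lemma represents_dForm (f : Fn d M) : Represents (extD₀ f) (dForm f) :=
  represents_of_apply fun _ _ => rfl

/-- The horizontal gradient of a smooth function. -/
def gradHV (f : Fn d M) : Vec d M := (lieRinehart hV).ph ((lieRinehart hV).sharp (dForm f))

/-- The horizontal Laplacian of a smooth function, as the trace of its Bott Hessian. -/
def lapH (f : Fn d M) : Fn d M := traceH hV.smooth ((lieRinehart hV).nabFL (dForm f))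

lemma pv_gradHV (f : Fn d M) : (lieRinehart hV).pv (gradHV hV f) = 0 := by
  simp [gradHV]

lemma gradH_apply (f : Fn d M) (x : M) : gradH V f x = gradHV hV f x := by
  have h : Represents (extD₀ f) ((lieRinehart hV).ip ((lieRinehart hV).sharp (dForm f))) :=
    represents_of_apply fun W y => by rw [(lieRinehart hV).ip_sharp]; rfl
  rw [gradH, h.sharp_eq, projH_apply hV]
  rfl

lemma lapH_apply (f : Fn d M) {x : M} {ι : Type*} [Fintype ι] {b : ι → Vec d M}
    (hb : Orthonormal ℝ fun i => b i x)
    (hS : Submodule.span ℝ (Set.range fun i => b i x) = (V x)ᗮ) :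
    lapH hV f x = ∑ i, (lieRinehart hV).nabF (b i) (dForm f) (b i) x :=
  frameSum_evB ((lieRinehart hV).nabFL (dForm f)) hb hS

lemma divFn_gradHV (f : Fn d M) : divFn hV (gradHV hV f) = lapH hV f := by
  ext x
  obtain ⟨b, z, hp, -, hb⟩ := exists_adapted_frame hV.smooth x
  obtain ⟨⟨hb, hS⟩, -⟩ := hb.self_of_nhds
  rw [divFn_of_horizontal hV (pv_gradHV hV f) hp hb hS,
    lapH_apply hV f hb hS]
  refine Finset.sum_congr rfl fun i _ => ?_
  rw [gradHV, (lieRinehart hV).ip_nab_ph_sharp (dForm f) (hp i)]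

lemma divEps₁_extD₀ (f : Fn d M) (ε : ℝ≥0∞) :
    divEps₁ V ε (extD₀ f) = fun x => - lapH hV f x := by
  funext x
  obtain ⟨b, z, hp, -, hb⟩ := exists_adapted_frame hV.smooth x
  obtain ⟨⟨hb, hS⟩, -⟩ := hb.self_of_nhds
  rw [(represents_dForm f).divEps₁ hV ε hp hb hS, lapH_apply hV f hb hS]

lemma derV_gradHV (f u : Fn d M) :
    derV (gradHV hV f) u = (lieRinehart hV).ip (gradHV hV f) (gradHV hV u) := by
  have h : (lieRinehart hV).ip ((lieRinehart hV).sharp (dForm u)) (gradHV hV f)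
      = derV (gradHV hV f) u := (lieRinehart hV).ip_sharp _ _
  rw [← h, (lieRinehart hV).ip_comm (gradHV hV f), gradHV, gradHV,
    (lieRinehart hV).ip_of_horizontal (by simp)]

lemma extF_dForm (f : Fn d M) : (lieRinehart hV).extF (dForm f) = 0 := by
  refine LinearMap.ext fun X => LinearMap.ext fun Y => ?_
  have h := (lieRinehart hV).der_br X Y f
  exact sub_eq_zero.2 h.symm

lemma divEps₂_extD₁_extD₀ (hV : IsTotallyGeodesicRiemannianFoliation m V)
    (f : Fn d M) (ε : ℝ≥0∞) (x : M) (w : TangentSpace (𝓡 d) x) :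
    divEps₂ V ε (extD₁ (extD₀ f)) x w = 0 := by
  obtain ⟨b, z, -, -, hb⟩ := exists_adapted_frame hV.smooth x
  obtain ⟨⟨hb, hS⟩, -⟩ := hb.self_of_nhds
  rw [((represents_dForm f).extD₁ hV).divEps₂ hV ε hb hS w, extF_dForm, neg_eq_zero]
  refine Finset.sum_eq_zero fun i _ => ?_
  simp [FoliatedLieRinehart.cnF₂]

/-- The exterior derivative commutes with the horizontal Laplacians. -/
lemma extD₀_lapH (f : Fn d M) (ε : ℝ≥0∞) (x : M) (v : TangentSpace (𝓡 d) x) :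
    extD₀ (lapH hV f) x v = lapEps V ε (extD₀ f) x v := by
  have h : divEps₁ V ε (extD₀ f) = ⇑(- lapH hV f) := divEps₁_extD₀ hV f ε
  rw [lapEps_eq hV ε (represents_dForm f).isSmoothOneForm, divEps₂_extD₁_extD₀ hV, h, sub_zero,
    (represents_dForm (lapH hV f)) x v, (represents_dForm (-lapH hV f)) x v]
  have h2 : dForm (- lapH hV f) (gext x v) = - dForm (lapH hV f) (gext x v) :=
    map_neg (derV (gext x v)) _
  rw [h2, fn_neg_apply, neg_neg]

variable [MeasurableSpace M] [BorelSpace M] [CompactSpace M]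

lemma isHorizontalLaplacian_lapH (f : Fn d M) : IsHorizontalLaplacian V f (lapH hV f) := by
  refine ⟨(lapH hV f).contMDiff, fun u hu => ?_⟩
  let u' : Fn d M := ⟨u, hu⟩
  -- The divergence of this product is `⟨∇_H f, ∇_H u⟩ + u Δ_H f`.
  have h := integral_divFn hV (u' • gradHV hV f)
  rw [divFn_smul, divFn_gradHV, derV_gradHV] at h
  have h1 : ∫ x, ((lieRinehart hV).ip (gradHV hV f) (gradHV hV u') x + (u' * lapH hV f) x)
      ∂(riemannianVolume d M) = 0 := h
  rw [integral_add (integrable_fn _) (integrable_fn _)] at h1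
  have h2 : ∀ x, inner ℝ (gradH V f x) (gradH V u x)
      = (lieRinehart hV).ip (gradHV hV f) (gradHV hV u') x := fun x => by
    rw [gradH_apply hV f, show gradH V u x = _ from gradH_apply hV u' x, lieRinehart_ip_apply]
  simp only [h2]
  exact eq_neg_of_add_eq_zero_left h1

lemma IsHorizontalLaplacian.unique {f h h' : M → ℝ} (H : IsHorizontalLaplacian V f h)
    (H' : IsHorizontalLaplacian V f h') : h = h' := by
  let k : Fn d M := ⟨h, H.1⟩
  let k' : Fn d M := ⟨h', H'.1⟩
  -- Both weak formulas are tested with `u = h - h'`, which leaves the integral of a square.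
  have h1 := neg_injective ((H.2 _ (k - k').contMDiff).symm.trans (H'.2 _ (k - k').contMDiff))
  have h2 : ∫ x, ((k - k') * (k - k') : Fn d M) x ∂(riemannianVolume d M) = 0 := by
    have h3 : ∫ x, (k - k') x * k x ∂(riemannianVolume d M)
        - ∫ x, (k - k') x * k' x ∂(riemannianVolume d M) = 0 := sub_eq_zero.2 h1
    have e : ∀ j : Fn d M, Integrable (fun x => (k - k') x * j x) (riemannianVolume d M) :=
      fun j => integrable_fn ((k - k') * j)
    rw [← integral_sub (e k) (e k')] at h3
    rw [← h3]
    congr 1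
    funext x
    simp only [fn_mul_apply, fn_sub_apply]
    show (k x - k' x) * (k x - k' x) = (k x - k' x) * k x - (k x - k' x) * k' x
    ring
  funext x
  have h3 := fn_eq_zero_of_integral (fun x => mul_self_nonneg ((k - k') x)) h2 x
  exact sub_eq_zero.1 (mul_self_eq_zero.1 h3)

end TGFoliation

end

theorem mainTheorem5 {n m : ℕ} {M : Type*} [TopologicalSpace M]
    [ChartedSpace (EuclideanSpace ℝ (Fin (n + m))) M] [IsManifold (𝓡 (n + m)) ∞ M]
    [T2Space M] [CompactSpace M] [MeasurableSpace M] [BorelSpace M]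
    [Bundle.RiemannianBundle (fun x : M => TangentSpace (𝓡 (n + m)) x)]
    [IsContMDiffRiemannianBundle (𝓡 (n + m)) ∞ (EuclideanSpace ℝ (Fin (n + m)))
      (fun x : M => TangentSpace (𝓡 (n + m)) x)]
    (V : TGFoliation.Distribution (n + m) M)
    (hV : TGFoliation.IsTotallyGeodesicRiemannianFoliation m V)
    (ε : ℝ≥0∞) (hε : 0 < ε) :
    (∀ α : TGFoliation.CoField (n + m) M, TGFoliation.IsSmoothOneForm α →
      (ε ≠ ⊤ → ∀ β : TGFoliation.CoField (n + m) M,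
        TGFoliation.IsNegAdjointGrad V ε α β ↔ β = TGFoliation.roughLaplacian V ε α) ∧
      ∀ (x : M) (v : TangentSpace (𝓡 (n + m)) x),
        TGFoliation.lapEps V ε α x v
          = - TGFoliation.extD₀ (TGFoliation.divEps₁ V ε α) x v
            - TGFoliation.divEps₂ V ε (TGFoliation.extD₁ α) x v) ∧
    ∀ f : M → ℝ, TGFoliation.SmoothFun (d := n + m) f →
      (∃! h : M → ℝ, TGFoliation.IsHorizontalLaplacian V f h) ∧
      ∀ h : M → ℝ, TGFoliation.IsHorizontalLaplacian V f h →
        ∀ (x : M) (v : TangentSpace (𝓡 (n + m)) x),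
          TGFoliation.extD₀ h x v
            = TGFoliation.lapEps V ε (TGFoliation.extD₀ f) x v := by
  refine ⟨fun α hα => ⟨fun h β => TGFoliation.isNegAdjointGrad_iff hV hε h hα β,
    TGFoliation.lapEps_eq hV ε hα⟩, fun f hf => ?_⟩
  let f' : TGFoliation.Fn (n + m) M := ⟨f, hf⟩
  have H : TGFoliation.IsHorizontalLaplacian V f (TGFoliation.lapH hV f') :=
    TGFoliation.isHorizontalLaplacian_lapH hV f'
  refine ⟨⟨_, H, fun h hh => hh.unique H⟩, fun h hh x v => ?_⟩
  rw [hh.unique H]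
  exact TGFoliation.extD₀_lapH hV f' ε x v
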